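/- **Setting.** Let $C$ be an $(r,s)$-QLDPC CSS code on $n$ qubits, given by $X$-type and $Z$-type stabilizer generators $M_1,\dots,M_l$, $l<n$ (each generator has weight at most $r$, each qubit is involved in at most $s$ generators), with code space $\overline L$, minimum distance $d_{\min}$ and syndrome projectors $\Pi_\sigma=\prod_i\frac12(1+(-1)^{\sigma_i}M_i)$, $\sigma\in\{0,1\}^l$. The reduced weight $|\mathbf e|_{\rm red}$ of a Pauli error $X^{\mathbf e_x}Z^{\mathbf e_z}$ is the larger of the least Hamming weights of $\mathbf e_x$ and of $\mathbf e_z$ modulo $X$-type, respectively $Z$-type, stabilizers. For an operator $E$ on a code block and an auxiliary system, written $E=\sum_{\mathbf e}E_{\mathbf e}\otimes X^{\mathbf e_x}Z^{\mathbf e_z}$, its reduced weight with respect to the block is $|E|_{\rm red}=\max\{|\mathbf e|_{\rm red}:E_{\mathbf e}\ne0\}$ (and $0$ if $E=0$). A superoperator ${\cal V}$ has $|{\cal V}|_{\rm red}\le t$ with respect to a block if ${\cal V}=\sum_k E_k(\cdot)E_k'^\dagger$ with all $|E_k|_{\rm red},|E'_k|_{\rm red}\le t$. *Single-shot decoder.*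 Assume that $C$ has a single-shot decoder with constants $R,S,\beta>0$, where $\beta Sn+Rn<d_{\min}/2$: there is a controlled Pauli unitary $U_{\rm ec}=\sum_\sigma|\sigma\rangle\langle\sigma|\otimes P_\sigma$ on $l$ syndrome bits and $n$ qubits such that for every Pauli error $\mathbf e$ with $|\mathbf e|_{\rm red}\le\beta Sn+Rn$, every syndrome error $\mathbf e^{\rm syn}\in\{0,1\}^l$ of weight at most $Sn$ and every $\sigma$ there are a Pauli error $\mathbf e'$ with $|\mathbf e'|_{\rm red}\le\beta Sn$ and a phase $\varepsilon$, $|\varepsilon|=1$, such that for all $|\psi\rangle\in\overline L$ $$U_{\rm ec}\big(|\sigma\rangle\otimes\Pi_{\sigma\oplus\mathbf e^{\rm syn}}X^{\mathbf e_x}Z^{\mathbf e_z}|\psi\rangle\big)=\alpha\,\varepsilon\,|\sigma\rangle\otimes X^{\mathbf e'_x}Z^{\mathbf e'_z}|\psi\rangle ,$$ where $\alpha=1$ if $\sigma\oplus\mathbf e^{\rm syn}$ is the syndrome of $\mathbf e$ and $\alpha=0$ otherwise. Let ${\cal U}_{\rm ec}=U_{\rm ec}(\cdot)U_{\rm ec}^\dagger$.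 *Circuit and noise.* Let $\Phi$ be a syndrome extraction circuit of depth $d$ for $C$: layer $1$ prepares $l$ ancilla qubits in $|0\rangle$ or $|+\rangle$; layers $2,\dots,d-1$ consist of unitary gates (for example CNOTs), each on a single qubit or on one data and one ancilla qubit; layer $d$ measures the ancillas in the Pauli $Z$ or $X$ basis; waiting qubits undergo idle gates; and without noise $\Phi$ realizes $\rho\mapsto\sum_\sigma\Pi_\sigma\rho\Pi_\sigma\otimes|\sigma\rangle\langle\sigma|$. For $\delta\in[0,1]$ let $\mathrm{Trans}(\Phi,\delta)$ be the set of channels obtained by replacing the channel of each gate (including idle gates, preparations and measurements) by an arbitrary channel with the same input and output spaces, classical outputs remaining classical, at diamond distance at most $\delta$ from it. **Theorem.** Let $5\delta 2^{d+1}\le S$, let $\kappa=ed$ with $e=\exp(1)$, and let $h\ge1$ be an integer with $h\kappa e\exp(-n\delta/3)\le1$. Consider $h$ blocks of $C$ and a superoperator ${\cal V}$ on the $hn$ data qubits with $|{\cal V}|_{\rm red}\le\beta Sn+Rn$ with respect to every block. Let $\tilde{\cal T}_i\in\mathrm{Trans}(\Phi,\delta)$ for $i=1,\dots,h$. Then there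 is a superoperator ${\cal V}'$ on the $h$ blocks with $|{\cal V}'|_{\rm red}\le\beta Sn+5n\delta2^{d+1}$ with respect to every block, such that for every unit vector $|\psi\rangle\in\overline L^{\otimes h}$ with $\|{\cal V}(|\psi\rangle\langle\psi|)\|_1\le1$, $$\Big\|\Big(\bigotimes_{i=1}^h{\rm tr}_{A_i}\circ{\cal U}_{\rm ec}\circ\tilde{\cal T}_i\Big)\big({\cal V}(|\psi\rangle\langle\psi|)\big)-{\cal V}'(|\psi\rangle\langle\psi|)\Big\|_1<h\kappa e\exp(-n\delta/3),$$ where ${\rm tr}_{A_i}$ traces out the syndrome (ancilla) bits of block $i$. -/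

import Mathlib

open scoped BigOperators ENNReal Matrix

noncomputable section

namespace QEC

/-! ## Superoperators, trace norm, diamond norm, channels

A finite dimensional Hilbert space with orthonormal basis indexed by `I` is `I → ℂ`; operators on it
are `Matrix I I ℂ`.  A set `W` of qubits has the basis `W → ZMod 2` (bit strings on `W`). -/

/-- Superoperators from operators on `I → ℂ` to operators on `J → ℂ`. -/
abbrev SuperOp (I J : Type) := Matrix I I ℂ →ₗ[ℂ] Matrix J J ℂ

/-- The trace norm: the sum of the singular values. -/
def traceNorm {I : Type} [Fintype I] [DecidableEq I] (A : Matrix I I ℂ) : ℝ :=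
  ∑ i, Real.sqrt ((Matrix.isHermitian_conjTranspose_mul_self A).eigenvalues i)

/-- `(id_G ⊗ T) ρ` for a reference system with basis `G`. -/
def amplify {I J : Type} (G : Type) (T : SuperOp I J) (ρ : Matrix (G × I) (G × I) ℂ) :
    Matrix (G × J) (G × J) ℂ :=
  Matrix.of fun x y => T (Matrix.of fun c d => ρ (x.1, c) (y.1, d)) x.2 y.2

/-- The diamond norm `sup_G sup_{‖ρ‖₁ ≤ 1} ‖(id_G ⊗ T) ρ‖₁`, as an extended nonnegative real. -/
def dnorm {I J : Type} [Fintype I] [DecidableEq I] [Fintype J] [DecidableEq J]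
    (T : SuperOp I J) : ℝ≥0∞ :=
  ⨆ (k : ℕ) (ρ : Matrix (Fin k × I) (Fin k × I) ℂ) (_ : traceNorm ρ ≤ 1),
    ENNReal.ofReal (traceNorm (amplify (Fin k) T ρ))

/-- Quantum channels (completely positive trace preserving maps), in Kraus form. -/
def IsChannel {I J : Type} [Fintype I] [DecidableEq I] [Fintype J] (T : SuperOp I J) : Prop :=
  ∃ (r : ℕ) (K : Fin r → Matrix J I ℂ),
    (∀ ρ, T ρ = ∑ i, K i * ρ * (K i)ᴴ) ∧ ∑ i, (K i)ᴴ * K i = 1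

/-- The superoperator `E (·) F†`. -/
def sandwich {I J : Type} [Fintype I] (E F : Matrix J I ℂ) : SuperOp I J where
  toFun ρ := E * ρ * Fᴴ
  map_add' ρ τ := by rw [Matrix.mul_add, Matrix.add_mul]
  map_smul' c ρ := by simp

/-- The tensor product `⨂ⱼ Tⱼ` of superoperators, where the identifications `f`, `g` present the
basis `K` (resp. `L`) as the product basis of the factors. It is the unique linear map with
`|c⟩⟨d| ↦ ⨂ⱼ Tⱼ(|cⱼ⟩⟨dⱼ|)`. -/
def tensorOp {ι : Type} [Fintype ι] {I J : ι → Type} [∀ j, DecidableEq (I j)]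
    {K L : Type} [Fintype K] (f : K ≃ ∀ j, I j) (g : L ≃ ∀ j, J j)
    (T : ∀ j, SuperOp (I j) (J j)) : SuperOp K L where
  toFun ρ := Matrix.of fun a b => ∑ c, ∑ d,
    ρ c d * ∏ j, T j (Matrix.single (f c j) (f d j) 1) (g a j) (g b j)
  map_add' ρ τ := by
    ext a b
    simp [add_mul, Finset.sum_add_distrib]
  map_smul' c ρ := by
    ext a b
    simp [Finset.mul_sum, mul_assoc]

/-! ## Pauli operators -/

/-- `(-1)^z` for a bit `z`. -/
def sgn (z : ZMod 2) : ℂ := if z = 0 then 1 else -1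

/-- `X^e = ⨂ᵢ X^{eᵢ}`. -/
def Xop {W : Type} [Fintype W] [DecidableEq W] (e : W → ZMod 2) : Matrix (W → ZMod 2) (W → ZMod 2) ℂ :=
  Matrix.of fun a b => if ∀ w, a w = b w + e w then 1 else 0

/-- `Z^e = ⨂ᵢ Z^{eᵢ}`. -/
def Zop {W : Type} [Fintype W] [DecidableEq W] (e : W → ZMod 2) :
    Matrix (W → ZMod 2) (W → ZMod 2) ℂ :=
  Matrix.of fun a b => if ∀ w, a w = b w then sgn (∑ w, e w * a w) else 0

/-- The Hadamard operator on every qubit of `W`. -/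
def hadamard (W : Type) [Fintype W] : Matrix (W → ZMod 2) (W → ZMod 2) ℂ :=
  Matrix.of fun a b => ((Real.sqrt 2 : ℂ)⁻¹) ^ Fintype.card W * sgn (∑ w, a w * b w)

/-! ## CSS codes -/

/-- A CSS code on `n` qubits, given by `lX` generators of `X` type and `lZ` generators of `Z` type:
the rows of the parity check matrices `hX` and `hZ`. -/
structure CSSCode (n lX lZ : ℕ) where
  hX : Matrix (Fin lX) (Fin n) (ZMod 2)
  hZ : Matrix (Fin lZ) (Fin n) (ZMod 2)
  comm : hX * hZᵀ = 0

/-- Labels of the generators, and of the ancilla qubits measuring them. -/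
abbrev Anc (lX lZ : ℕ) := Fin lX ⊕ Fin lZ

namespace CSSCode

variable {n lX lZ : ℕ} (C : CSSCode n lX lZ)

/-- The stabilizer generators. -/
def gen : Anc lX lZ → Matrix (Fin n → ZMod 2) (Fin n → ZMod 2) ℂ
  | Sum.inl i => Xop (C.hX i)
  | Sum.inr j => Zop (C.hZ j)

/-- Every generator has weight at most `r`, every qubit is involved in at most `s` generators. -/
def IsQLDPC (r s : ℕ) : Prop :=
  (∀ i, hammingNorm (C.hX i) ≤ r) ∧ (∀ j, hammingNorm (C.hZ j) ≤ r) ∧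
    ∀ q, hammingNorm (fun i => C.hX i q) + hammingNorm (fun j => C.hZ j q) ≤ s

/-- The code space: the joint `+1` eigenspace of the generators. -/
def codeSpace : Set ((Fin n → ZMod 2) → ℂ) := {ψ | ∀ k, C.gen k *ᵥ ψ = ψ}

/-- `X`-type stabilizers. -/
def stabX : Submodule (ZMod 2) (Fin n → ZMod 2) := Submodule.span (ZMod 2) (Set.range C.hX)

/-- `Z`-type stabilizers. -/
def stabZ : Submodule (ZMod 2) (Fin n → ZMod 2) := Submodule.span (ZMod 2) (Set.range C.hZ)

/-- The minimum distance: the least weight of an `X`- or `Z`-type operator that commutes with all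
generators and is not a stabilizer. (There is one as soon as `lX + lZ < n`.) -/
def minDist : ℕ :=
  sInf {w | ∃ e : Fin n → ZMod 2,
    ((C.hZ *ᵥ e = 0 ∧ e ∉ C.stabX) ∨ (C.hX *ᵥ e = 0 ∧ e ∉ C.stabZ)) ∧ hammingNorm e = w}

/-- The projector `Π_σ = ∏ᵢ (1 + (-1)^{σᵢ} Mᵢ) / 2`; the factors commute. -/
def proj (σ : Anc lX lZ → ZMod 2) : Matrix (Fin n → ZMod 2) (Fin n → ZMod 2) ℂ :=
  (List.ofFn fun i : Fin lX => (1 / 2 : ℂ) • (1 + sgn (σ (Sum.inl i)) • C.gen (Sum.inl i))).prod *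
  (List.ofFn fun j : Fin lZ => (1 / 2 : ℂ) • (1 + sgn (σ (Sum.inr j)) • C.gen (Sum.inr j))).prod

/-- The syndrome of the Pauli error `X^{e.1} Z^{e.2}`. -/
def syndrome (e : (Fin n → ZMod 2) × (Fin n → ZMod 2)) : Anc lX lZ → ZMod 2
  | Sum.inl i => (C.hX *ᵥ e.2) i
  | Sum.inr j => (C.hZ *ᵥ e.1) j

/-- Stabilizer reduced weight of the Pauli error `X^{e.1} Z^{e.2}`. -/
def redWeight (e : (Fin n → ZMod 2) × (Fin n → ZMod 2)) : ℕ :=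
  max (sInf {w | ∃ s ∈ C.stabX, hammingNorm (e.1 + s) = w})
    (sInf {w | ∃ s ∈ C.stabZ, hammingNorm (e.2 + s) = w})

end CSSCode

/-- For `E` acting on a code block and an auxiliary system with basis `N`, the operator
`E_e = 2⁻ⁿ tr_{[n]} (E (1 ⊗ Z^{e.2} X^{e.1}))` on the auxiliary system, so that
`E = ∑ₑ E_e ⊗ X^{e.1} Z^{e.2}`. -/
def pauliCoeff {n : ℕ} {N : Type}
    (E : Matrix (N × (Fin n → ZMod 2)) (N × (Fin n → ZMod 2)) ℂ)
    (e : (Fin n → ZMod 2) × (Fin n → ZMod 2)) : Matrix N N ℂ :=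
  Matrix.of fun x y => ((2 : ℂ) ^ n)⁻¹ * ∑ u, ∑ v, E (x, u) (y, v) * (Zop e.2 * Xop e.1) v u

open Classical in
/-- Reduced weight, with respect to the code block, of an operator on auxiliary system and block. -/
def CSSCode.opRedWeight {n lX lZ : ℕ} (C : CSSCode n lX lZ) {N : Type}
    (E : Matrix (N × (Fin n → ZMod 2)) (N × (Fin n → ZMod 2)) ℂ) : ℕ :=
  (Finset.univ.filter fun e => pauliCoeff E e ≠ 0).sup C.redWeight

/-! ## Several code blocks -/

/-- The basis of the data qubits of `h` blocks of `n` qubits. -/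
abbrev Blocks (h n : ℕ) := Fin h → Fin n → ZMod 2

/-- Split off the `i`-th block, the other blocks being the auxiliary system. -/
def splitBlock {h n : ℕ} (i : Fin h) :
    Blocks h n ≃ ({k : Fin h // k ≠ i} → Fin n → ZMod 2) × (Fin n → ZMod 2) :=
  (Equiv.funSplitAt i (Fin n → ZMod 2)).trans (Equiv.prodComm _ _)

/-- Reduced weight, with respect to the `i`-th block, of an operator on `h` blocks. -/
def CSSCode.blockRedWeight {n lX lZ h : ℕ} (C : CSSCode n lX lZ) (i : Fin h)
    (E : Matrix (Blocks h n) (Blocks h n) ℂ) : ℕ :=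
  C.opRedWeight (Matrix.reindex (splitBlock i) (splitBlock i) E)

/-- `|V|_red ≤ t` with respect to the `i`-th block: `V = ∑ Eₖ (·) Fₖ†` for operators `Eₖ`, `Fₖ` whose
reduced weight with respect to that block is at most `t`. -/
def CSSCode.RedWeightLE {n lX lZ h : ℕ} (C : CSSCode n lX lZ) (i : Fin h)
    (V : SuperOp (Blocks h n) (Blocks h n)) (t : ℝ) : Prop :=
  ∃ (r : ℕ) (E F : Fin r → Matrix (Blocks h n) (Blocks h n) ℂ),
    V = ∑ k, sandwich (E k) (F k) ∧
      ∀ k, (C.blockRedWeight i (E k) : ℝ) ≤ t ∧ (C.blockRedWeight i (F k) : ℝ) ≤ t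

/-- The tensor product of the code spaces of `h` blocks. -/
def CSSCode.blockCodeSpace {n lX lZ : ℕ} (C : CSSCode n lX lZ) (h : ℕ) :
    Submodule ℂ (Blocks h n → ℂ) :=
  Submodule.span ℂ {Ψ | ∃ φ : Fin h → (Fin n → ZMod 2) → ℂ,
    (∀ i, φ i ∈ C.codeSpace) ∧ Ψ = fun a => ∏ i, φ i (a i)}

/-- The operator `|ψ⟩⟨ψ|`. -/
def ketBra {I : Type} (ψ : I → ℂ) : Matrix I I ℂ := Matrix.vecMulVec ψ (star ψ)

/-- The tensor product of superoperators, one for each block. -/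
def blockTensor {h n : ℕ} (T : Fin h → SuperOp (Fin n → ZMod 2) (Fin n → ZMod 2)) :
    SuperOp (Blocks h n) (Blocks h n) :=
  tensorOp (Equiv.refl _) (Equiv.refl _) T

/-! ## Error correction -/

/-- `|φ⟩_D ⊗ |σ⟩_A`. -/
def withSyndrome {D A : Type} [Fintype A] (φ : (D → ZMod 2) → ℂ) (σ : A → ZMod 2) :
    (D ⊕ A → ZMod 2) → ℂ :=
  fun a => if ∀ k, a (Sum.inr k) = σ k then φ (fun q => a (Sum.inl q)) else 0

/-- A decoder: the Pauli correction `X^{e.1} Z^{e.2}` to be applied for each observed syndrome. -/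
abbrev Decoder (n lX lZ : ℕ) :=
  (Anc lX lZ → ZMod 2) → (Fin n → ZMod 2) × (Fin n → ZMod 2)

/-- The controlled Pauli operator `U_ec = ∑_σ |σ⟩⟨σ|_A ⊗ X^{(dec σ).1} Z^{(dec σ).2}`. -/
def Decoder.Uec {n lX lZ : ℕ} (dec : Decoder n lX lZ) :
    Matrix (Fin n ⊕ Anc lX lZ → ZMod 2) (Fin n ⊕ Anc lX lZ → ZMod 2) ℂ :=
  Matrix.of fun a b =>
    if ∀ k : Anc lX lZ, a (Sum.inr k) = b (Sum.inr k) then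
      (Xop (dec fun k => a (Sum.inr k)).1 * Zop (dec fun k => a (Sum.inr k)).2)
        (fun q => a (Sum.inl q)) (fun q => b (Sum.inl q))
    else 0

/-- The single-shot decoding property with constants `R`, `S`, `β`: for a data error of reduced weight
at most `β S n + R n` and a syndrome error of weight at most `S n`, correction according to the
observed syndrome `σ` leaves, on all code states and up to a global phase `ε`, a Pauli error of
reduced weight at most `β S n`; the observation has amplitude `0` unless `σ + esyn` is the syndrome
of the data error. -/
def Decoder.IsSingleShot {n lX lZ : ℕ} (dec : Decoder n lX lZ) (C : CSSCode n lX lZ)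
    (R S β : ℝ) : Prop :=
  ∀ (e : (Fin n → ZMod 2) × (Fin n → ZMod 2)) (esyn : Anc lX lZ → ZMod 2),
    (C.redWeight e : ℝ) ≤ β * S * n + R * n → (hammingNorm esyn : ℝ) ≤ S * n →
    ∀ σ : Anc lX lZ → ZMod 2, ∃ (e' : (Fin n → ZMod 2) × (Fin n → ZMod 2)) (ε : ℂ),
      (C.redWeight e' : ℝ) ≤ β * S * n ∧ ‖ε‖ = 1 ∧ ∀ ψ ∈ C.codeSpace,
        dec.Uec *ᵥ withSyndrome (C.proj (σ + esyn) *ᵥ ((Xop e.1 * Zop e.2) *ᵥ ψ)) σ =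
          (if ∀ k, (σ + esyn) k = C.syndrome e k then ε else 0) •
            withSyndrome ((Xop e'.1 * Zop e'.2) *ᵥ ψ) σ

/-- Tracing out the qubits of `A`. -/
def traceAnc {D A : Type} [Fintype A] [DecidableEq A] : SuperOp (D ⊕ A → ZMod 2) (D → ZMod 2) where
  toFun ρ := Matrix.of fun a b => ∑ σ : A → ZMod 2, ρ (Sum.elim a σ) (Sum.elim b σ)
  map_add' ρ τ := by
    ext a b
    simp [Finset.sum_add_distrib]
  map_smul' c ρ := by
    ext a b
    simp [Finset.mul_sum]

/-- `tr_A ∘ 𝒰_ec`. -/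
def Decoder.correct {n lX lZ : ℕ} (dec : Decoder n lX lZ) :
    SuperOp (Fin n ⊕ Anc lX lZ → ZMod 2) (Fin n → ZMod 2) :=
  traceAnc ∘ₗ sandwich dec.Uec dec.Uec

/-! ## Circuit layers and general circuit noise -/

/-- The register of wires assigned to the location `j`. -/
abbrev Reg {W Loc : Type} (r : W → Loc) (j : Loc) := {w : W // r w = j}

/-- A bit string on `W` is a family of bit strings on the registers of a partition of `W`. -/
def regEquiv {W Loc : Type} (r : W → Loc) : (W → ZMod 2) ≃ ∀ j, (Reg r j → ZMod 2) where
  toFun a := fun j w => a w.1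
  invFun b := fun w => b (r w) ⟨w, rfl⟩
  left_inv a := rfl
  right_inv b := by
    funext j w
    obtain ⟨w, rfl⟩ := w
    rfl

/-- A circuit layer with quantum input wires `W` and output wires `W'`: a partition of the wires into
registers indexed by the locations, an ideal gate at each location, and the set of those output
wires that are classical (classical bits are diagonal qubits). -/
structure Layer (W W' : Type) where
  Loc : Type
  [finLoc : Fintype Loc]
  [decLoc : DecidableEq Loc]
  inReg : W → Loc
  outReg : W' → Loc
  gate : ∀ j, SuperOp (Reg inReg j → ZMod 2) (Reg outReg j → ZMod 2)
  classical : Set W'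

attribute [instance] Layer.finLoc Layer.decLoc

namespace Layer

variable {W W' : Type} [Fintype W] [DecidableEq W] [Fintype W'] [DecidableEq W']

/-- The superoperator of the layer when the gate at location `j` is implemented as `T j`. -/
def apply (L : Layer W W')
    (T : ∀ j, SuperOp (Reg L.inReg j → ZMod 2) (Reg L.outReg j → ZMod 2)) :
    SuperOp (W → ZMod 2) (W' → ZMod 2) :=
  tensorOp (regEquiv L.inReg) (regEquiv L.outReg) T

/-- The noiseless realization. -/
def ideal (L : Layer W W') : SuperOp (W → ZMod 2) (W' → ZMod 2) := L.apply L.gate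

/-- `T` is a `δ`-noisy version of the gate at location `j`: a channel with the same input and output
spaces (in particular classical outputs remain classical) and within diamond distance `δ`. -/
def IsNoisyGate (L : Layer W W') (δ : ℝ) (j : L.Loc)
    (T : SuperOp (Reg L.inReg j → ZMod 2) (Reg L.outReg j → ZMod 2)) : Prop :=
  IsChannel T ∧
    (∀ ρ a b, (∃ w : Reg L.outReg j, w.1 ∈ L.classical ∧ a w ≠ b w) → T ρ a b = 0) ∧
    dnorm (T - L.gate j) ≤ ENNReal.ofReal δ

/-- All `δ`-noisy realizations. -/
def trans (L : Layer W W') (δ : ℝ) : Set (SuperOp (W → ZMod 2) (W' → ZMod 2)) :=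
  {T | ∃ N : ∀ j, SuperOp (Reg L.inReg j → ZMod 2) (Reg L.outReg j → ZMod 2),
    (∀ j, L.IsNoisyGate δ j (N j)) ∧ T = L.apply N}

end Layer

/-! ## Syndrome extraction circuits -/

/-- The two Pauli bases used for ancilla initialization and measurement. -/
inductive PauliBasis
  | Z
  | X

/-- The projector on `|0⟩` (basis `Z`) or `|+⟩` (basis `X`) on each qubit of `W`. -/
def initState (W : Type) [Fintype W] [DecidableEq W] :
    PauliBasis → Matrix (W → ZMod 2) (W → ZMod 2) ℂ
  | PauliBasis.Z => Matrix.single 0 0 1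
  | PauliBasis.X => hadamard W * Matrix.single 0 0 1 * (hadamard W)ᴴ

/-- Measurement in the computational basis, `ρ ↦ ∑ₐ |a⟩⟨a| ρ |a⟩⟨a|`. -/
def measZ (W : Type) : SuperOp (W → ZMod 2) (W → ZMod 2) where
  toFun ρ := Matrix.of fun a b => by
    classical exact if a = b then ρ a b else 0
  map_add' ρ τ := by
    ext a b
    by_cases h : a = b <;> simp [h]
  map_smul' c ρ := by
    ext a b
    by_cases h : a = b <;> simp [h]

/-- Measurement of each qubit in the given Pauli basis, with classical (diagonal) output. -/
def meas (W : Type) [Fintype W] [DecidableEq W] :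
    PauliBasis → SuperOp (W → ZMod 2) (W → ZMod 2)
  | PauliBasis.Z => measZ W
  | PauliBasis.X => measZ W ∘ₗ sandwich (hadamard W) (hadamard W)

/-- The identity channel between two copies of a register, identified through `f`. -/
def relabel {I J : Type} (f : J → I) : SuperOp I J where
  toFun ρ := Matrix.of fun a b => ρ (f a) (f b)
  map_add' _ _ := rfl
  map_smul' _ _ := rfl

/-- The channel `ρ ↦ tr(ρ) τ` preparing the state `τ`. -/
def prepare {I J : Type} [Fintype I] (τ : Matrix J J ℂ) : SuperOp I J where
  toFun ρ := ρ.trace • τ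
  map_add' ρ ρ' := by rw [Matrix.trace_add, add_smul]
  map_smul' c ρ := by simp [Matrix.trace_smul, mul_smul]

section Circuit

variable (D A : Type) [Fintype D] [DecidableEq D] [Fintype A] [DecidableEq A]

/-- The first layer: idle on every data qubit, and preparation of every ancilla qubit. -/
def prepLayer (basis : A → PauliBasis) : Layer D (D ⊕ A) where
  Loc := D ⊕ A
  inReg := Sum.inl
  outReg := id
  gate
    | Sum.inl _ => relabel fun a w => a ⟨Sum.inl w.1, w.2⟩
    | Sum.inr k => prepare (initState _ (basis k))
  classical := ∅

/-- The last layer: idle on every data qubit, and measurement of every ancilla qubit. -/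
def measLayer (basis : A → PauliBasis) : Layer (D ⊕ A) (D ⊕ A) where
  Loc := D ⊕ A
  inReg := id
  outReg := id
  gate
    | Sum.inl _ => LinearMap.id
    | Sum.inr k => meas _ (basis k)
  classical := Set.range Sum.inr

/-- An intermediate layer: each location is a unitary gate (e.g. a CNOT, or an idle gate) acting on a
single qubit or on one data and one ancilla qubit. -/
structure GateLayer where
  Loc : Type
  [finLoc : Fintype Loc]
  [decLoc : DecidableEq Loc]
  reg : D ⊕ A → Loc
  reg_surjective : Function.Surjective reg
  reg_data : ∀ q q' : D, reg (Sum.inl q) = reg (Sum.inl q') → q = q'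
  reg_anc : ∀ k k' : A, reg (Sum.inr k) = reg (Sum.inr k') → k = k'
  gate : ∀ j, Matrix.unitaryGroup (Reg reg j → ZMod 2) ℂ

attribute [instance] GateLayer.finLoc GateLayer.decLoc

variable {D A}

/-- The layer of unitary channels. -/
def GateLayer.toLayer (G : GateLayer D A) : Layer (D ⊕ A) (D ⊕ A) where
  Loc := G.Loc
  inReg := G.reg
  outReg := G.reg
  gate := fun j => sandwich (G.gate j : Matrix _ _ ℂ) (G.gate j : Matrix _ _ ℂ)
  classical := ∅

/-- The noiseless realization of a sequence of intermediate layers (the head acts first). -/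
def idealGates : List (GateLayer D A) → SuperOp (D ⊕ A → ZMod 2) (D ⊕ A → ZMod 2)
  | [] => LinearMap.id
  | G :: Gs => idealGates Gs ∘ₗ G.toLayer.ideal

/-- The `δ`-noisy realizations of a sequence of intermediate layers (the head acts first). -/
def transGates (δ : ℝ) :
    List (GateLayer D A) → Set (SuperOp (D ⊕ A → ZMod 2) (D ⊕ A → ZMod 2))
  | [] => {LinearMap.id}
  | G :: Gs => {T | ∃ T₁ ∈ G.toLayer.trans δ, ∃ T₂ ∈ transGates δ Gs, T = T₂ ∘ₗ T₁}

variable (D A)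

/-- Circuits with data qubits `D` and ancilla qubits `A`: initialization of the ancillas, layers of
one- and two-qubit gates between data and ancilla, and measurement of the ancillas. -/
structure AncillaCircuit where
  initBasis : A → PauliBasis
  gates : List (GateLayer D A)
  measBasis : A → PauliBasis

end Circuit

namespace AncillaCircuit

variable {D A : Type} [Fintype D] [DecidableEq D] [Fintype A] [DecidableEq A]

/-- The number of layers. -/
def depth (Φ : AncillaCircuit D A) : ℕ := Φ.gates.length + 2

/-- The channel realized by the noiseless circuit. -/
def ideal (Φ : AncillaCircuit D A) : SuperOp (D → ZMod 2) (D ⊕ A → ZMod 2) :=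
  (measLayer D A Φ.measBasis).ideal ∘ₗ idealGates Φ.gates ∘ₗ (prepLayer D A Φ.initBasis).ideal

/-- The channels realized by the circuit under general circuit noise with error rate `δ`. -/
def trans (Φ : AncillaCircuit D A) (δ : ℝ) : Set (SuperOp (D → ZMod 2) (D ⊕ A → ZMod 2)) :=
  {T | ∃ T₁ ∈ (prepLayer D A Φ.initBasis).trans δ, ∃ T₂ ∈ transGates δ Φ.gates,
    ∃ T₃ ∈ (measLayer D A Φ.measBasis).trans δ, T = T₃ ∘ₗ T₂ ∘ₗ T₁}

end AncillaCircuit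

/-- `Φ` is a syndrome extraction circuit of `C`: without noise it realizes the syndrome measurement
`ρ ↦ ∑_σ Π_σ ρ Π_σ ⊗ |σ⟩⟨σ|`. -/
def CSSCode.IsSyndromeExtraction {n lX lZ : ℕ} (C : CSSCode n lX lZ)
    (Φ : AncillaCircuit (Fin n) (Anc lX lZ)) : Prop :=
  ∀ ρ a b, Φ.ideal ρ a b =
    if ∀ k : Anc lX lZ, a (Sum.inr k) = b (Sum.inr k) then
      (C.proj (fun k => a (Sum.inr k)) * ρ * C.proj (fun k => a (Sum.inr k)))
        (fun q => a (Sum.inl q)) (fun q => b (Sum.inl q))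
    else 0

end QEC

end

noncomputable section

set_option linter.unusedSectionVars false

namespace QEC

/-! Since there are fewer ancillas than data qubits, every layer has at most 2n locations. Write
each noisy gate as the ideal gate plus a difference of diamond norm at most δ, expand the tensor
product of a layer over the set of faulty locations, and keep only the terms with at most m = ⌊10nδ⌋
faults. A Chernoff-type estimate bounds the discarded part by exp(-nδ) in diamond norm
(`diamondLE_tensorOp_sub_truncated`). The truncated layers are no longer channels, but their norms
are at most 1 + exp(-nδ), so the circuit changes by at most (1 + exp(-nδ))^d - 1
(`DiamondLE.comp_sub_comp`).

In the truncated circuit all faults are pushed to the end and expanded in Pauli operators. An error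
on x data and x ancilla qubits meets at most 2x locations, and a location holds at most one qubit of
each kind; a layer therefore yields an error on at most 2x + m qubits of each kind. After d layers
the weight is at most 2^d m ≤ 5nδ2^(d+1) ≤ Sn (`AncillaCircuit.exists_truncated`). A faulty
measurement still has classical output, so it too is an error in front of a perfect measurement.

What precedes that perfect measurement is ρ ↦ WρWᴴ, and the part of W with ancillas in state σ is a
multiple of Π_σ. The ancilla part of a residual Pauli error shifts σ, so it acts as a syndrome error
of weight at most Sn; the data part commutes with the correction up to a phase. The single-shot
property then leaves a Pauli error of reduced weight at most βSn, multiplied by the data part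
(`Decoder.IsSingleShot.exists_pauli`).

For h blocks, both the incoming superoperator and the faults are linear combinations of products of
Pauli operators, so each block is treated separately even if the blocks are entangled
(`CSSCode.exists_blockReducedSpan`). The blocks together contribute (1 + exp(-nδ))^(dh) - 1, and
exp(x) - 1 ≤ 2x on [0,1] gives the stated bound. -/

/-! ## Contractions and the dual description of the trace norm -/

/-- Matrices that do not increase the Euclidean norm. -/
def IsContraction {I J : Type} [Fintype I] [Fintype J] (B : Matrix J I ℂ) : Prop :=
  ∀ x : I → ℂ, ∑ j, ‖(B *ᵥ x) j‖ ^ 2 ≤ ∑ i, ‖x i‖ ^ 2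

section Contraction

variable {I J K : Type} [Fintype I] [Fintype J] [Fintype K]

lemma sum_norm_sq_eq_dotProduct (x : I → ℂ) :
    ((∑ i, ‖x i‖ ^ 2 : ℝ) : ℂ) = star x ⬝ᵥ x := by
  simp only [dotProduct, Complex.ofReal_sum, Pi.star_apply, RCLike.star_def]
  refine Finset.sum_congr rfl fun i _ => ?_
  rw [Complex.conj_mul']
  push_cast
  rfl

lemma sum_norm_sq_mulVec (B : Matrix J I ℂ) (x : I → ℂ) :
    ((∑ j, ‖(B *ᵥ x) j‖ ^ 2 : ℝ) : ℂ) = star x ⬝ᵥ ((Bᴴ * B) *ᵥ x) := by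
  rw [sum_norm_sq_eq_dotProduct, Matrix.star_mulVec, ← Matrix.dotProduct_mulVec,
    Matrix.mulVec_mulVec]

lemma IsContraction.mul {B : Matrix K J ℂ} {A : Matrix J I ℂ} (hB : IsContraction B)
    (hA : IsContraction A) : IsContraction (B * A) := fun x => by
  rw [← Matrix.mulVec_mulVec]
  exact (hB _).trans (hA x)

lemma IsContraction.of_isometry [DecidableEq I] {B : Matrix J I ℂ} (hB : Bᴴ * B = 1) :
    IsContraction B := fun x => by
  have h := sum_norm_sq_mulVec B x
  rw [hB, Matrix.one_mulVec, ← sum_norm_sq_eq_dotProduct] at h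
  exact (Complex.ofReal_injective h).le

/-- Expanding 0 ≤ ‖x - BBᴴx‖² gives ‖x‖² - 2‖Bᴴx‖² + ‖BBᴴx‖², and the last term is at most ‖Bᴴx‖².
-/
lemma IsContraction.conjTranspose {B : Matrix J I ℂ} (hB : IsContraction B) :
    IsContraction Bᴴ := fun x => by
  have h1 := hB (Bᴴ *ᵥ x)
  have h2 : 0 ≤ ∑ j, ‖(x - B *ᵥ (Bᴴ *ᵥ x)) j‖ ^ 2 := by positivity
  have h3 : ∑ j, ‖(x - B *ᵥ (Bᴴ *ᵥ x)) j‖ ^ 2 = ∑ j, ‖x j‖ ^ 2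
      - 2 * ∑ i, ‖(Bᴴ *ᵥ x) i‖ ^ 2 + ∑ j, ‖(B *ᵥ (Bᴴ *ᵥ x)) j‖ ^ 2 := by
    apply Complex.ofReal_injective
    push_cast only [Complex.ofReal_sub, Complex.ofReal_add, Complex.ofReal_mul]
    rw [sum_norm_sq_eq_dotProduct, sum_norm_sq_eq_dotProduct, sum_norm_sq_eq_dotProduct,
      sum_norm_sq_eq_dotProduct]
    have e1 : star x ⬝ᵥ (B *ᵥ (Bᴴ *ᵥ x)) = star (Bᴴ *ᵥ x) ⬝ᵥ (Bᴴ *ᵥ x) := by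
      rw [Matrix.star_mulVec, ← Matrix.dotProduct_mulVec, Matrix.conjTranspose_conjTranspose]
    have e2 : star (B *ᵥ (Bᴴ *ᵥ x)) ⬝ᵥ x = star (Bᴴ *ᵥ x) ⬝ᵥ (Bᴴ *ᵥ x) := by
      rw [Matrix.star_mulVec, ← Matrix.dotProduct_mulVec]
    rw [star_sub, sub_dotProduct, dotProduct_sub, dotProduct_sub, e1, e2]
    push_cast
    ring
  linarith

lemma IsContraction.submatrix_equiv {I' J' : Type} [Fintype I'] [Fintype J'] {B : Matrix J I ℂ}
    (hB : IsContraction B) (e : J' ≃ J) (f : I' ≃ I) : IsContraction (B.submatrix e f) :=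
  fun x => by
    rw [Matrix.submatrix_mulVec_equiv]
    have h := hB (x ∘ f.symm)
    rw [← Equiv.sum_comp e, ← Equiv.sum_comp f] at h
    simpa using h

end Contraction

section TraceNorm

variable {I J : Type} [Fintype I] [DecidableEq I] [Fintype J] [DecidableEq J]

/-- In an orthonormal eigenbasis v_i of AᴴA, the i-th diagonal term of the trace is an inner product
of v_i with B A v_i, hence at most ‖A v_i‖, the i-th singular value. Together with
`exists_trace_mul_eq` this makes the trace norm a maximum over contractions, from which all its
properties below are derived. -/
lemma norm_trace_mul_le {B A : Matrix I I ℂ} (hB : IsContraction B) :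
    ‖(B * A).trace‖ ≤ traceNorm A := by
  set hA := Matrix.isHermitian_conjTranspose_mul_self A
  set V : Matrix I I ℂ := (hA.eigenvectorUnitary : Matrix I I ℂ) with hV
  have hVV : Vᴴ * V = 1 := Unitary.coe_star_mul_self hA.eigenvectorUnitary
  have hVV' : V * Vᴴ = 1 := Unitary.coe_mul_star_self hA.eigenvectorUnitary
  have hD : Vᴴ * (Aᴴ * A) * V = Matrix.diagonal (fun i => (hA.eigenvalues i : ℂ)) := by
    have h := hA.spectral_theorem
    rw [Unitary.conjStarAlgAut_apply] at h
    conv_lhs => rw [h]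
    change Vᴴ * (V * _ * Vᴴ) * V = _
    rw [← mul_assoc, ← mul_assoc, hVV, one_mul, mul_assoc, hVV, mul_one]
    rfl
  have htr : (B * A).trace = ∑ i, ((Vᴴ * B) *ᵥ fun j => (A * V) j i) i := by
    have : (B * A).trace = (Vᴴ * B * (A * V)).trace := by
      rw [← mul_assoc, Matrix.trace_mul_comm _ V, ← mul_assoc, ← mul_assoc, hVV', one_mul]
    rw [this]
    rfl
  rw [htr, traceNorm]
  refine (norm_sum_le _ _).trans (Finset.sum_le_sum fun i _ => ?_)
  have hc : IsContraction (Vᴴ * B) :=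
    (IsContraction.of_isometry (by rw [Matrix.conjTranspose_conjTranspose, hVV'])).mul hB
  refine Real.le_sqrt_of_sq_le ?_
  have h1 := Finset.single_le_sum (f := fun k => ‖((Vᴴ * B) *ᵥ fun j => (A * V) j i) k‖ ^ 2)
    (fun k _ => by positivity) (Finset.mem_univ i)
  refine h1.trans ((hc _).trans (le_of_eq ?_))
  apply Complex.ofReal_injective
  rw [sum_norm_sq_eq_dotProduct]
  have h2 := congrFun (congrFun hD i) i
  rw [Matrix.diagonal_apply_eq, ← mul_assoc, mul_assoc, ← Matrix.conjTranspose_mul] at h2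
  rw [← h2]
  rfl

open scoped ComplexOrder in
lemma exists_trace_mul_eq (A : Matrix I I ℂ) :
    ∃ B : Matrix I I ℂ, IsContraction B ∧ (B * A).trace = (traceNorm A : ℂ) := by
  set hA := Matrix.isHermitian_conjTranspose_mul_self A with hA_def
  set V : Matrix I I ℂ := (hA.eigenvectorUnitary : Matrix I I ℂ) with hV
  have hVV : Vᴴ * V = 1 := Unitary.coe_star_mul_self hA.eigenvectorUnitary
  have hVV' : V * Vᴴ = 1 := Unitary.coe_mul_star_self hA.eigenvectorUnitary
  have hD : Vᴴ * (Aᴴ * A) * V = Matrix.diagonal (fun i => (hA.eigenvalues i : ℂ)) := by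
    have h := hA.spectral_theorem
    rw [Unitary.conjStarAlgAut_apply] at h
    conv_lhs => rw [h]
    change Vᴴ * (V * _ * Vᴴ) * V = _
    rw [← mul_assoc, ← mul_assoc, hVV, one_mul, mul_assoc, hVV, mul_one]
    rfl
  set s : I → ℝ := fun i => Real.sqrt (hA.eigenvalues i) with hs
  have hnn : ∀ i, 0 ≤ hA.eigenvalues i :=
    fun i => (Matrix.posSemidef_conjTranspose_mul_self A).eigenvalues_nonneg i
  have hss : ∀ i, hA.eigenvalues i = s i * s i := fun i => (Real.mul_self_sqrt (hnn i)).symm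
  -- Since 0⁻¹ = 0, `A * V * d` is the partial isometry of the polar decomposition (up to `V`) also
  -- when `A` is singular.
  set d : Matrix I I ℂ := Matrix.diagonal fun i => ((s i)⁻¹ : ℂ) with hd
  have hdd : dᴴ = d := by
    rw [hd, Matrix.diagonal_conjTranspose]
    congr 1
    funext i
    simp
  have hM : IsContraction (A * V * d) := fun x => by
    have h := sum_norm_sq_mulVec (A * V * d) x
    have h2 : (A * V * d)ᴴ * (A * V * d) =
        Matrix.diagonal fun i => ((s i)⁻¹ * (s i * s i) * (s i)⁻¹ : ℂ) := by
      rw [Matrix.conjTranspose_mul, Matrix.conjTranspose_mul, hdd]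
      have : d * (Vᴴ * Aᴴ) * (A * V * d) = d * (Vᴴ * (Aᴴ * A) * V) * d := by
        simp only [mul_assoc]
      rw [this, hD, hd, Matrix.diagonal_mul_diagonal, Matrix.diagonal_mul_diagonal]
      congr 1
      funext i
      rw [hss i]
      push_cast
      rfl
    rw [h2] at h
    have h3 : ((∑ j, ‖((A * V * d) *ᵥ x) j‖ ^ 2 : ℝ) : ℂ) =
        ((∑ i, ((s i)⁻¹ * (s i * s i) * (s i)⁻¹) * ‖x i‖ ^ 2 : ℝ) : ℂ) := by
      rw [h]
      simp only [dotProduct, Matrix.mulVec_diagonal, Complex.ofReal_sum, Pi.star_apply,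
        RCLike.star_def]
      refine Finset.sum_congr rfl fun i _ => ?_
      rw [mul_left_comm, Complex.conj_mul']
      push_cast
      rfl
    rw [Complex.ofReal_injective h3]
    refine Finset.sum_le_sum fun i _ => ?_
    refine mul_le_of_le_one_left (by positivity) ?_
    by_cases h0 : s i = 0
    · simp [h0]
    · apply le_of_eq
      field_simp
  refine ⟨V * (A * V * d)ᴴ, (IsContraction.of_isometry hVV).mul hM.conjTranspose, ?_⟩
  have : (V * (A * V * d)ᴴ * A).trace = (d * (Vᴴ * (Aᴴ * A) * V)).trace := by
    rw [mul_assoc, Matrix.trace_mul_comm, Matrix.conjTranspose_mul, Matrix.conjTranspose_mul, hdd]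
    simp only [mul_assoc]
  rw [this, hD, hd, Matrix.diagonal_mul_diagonal, Matrix.trace_diagonal, traceNorm,
    Complex.ofReal_sum]
  refine Finset.sum_congr rfl fun i _ => ?_
  change _ = (s i : ℂ)
  rw [hss i]
  by_cases h0 : s i = 0
  · simp [h0]
  · have : (s i : ℂ) ≠ 0 := by exact_mod_cast h0
    push_cast
    field_simp

lemma traceNorm_nonneg (A : Matrix I I ℂ) : 0 ≤ traceNorm A :=
  Finset.sum_nonneg fun _ _ => Real.sqrt_nonneg _

lemma traceNorm_le_of_forall {A : Matrix I I ℂ} {c : ℝ}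
    (h : ∀ B : Matrix I I ℂ, IsContraction B → ‖(B * A).trace‖ ≤ c) : traceNorm A ≤ c := by
  obtain ⟨B, hB, hBA⟩ := exists_trace_mul_eq A
  have := h B hB
  rwa [hBA, Complex.norm_real, Real.norm_of_nonneg (traceNorm_nonneg A)] at this

lemma traceNorm_add_le (A B : Matrix I I ℂ) : traceNorm (A + B) ≤ traceNorm A + traceNorm B :=
  traceNorm_le_of_forall fun M hM => by
    rw [mul_add, Matrix.trace_add]
    exact (norm_add_le _ _).trans (add_le_add (norm_trace_mul_le hM) (norm_trace_mul_le hM))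

lemma traceNorm_smul_le (c : ℂ) (A : Matrix I I ℂ) : traceNorm (c • A) ≤ ‖c‖ * traceNorm A :=
  traceNorm_le_of_forall fun M hM => by
    rw [Matrix.mul_smul, Matrix.trace_smul, norm_smul]
    exact mul_le_mul_of_nonneg_left (norm_trace_mul_le hM) (norm_nonneg c)

lemma traceNorm_zero : traceNorm (0 : Matrix I I ℂ) = 0 :=
  le_antisymm (by simpa using traceNorm_smul_le 0 (0 : Matrix I I ℂ)) (traceNorm_nonneg _)

lemma traceNorm_submatrix_equiv_le (A : Matrix I I ℂ) (e : J ≃ I) :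
    traceNorm (A.submatrix e e) ≤ traceNorm A :=
  traceNorm_le_of_forall fun B hB => by
    have h := norm_trace_mul_le (A := A) (hB.submatrix_equiv e.symm e.symm)
    refine le_trans (le_of_eq ?_) h
    congr 1
    simp only [Matrix.trace, Matrix.diag_apply, Matrix.mul_apply, Matrix.submatrix_apply]
    rw [← Equiv.sum_comp e]
    refine Finset.sum_congr rfl fun i _ => ?_
    rw [← Equiv.sum_comp e]
    simp

lemma traceNorm_submatrix_equiv (A : Matrix I I ℂ) (e : J ≃ I) :
    traceNorm (A.submatrix e e) = traceNorm A :=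
  le_antisymm (traceNorm_submatrix_equiv_le A e) <| by
    simpa using traceNorm_submatrix_equiv_le (A.submatrix e e) e.symm

/-- By duality it suffices that the adjoint map ∑ KᵢᴴBKᵢ preserves contractions. It equals Sᴴ(1 ⊗
B)S, where S stacks the Kᵢ and is an isometry by `hK`. -/
lemma traceNorm_sum_kraus_le {ι : Type} [Fintype ι] {K : ι → Matrix J I ℂ}
    (hK : ∑ i, (K i)ᴴ * K i = 1) (ρ : Matrix I I ℂ) :
    traceNorm (∑ i, K i * ρ * (K i)ᴴ) ≤ traceNorm ρ :=
  traceNorm_le_of_forall fun B hB => by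
    classical
    set S : Matrix (ι × J) I ℂ := Matrix.of fun x a => K x.1 x.2 a with hS
    set B' : Matrix (ι × J) (ι × J) ℂ := Matrix.of fun x y => if x.1 = y.1 then B x.2 y.2 else 0
      with hB'
    have hSc : IsContraction S := IsContraction.of_isometry <| by
      rw [← hK]
      ext a b
      simp [Matrix.mul_apply, Matrix.sum_apply, Fintype.sum_prod_type, hS]
    have hBc : IsContraction B' := fun x => by
      rw [Fintype.sum_prod_type, Fintype.sum_prod_type]
      refine Finset.sum_le_sum fun i _ => ?_
      refine le_trans (le_of_eq ?_) (hB fun j => x (i, j))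
      refine Finset.sum_congr rfl fun j _ => ?_
      congr 2
      simp [Matrix.mulVec, dotProduct, Fintype.sum_prod_type, hB']
    have hC : ∑ i, (K i)ᴴ * B * K i = Sᴴ * B' * S := by
      ext a b
      simp [Matrix.mul_apply, Matrix.sum_apply, Fintype.sum_prod_type, hS, hB']
    have htr : (B * ∑ i, K i * ρ * (K i)ᴴ).trace = ((∑ i, (K i)ᴴ * B * K i) * ρ).trace := by
      rw [Matrix.mul_sum, Matrix.sum_mul, Matrix.trace_sum, Matrix.trace_sum]
      refine Finset.sum_congr rfl fun i _ => ?_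
      rw [← Matrix.mul_assoc, Matrix.trace_mul_comm, ← Matrix.mul_assoc, ← Matrix.mul_assoc]
    rw [htr, hC]
    exact norm_trace_mul_le ((hSc.conjTranspose.mul hBc).mul hSc)

end TraceNorm

/-! ## Bounds for the diamond norm -/

/-- `‖(id_G ⊗ T) ρ‖₁ ≤ c ‖ρ‖₁` for every reference system. -/
def DiamondLE {I J : Type} [Fintype I] [DecidableEq I] [Fintype J] [DecidableEq J]
    (T : SuperOp I J) (c : ℝ) : Prop :=
  ∀ (G : Type) [Fintype G] [DecidableEq G] (ρ : Matrix (G × I) (G × I) ℂ),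
    traceNorm (amplify G T ρ) ≤ c * traceNorm ρ

section Diamond

variable {I J K : Type} [Fintype I] [DecidableEq I] [Fintype J] [DecidableEq J] [Fintype K]
  [DecidableEq K]

lemma amplify_smul (G : Type) (T : SuperOp I J) (c : ℂ) (ρ : Matrix (G × I) (G × I) ℂ) :
    amplify G T (c • ρ) = c • amplify G T ρ := by
  ext x y
  change T (c • Matrix.of fun a b => ρ (x.1, a) (y.1, b)) x.2 y.2 = _
  rw [map_smul]
  rfl

lemma amplify_comp (G : Type) (S : SuperOp J K) (T : SuperOp I J) (ρ : Matrix (G × I) (G × I) ℂ) :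
    amplify G (S ∘ₗ T) ρ = amplify G S (amplify G T ρ) := rfl

lemma DiamondLE.comp {S : SuperOp J K} {T : SuperOp I J} {a b : ℝ} (ha : 0 ≤ a)
    (hS : DiamondLE S a) (hT : DiamondLE T b) : DiamondLE (S ∘ₗ T) (a * b) := fun G _ _ ρ => by
  rw [amplify_comp, mul_assoc]
  exact (hS G _).trans (mul_le_mul_of_nonneg_left (hT G ρ) ha)

lemma DiamondLE.add {S T : SuperOp I J} {a b : ℝ} (hS : DiamondLE S a) (hT : DiamondLE T b) :
    DiamondLE (S + T) (a + b) := fun G _ _ ρ => by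
  have : amplify G (S + T) ρ = amplify G S ρ + amplify G T ρ := rfl
  rw [this, add_mul]
  exact (traceNorm_add_le _ _).trans (add_le_add (hS G ρ) (hT G ρ))

lemma DiamondLE.neg {T : SuperOp I J} {a : ℝ} (hT : DiamondLE T a) : DiamondLE (-T) a :=
  fun G _ _ ρ => by
    have : amplify G (-T) ρ = (-1 : ℂ) • amplify G T ρ := by
      ext
      simp [amplify]
    rw [this]
    simpa using (traceNorm_smul_le (-1 : ℂ) (amplify G T ρ)).trans
      (mul_le_mul_of_nonneg_left (hT G ρ) (norm_nonneg _))

lemma diamondLE_zero : DiamondLE (0 : SuperOp I J) 0 := fun G _ _ ρ => by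
  have : amplify G (0 : SuperOp I J) ρ = 0 := rfl
  rw [this, traceNorm_zero, zero_mul]

lemma DiamondLE.sum {ι : Type} (s : Finset ι) {T : ι → SuperOp I J} {c : ι → ℝ}
    (h : ∀ i ∈ s, DiamondLE (T i) (c i)) : DiamondLE (∑ i ∈ s, T i) (∑ i ∈ s, c i) := by
  classical
  induction s using Finset.induction_on with
  | empty => simpa using diamondLE_zero
  | insert i s hi ih =>
    rw [Finset.sum_insert hi, Finset.sum_insert hi]
    exact (h i (Finset.mem_insert_self i s)).add
      (ih fun j hj => h j (Finset.mem_insert_of_mem hj))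

lemma DiamondLE.mono {T : SuperOp I J} {a b : ℝ} (hT : DiamondLE T a) (hab : a ≤ b) :
    DiamondLE T b := fun G _ _ ρ =>
  (hT G ρ).trans (mul_le_mul_of_nonneg_right hab (traceNorm_nonneg ρ))

lemma diamondLE_id : DiamondLE (LinearMap.id : SuperOp I I) 1 := fun G _ _ ρ => by
  rw [one_mul]
  exact le_rfl

lemma traceNorm_le_of_diamondLE {T : SuperOp I J} {c : ℝ} (hT : DiamondLE T c)
    (ρ : Matrix I I ℂ) : traceNorm (T ρ) ≤ c * traceNorm ρ := by
  have h := hT Unit (ρ.submatrix (Equiv.punitProd I) (Equiv.punitProd I))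
  rw [traceNorm_submatrix_equiv] at h
  have h2 : amplify Unit T (ρ.submatrix (Equiv.punitProd I) (Equiv.punitProd I)) =
    (T ρ).submatrix (Equiv.punitProd J) (Equiv.punitProd J) := rfl
  rwa [h2, traceNorm_submatrix_equiv] at h

lemma diamondLE_of_kraus {ι : Type} [Fintype ι] {T : SuperOp I J} {K : ι → Matrix J I ℂ}
    (hT : ∀ ρ, T ρ = ∑ i, K i * ρ * (K i)ᴴ) (hK : ∑ i, (K i)ᴴ * K i = 1) : DiamondLE T 1 :=
  fun G _ _ ρ => by
    set K' : ι → Matrix (G × J) (G × I) ℂ :=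
      fun i => Matrix.of fun x y => if x.1 = y.1 then K i x.2 y.2 else 0 with hK'
    have h1 : amplify G T ρ = ∑ i, K' i * ρ * (K' i)ᴴ := by
      ext x y
      change T _ x.2 y.2 = _
      rw [hT]
      simp only [Matrix.sum_apply, Matrix.mul_apply, hK', Matrix.of_apply,
        Matrix.conjTranspose_apply, Fintype.sum_prod_type]
      refine Finset.sum_congr rfl fun i _ => ?_
      simp [apply_ite star, Finset.sum_ite_irrel]
    have h2 : ∑ i, (K' i)ᴴ * K' i = 1 := by
      ext x y
      have h := congrFun (congrFun hK x.2) y.2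
      simp only [Matrix.sum_apply, Matrix.mul_apply, Matrix.conjTranspose_apply,
        RCLike.star_def] at h
      simp only [Matrix.sum_apply, Matrix.mul_apply, hK', Matrix.of_apply,
        Matrix.conjTranspose_apply, Fintype.sum_prod_type]
      by_cases hxy : x.1 = y.1
      · simp [apply_ite star, Finset.sum_ite_irrel, hxy, h, Matrix.one_apply, Prod.ext_iff]
      · have : x ≠ y := fun h => hxy (congrArg Prod.fst h)
        simp [apply_ite star, Finset.sum_ite_irrel, this, Ne.symm hxy]
    rw [h1, one_mul]
    exact traceNorm_sum_kraus_le h2 ρ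

lemma IsChannel.diamondLE {T : SuperOp I J} (hT : IsChannel T) : DiamondLE T 1 := by
  obtain ⟨r, K, h1, h2⟩ := hT
  exact diamondLE_of_kraus h1 h2

/-- Homogeneity passes from the unit ball to all `ρ`, and any finite reference system is a
relabelled `Fin k`. -/
lemma diamondLE_of_dnorm_le {T : SuperOp I J} {c : ℝ} (hc : 0 ≤ c)
    (hT : dnorm T ≤ ENNReal.ofReal c) : DiamondLE T c := by
  have key : ∀ (k : ℕ) (ρ : Matrix (Fin k × I) (Fin k × I) ℂ), traceNorm ρ ≤ 1 →
      traceNorm (amplify (Fin k) T ρ) ≤ c := fun k ρ hρ => by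
    have h : ENNReal.ofReal (traceNorm (amplify (Fin k) T ρ)) ≤ ENNReal.ofReal c :=
      le_trans (le_iSup₂_of_le k ρ (le_iSup_of_le (f := fun _ => _) hρ le_rfl)) hT
    exact (ENNReal.ofReal_le_ofReal_iff hc).1 h
  have key2 : ∀ (k : ℕ) (ρ : Matrix (Fin k × I) (Fin k × I) ℂ),
      traceNorm (amplify (Fin k) T ρ) ≤ c * traceNorm ρ := fun k ρ => by
    refine le_of_forall_pos_le_add fun ε hε => ?_
    -- The extra summand makes the normalization positive even if the trace norm vanishes, and costs
    -- at most ε after multiplication by `c`.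
    set t := traceNorm ρ + ε / (c + 1) with ht
    have htp : 0 < t := by have := traceNorm_nonneg ρ; positivity
    have h1 : traceNorm (((t⁻¹ : ℝ) : ℂ) • ρ) ≤ 1 := by
      refine (traceNorm_smul_le _ _).trans ?_
      rw [Complex.norm_real, Real.norm_of_nonneg (inv_nonneg.2 htp.le), inv_mul_le_iff₀ htp,
        mul_one, ht]
      have : 0 ≤ ε / (c + 1) := by positivity
      linarith
    have h2 := key k _ h1
    have h3 : amplify (Fin k) T ρ = (t : ℂ) • amplify (Fin k) T (((t⁻¹ : ℝ) : ℂ) • ρ) := by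
      rw [amplify_smul, smul_smul]
      have : (t : ℂ) ≠ 0 := by exact_mod_cast htp.ne'
      push_cast
      rw [mul_inv_cancel₀ this, one_smul]
    rw [h3]
    refine (traceNorm_smul_le _ _).trans ?_
    rw [Complex.norm_real, Real.norm_of_nonneg htp.le]
    refine (mul_le_mul_of_nonneg_left h2 htp.le).trans ?_
    rw [ht, add_mul, mul_comm]
    have : ε / (c + 1) * c ≤ ε := by
      rw [div_mul_eq_mul_div, div_le_iff₀ (by positivity)]
      nlinarith
    linarith
  intro G _ _ ρ
  set e := Fintype.equivFin G
  have h := key2 _ (ρ.submatrix (e.symm.prodCongr (Equiv.refl I)) (e.symm.prodCongr (Equiv.refl I)))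
  rw [traceNorm_submatrix_equiv] at h
  have h2 : amplify (Fin (Fintype.card G)) T
      (ρ.submatrix (e.symm.prodCongr (Equiv.refl I)) (e.symm.prodCongr (Equiv.refl I))) =
      (amplify G T ρ).submatrix (e.symm.prodCongr (Equiv.refl J))
        (e.symm.prodCongr (Equiv.refl J)) := rfl
  rwa [h2, traceNorm_submatrix_equiv] at h

end Diamond

/-! ## Tensor products of superoperators -/

section SuperOp

variable {I J K : Type} [Fintype I] [DecidableEq I] [Fintype J] [DecidableEq J]

lemma superOp_apply (T : SuperOp I J) (ρ : Matrix I I ℂ) (a b : J) :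
    T ρ a b = ∑ c, ∑ d, ρ c d * T (Matrix.single c d 1) a b := by
  conv_lhs => rw [Matrix.matrix_eq_sum_single ρ, map_sum]
  rw [Matrix.sum_apply]
  refine Finset.sum_congr rfl fun c _ => ?_
  rw [map_sum, Matrix.sum_apply]
  refine Finset.sum_congr rfl fun d _ => ?_
  have : Matrix.single c d (ρ c d) = ρ c d • Matrix.single c d (1 : ℂ) := by simp
  rw [this, map_smul]
  rfl

lemma superOp_ext {S T : SuperOp I J}
    (h : ∀ c d a b, S (Matrix.single c d 1) a b = T (Matrix.single c d 1) a b) : S = T := by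
  refine LinearMap.ext fun ρ => ?_
  ext a b
  rw [superOp_apply, superOp_apply T]
  simp only [h]

lemma sandwich_single (E F : Matrix J I ℂ) (c d : I) (a b : J) :
    sandwich E F (Matrix.single c d 1) a b = E a c * star (F b d) := by
  change (E * Matrix.single c d (1 : ℂ) * Fᴴ) a b = _
  simp [Matrix.mul_apply, Matrix.single_apply, Finset.sum_ite_eq, ite_and]

lemma sandwich_comp [Fintype K] (E F : Matrix K J ℂ) (E' F' : Matrix J I ℂ) :
    sandwich E F ∘ₗ sandwich E' F' = sandwich (E * E') (F * F') := by
  refine LinearMap.ext fun ρ => ?_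
  change E * (E' * ρ * F'ᴴ) * Fᴴ = E * E' * ρ * (F * F')ᴴ
  rw [Matrix.conjTranspose_mul]
  simp only [Matrix.mul_assoc]

lemma sandwich_one_one : sandwich (1 : Matrix I I ℂ) 1 = LinearMap.id := by
  refine LinearMap.ext fun ρ => ?_
  change 1 * ρ * 1ᴴ = ρ
  simp

lemma sandwich_smul_smul (x y : ℂ) (E F : Matrix J I ℂ) :
    sandwich (x • E) (y • F) = (x * star y) • sandwich E F := by
  refine LinearMap.ext fun ρ => ?_
  change (x • E) * ρ * (y • F)ᴴ = (x * star y) • (E * ρ * Fᴴ)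
  simp [Matrix.conjTranspose_smul, smul_smul, mul_comm]

lemma sandwich_vecMulVec (E F : Matrix J I ℂ) (φ φ' : I → ℂ) :
    sandwich E F (Matrix.vecMulVec φ (star φ')) =
      Matrix.vecMulVec (E *ᵥ φ) (star (F *ᵥ φ')) := by
  change E * Matrix.vecMulVec φ (star φ') * Fᴴ = _
  rw [Matrix.mul_vecMulVec, Matrix.vecMulVec_mul, Matrix.star_mulVec]

end SuperOp

/-- The tensor product of matrices. -/
def tensorMat {ι : Type} [Fintype ι] {I J : ι → Type} {K L : Type} (f : K ≃ ∀ j, I j)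
    (g : L ≃ ∀ j, J j) (M : ∀ j, Matrix (J j) (I j) ℂ) : Matrix L K ℂ :=
  Matrix.of fun a b => ∏ j, M j (g a j) (f b j)

section Tensor

variable {ι : Type} [Fintype ι] [DecidableEq ι] {I J H : ι → Type}
  [∀ j, Fintype (I j)] [∀ j, DecidableEq (I j)] [∀ j, Fintype (J j)] [∀ j, DecidableEq (J j)]
  [∀ j, Fintype (H j)] [∀ j, DecidableEq (H j)]
  {K L M : Type} [Fintype K] [DecidableEq K] [Fintype L] [DecidableEq L] [Fintype M]
  [DecidableEq M] (f : K ≃ ∀ j, I j) (g : L ≃ ∀ j, J j) (k : M ≃ ∀ j, H j)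

lemma tensorOp_single (T : ∀ j, SuperOp (I j) (J j)) (c d : K) (a b : L) :
    tensorOp f g T (Matrix.single c d 1) a b =
      ∏ j, T j (Matrix.single (f c j) (f d j) 1) (g a j) (g b j) := by
  change ∑ c', ∑ d', _ = _
  simp [Matrix.single_apply, ite_and]

lemma sum_prod_apply (F : ∀ j, I j → ℂ) : ∑ x : K, ∏ j, F j (f x j) = ∏ j, ∑ y, F j y := by
  rw [Equiv.sum_comp f fun y => ∏ j, F j (y j), Finset.prod_univ_sum, Fintype.piFinset_univ]

lemma sum_sum_prod_apply (F : ∀ j, I j → I j → ℂ) :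
    ∑ x : K, ∑ y : K, ∏ j, F j (f x j) (f y j) = ∏ j, ∑ x, ∑ y, F j x y := by
  rw [← sum_prod_apply f]
  refine Finset.sum_congr rfl fun x _ => ?_
  rw [sum_prod_apply f]

lemma forall_equiv_apply_eq_iff (a b : K) : (∀ j ∈ Finset.univ, f a j = f b j) ↔ a = b :=
  ⟨fun h => f.injective (funext fun j => h j (Finset.mem_univ j)), by rintro rfl; simp⟩

lemma tensorOp_tensorMat (T : ∀ j, SuperOp (I j) (J j)) (ρ : ∀ j, Matrix (I j) (I j) ℂ) :
    tensorOp f g T (tensorMat f f ρ) = tensorMat g g fun j => T j (ρ j) := by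
  ext a b
  change ∑ c, ∑ d, (∏ j, ρ j (f c j) (f d j)) * _ = ∏ j, T j (ρ j) (g a j) (g b j)
  simp_rw [← Finset.prod_mul_distrib, superOp_apply (T _) (ρ _)]
  rw [sum_sum_prod_apply f fun j x y => ρ j x y * T j (Matrix.single x y 1) (g a j) (g b j)]

lemma single_eq_tensorMat (c d : K) :
    Matrix.single c d (1 : ℂ) = tensorMat f f fun j => Matrix.single (f c j) (f d j) 1 := by
  ext a b
  simp only [Matrix.single_apply, tensorMat, Matrix.of_apply]
  rw [Finset.prod_ite_zero, Finset.prod_const_one]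
  have h : (∀ j ∈ Finset.univ, f c j = f a j ∧ f d j = f b j) ↔ c = a ∧ d = b := by
    rw [← forall_equiv_apply_eq_iff f c, ← forall_equiv_apply_eq_iff f d]
    simp only [forall_and]
  by_cases hab : c = a ∧ d = b
  · rw [if_pos hab, if_pos (h.2 hab)]
  · rw [if_neg hab, if_neg (mt h.1 hab)]

lemma tensorOp_comp (S : ∀ j, SuperOp (J j) (H j)) (T : ∀ j, SuperOp (I j) (J j)) :
    tensorOp g k S ∘ₗ tensorOp f g T = tensorOp f k fun j => S j ∘ₗ T j := by
  refine superOp_ext fun c d a b => ?_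
  rw [LinearMap.comp_apply, single_eq_tensorMat f, tensorOp_tensorMat, tensorOp_tensorMat,
    tensorOp_tensorMat]
  rfl

lemma tensorOp_sandwich (E F : ∀ j, Matrix (J j) (I j) ℂ) :
    tensorOp f g (fun j => sandwich (E j) (F j)) =
      sandwich (tensorMat f g E) (tensorMat f g F) := by
  refine superOp_ext fun c d a b => ?_
  rw [tensorOp_single, sandwich_single]
  simp only [sandwich_single, Finset.prod_mul_distrib, tensorMat, Matrix.of_apply]
  rw [star_prod]

/-- The tensor product of superoperators as a multilinear map. -/
def tensorOpMultilinear :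
    MultilinearMap ℂ (fun j => SuperOp (I j) (J j)) (SuperOp K L) where
  toFun T := tensorOp f g T
  map_update_add' {inst} T i x y := by
    refine superOp_ext fun c d a b => ?_
    rw [LinearMap.add_apply, Matrix.add_apply]
    simp only [tensorOp_single]
    rw [← Finset.mul_prod_erase _ _ (Finset.mem_univ i),
      ← Finset.mul_prod_erase _ _ (Finset.mem_univ i),
      ← Finset.mul_prod_erase _ _ (Finset.mem_univ i)]
    simp only [Function.update_self, LinearMap.add_apply, Matrix.add_apply, add_mul]
    congr 2 <;> refine Finset.prod_congr rfl fun j hj => ?_ <;>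
      rw [Function.update_of_ne (Finset.ne_of_mem_erase hj),
        Function.update_of_ne (Finset.ne_of_mem_erase hj)]
  map_update_smul' {inst} T i z x := by
    refine superOp_ext fun c d a b => ?_
    rw [LinearMap.smul_apply, Matrix.smul_apply]
    simp only [tensorOp_single]
    rw [← Finset.mul_prod_erase _ _ (Finset.mem_univ i),
      ← Finset.mul_prod_erase _ _ (Finset.mem_univ i)]
    simp only [Function.update_self, LinearMap.smul_apply, Matrix.smul_apply, smul_eq_mul,
      mul_assoc]
    congr 2
    refine Finset.prod_congr rfl fun j hj => ?_
    rw [Function.update_of_ne (Finset.ne_of_mem_erase hj),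
      Function.update_of_ne (Finset.ne_of_mem_erase hj)]

/-- With `S` the deviations and `T` the ideal gates, this is the expansion over sets of fault
locations. -/
lemma tensorOp_add (S T : ∀ j, SuperOp (I j) (J j)) :
    tensorOp f g (fun j => S j + T j) = ∑ s : Finset ι, tensorOp f g (s.piecewise S T) :=
  (tensorOpMultilinear f g).map_add_univ S T

end Tensor

/-- A multilinear map sends families in spans to the span of the values on the generators. -/
lemma multilinearMap_mem_span {R ι : Type} [CommRing R] [Fintype ι] [DecidableEq ι] {M : ι → Type}
    {N : Type} [∀ j, AddCommGroup (M j)] [∀ j, Module R (M j)] [AddCommGroup N] [Module R N]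
    (F : MultilinearMap R M N) (X : ∀ j, Set (M j)) (m : ∀ j, M j)
    (hm : ∀ j, m j ∈ Submodule.span R (X j)) :
    F m ∈ Submodule.span R {y | ∃ x : ∀ j, M j, (∀ j, x j ∈ X j) ∧ y = F x} := by
  have key : ∀ (s : Finset ι) (m : ∀ j, M j), (∀ j ∈ s, m j ∈ Submodule.span R (X j)) →
      (∀ j ∉ s, m j ∈ X j) →
      F m ∈ Submodule.span R {y | ∃ x : ∀ j, M j, (∀ j, x j ∈ X j) ∧ y = F x} := by
    intro s
    induction s using Finset.induction_on with
    | empty =>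
      intro m _ h
      exact Submodule.subset_span ⟨m, fun j => h j (by simp), rfl⟩
    | insert i s hi ih =>
      intro m h1 h2
      have h3 : ∀ z ∈ Submodule.span R (X i), F (Function.update m i z) ∈
          Submodule.span R {y | ∃ x : ∀ j, M j, (∀ j, x j ∈ X j) ∧ y = F x} := by
        intro z hz
        induction hz using Submodule.span_induction with
        | mem z hz =>
          refine ih _ (fun j hj => ?_) (fun j hj => ?_)
          · have : j ≠ i := fun h => hi (h ▸ hj)
            rw [Function.update_of_ne this]
            exact h1 j (Finset.mem_insert_of_mem hj)
          · by_cases hji : j = i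
            · subst hji
              rwa [Function.update_self]
            · rw [Function.update_of_ne hji]
              exact h2 j (by simp [hji, hj])
        | zero =>
          rw [F.map_update_zero]
          exact zero_mem _
        | add x y _ _ hx hy =>
          rw [F.map_update_add]
          exact add_mem hx hy
        | smul c x _ hx =>
          rw [F.map_update_smul]
          exact Submodule.smul_mem _ _ hx
      have := h3 (m i) (h1 i (Finset.mem_insert_self i s))
      rwa [Function.update_eq_self] at this
  exact key Finset.univ m (fun j _ => hm j) (fun j hj => absurd (Finset.mem_univ j) hj)

/-! ### Multiplicativity of diamond norm bounds under tensor products. -/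

section TensorBound

/-- `X` is `T` followed by `S`, each acting while the other tensor factor is counted as part of the
reference system: G × I for `T`, then G × L for `S`. The equivalences `e₁`, `e₂`, `e₃` only regroup
the factors, which leaves the trace norm unchanged. -/
lemma DiamondLE.tensorPair {I J K L P Q : Type} [Fintype I] [DecidableEq I] [Fintype J]
    [DecidableEq J] [Fintype K] [DecidableEq K] [Fintype L] [DecidableEq L] [Fintype P]
    [DecidableEq P] [Fintype Q] [DecidableEq Q] {S : SuperOp I J} {T : SuperOp K L} {a b : ℝ}
    (ha : 0 ≤ a) (hS : DiamondLE S a) (hT : DiamondLE T b) (f : P ≃ I × K) (g : Q ≃ J × L)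
    {X : SuperOp P Q}
    (hX : ∀ c d x y, X (Matrix.single c d 1) x y =
      S (Matrix.single (f c).1 (f d).1 1) (g x).1 (g y).1 *
        T (Matrix.single (f c).2 (f d).2 1) (g x).2 (g y).2) : DiamondLE X (a * b) :=
  fun G _ _ ρ => by
    let e₁ : (G × I) × K ≃ G × P :=
      (Equiv.prodAssoc G I K).trans ((Equiv.refl G).prodCongr f.symm)
    let e₂ : (G × L) × I ≃ (G × I) × L :=
      ((Equiv.prodAssoc G L I).trans ((Equiv.refl G).prodCongr (Equiv.prodComm L I))).trans
        (Equiv.prodAssoc G I L).symm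
    let e₃ : G × Q ≃ (G × L) × J :=
      ((Equiv.refl G).prodCongr (g.trans (Equiv.prodComm J L))).trans (Equiv.prodAssoc G L J).symm
    have h : amplify G X ρ = (amplify (G × L) S ((amplify (G × I) T
        (ρ.submatrix e₁ e₁)).submatrix e₂ e₂)).submatrix e₃ e₃ := by
      ext x y
      change X (Matrix.of fun c d => ρ (x.1, c) (y.1, d)) x.2 y.2 =
        S (Matrix.of fun i i' => T (Matrix.of fun c d => ρ (x.1, f.symm (i, c)) (y.1, f.symm (i', d)))
          (g x.2).2 (g y.2).2) (g x.2).1 (g y.2).1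
      rw [superOp_apply, superOp_apply S]
      simp only [hX, Matrix.of_apply]
      have e : ∀ F : P → ℂ, ∑ p, F p = ∑ i, ∑ k, F (f.symm (i, k)) := fun F => by
        rw [← Equiv.sum_comp f.symm, Fintype.sum_prod_type]
      simp only [e, Equiv.apply_symm_apply]
      refine Finset.sum_congr rfl fun i _ => ?_
      rw [Finset.sum_comm]
      refine Finset.sum_congr rfl fun i' _ => ?_
      rw [superOp_apply T, Finset.sum_mul]
      refine Finset.sum_congr rfl fun c _ => ?_
      rw [Finset.sum_mul]
      refine Finset.sum_congr rfl fun d _ => ?_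
      simp only [Matrix.of_apply]
      ring
    rw [h, traceNorm_submatrix_equiv, mul_assoc]
    refine (hS _ _).trans (mul_le_mul_of_nonneg_left ?_ ha)
    rw [traceNorm_submatrix_equiv]
    refine (hT _ _).trans (le_of_eq ?_)
    rw [traceNorm_submatrix_equiv]

lemma DiamondLE.tensorOp {ι : Type} [Fintype ι] : ∀ {I J : ι → Type}
    [∀ j, Fintype (I j)] [∀ j, DecidableEq (I j)] [∀ j, Fintype (J j)] [∀ j, DecidableEq (J j)]
    {K L : Type} [Fintype K] [DecidableEq K] [Fintype L] [DecidableEq L] (f : K ≃ ∀ j, I j)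
    (g : L ≃ ∀ j, J j) {T : ∀ j, SuperOp (I j) (J j)} {c : ι → ℝ}, (∀ j, 0 ≤ c j) →
    (∀ j, DiamondLE (T j) (c j)) → DiamondLE (tensorOp f g T) (∏ j, c j) := by
  refine Fintype.induction_empty_option (P := fun ι (_ : Fintype ι) => ∀ {I J : ι → Type}
    [∀ j, Fintype (I j)] [∀ j, DecidableEq (I j)] [∀ j, Fintype (J j)] [∀ j, DecidableEq (J j)]
    {K L : Type} [Fintype K] [DecidableEq K] [Fintype L] [DecidableEq L] (f : K ≃ ∀ j, I j)
    (g : L ≃ ∀ j, J j) {T : ∀ j, SuperOp (I j) (J j)} {c : ι → ℝ}, (∀ j, 0 ≤ c j) →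
    (∀ j, DiamondLE (T j) (c j)) → DiamondLE (QEC.tensorOp f g T) (∏ j, c j)) ?_ ?_ ?_ ι
  · intro α β _ e ih I J _ _ _ _ K L _ _ _ _ f g T c hc hT
    classical
    let := Fintype.ofEquiv β e.symm
    have h := ih (f.trans (Equiv.piCongrLeft I e).symm) (g.trans (Equiv.piCongrLeft J e).symm)
      (T := fun j => T (e j)) (c := fun j => c (e j)) (fun j => hc _) (fun j => hT _)
    rw [← Equiv.prod_comp e]
    have hX : QEC.tensorOp f g T = QEC.tensorOp (f.trans (Equiv.piCongrLeft I e).symm)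
        (g.trans (Equiv.piCongrLeft J e).symm) fun j => T (e j) := ?_
    · rwa [hX]
    refine superOp_ext fun c d a b => ?_
    rw [tensorOp_single, tensorOp_single, ← Equiv.prod_comp e]
    rfl
  · intro I J _ _ _ _ K L _ _ _ _ f g T c hc hT G _ _ ρ
    have : Unique K := f.unique
    have : Unique L := g.unique
    have e : L ≃ K := Equiv.ofUnique L K
    have h : amplify G (QEC.tensorOp f g T) ρ =
        ρ.submatrix ((Equiv.refl G).prodCongr e) ((Equiv.refl G).prodCongr e) := by
      ext x y
      change QEC.tensorOp f g T _ x.2 y.2 = _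
      rw [superOp_apply]
      simp only [tensorOp_single, Finset.univ_eq_empty, Finset.prod_empty, mul_one]
      rw [Fintype.sum_unique, Fintype.sum_unique, Matrix.of_apply, Matrix.submatrix_apply]
      congr 1
      · exact Prod.ext rfl (Subsingleton.elim _ _)
      · exact Prod.ext rfl (Subsingleton.elim _ _)
    rw [h, traceNorm_submatrix_equiv]
    simp
  · intro α _ ih I J _ _ _ _ K L _ _ _ _ f g T c hc hT
    classical
    rw [Fintype.prod_option]
    refine (hT none).tensorPair (hc none) (ih (Equiv.refl _) (Equiv.refl _)
      (fun j => hc (some j)) (fun j => hT (some j))) (f.trans (Equiv.piOptionEquivProd))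
      (g.trans (Equiv.piOptionEquivProd)) fun c d x y => ?_
    rw [tensorOp_single, tensorOp_single, Fintype.prod_option]
    rfl

end TensorBound

/-! ## Expansions in an operator basis -/

section OperatorBasis

variable {κ I : Type} [Fintype κ] [Fintype I] [DecidableEq I]

/-- The matrices `P e` satisfy the completeness relation of an orthogonal basis of matrices of
squared Hilbert-Schmidt norm `N`. -/
def IsComplete (P : κ → Matrix I I ℂ) (N : ℂ) : Prop :=
  ∀ a c a' c', ∑ e, star (P e a c) * P e a' c' = if a = a' ∧ c = c' then N else 0

/-- The Hilbert-Schmidt inner product. -/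
def hsInner (P E : Matrix I I ℂ) : ℂ := ∑ a, ∑ c, star (P a c) * E a c

/-- The (unnormalized) coefficient of `sandwich P Q` in a superoperator. -/
def superInner (P Q : Matrix I I ℂ) : SuperOp I I →ₗ[ℂ] ℂ where
  toFun T := ∑ a, ∑ c, ∑ b, ∑ d, star (P a c) * Q b d * T (Matrix.single c d 1) a b
  map_add' S T := by
    simp [mul_add, Finset.sum_add_distrib]
  map_smul' z T := by
    simp [Finset.mul_sum, mul_left_comm]

lemma superInner_sandwich (P Q E F : Matrix I I ℂ) :
    superInner P Q (sandwich E F) = hsInner P E * star (hsInner Q F) := by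
  change ∑ a, ∑ c, ∑ b, ∑ d, _ = _
  simp only [sandwich_single, hsInner, star_sum, Finset.sum_mul, star_mul', star_star]
  simp only [Finset.mul_sum]
  refine Finset.sum_congr rfl fun a _ => Finset.sum_congr rfl fun c _ =>
    Finset.sum_congr rfl fun b _ => Finset.sum_congr rfl fun d _ => ?_
  ring

lemma IsComplete.sum_hsInner_smul {P : κ → Matrix I I ℂ} {N : ℂ} (hP : IsComplete P N)
    (hN : N ≠ 0) (E : Matrix I I ℂ) : ∑ e, (N⁻¹ * hsInner (P e) E) • P e = E := by
  ext a' c'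
  have h : ∀ e, ((N⁻¹ * hsInner (P e) E) • P e) a' c' =
      ∑ a, ∑ c, N⁻¹ * E a c * (star (P e a c) * P e a' c') := fun e => by
    simp only [Matrix.smul_apply, smul_eq_mul, hsInner, Finset.mul_sum, Finset.sum_mul]
    refine Finset.sum_congr rfl fun a _ => Finset.sum_congr rfl fun c _ => ?_
    ring
  rw [Matrix.sum_apply]
  simp only [h]
  rw [Finset.sum_comm]
  simp only [Finset.sum_comm (s := (Finset.univ : Finset κ)), ← Finset.mul_sum, hP _ _ a' c']
  rw [Finset.sum_eq_single a', Finset.sum_eq_single c']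
  · simp [mul_assoc, mul_comm (E a' c'), hN]
  · intro c _ hc
    simp [hc]
  · simp
  · intro a _ ha
    simp [ha]
  · simp

lemma sandwich_sum_smul (P : κ → Matrix I I ℂ) (x y : κ → ℂ) :
    sandwich (∑ e, x e • P e) (∑ f, y f • P f) =
      ∑ e, ∑ f, (x e * star (y f)) • sandwich (P e) (P f) := by
  refine LinearMap.ext fun ρ => ?_
  simp only [LinearMap.sum_apply, ← sandwich_smul_smul]
  change (∑ e, x e • P e) * ρ * (∑ f, y f • P f)ᴴ = ∑ e, ∑ f, (x e • P e) * ρ * (y f • P f)ᴴ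
  rw [Matrix.conjTranspose_sum, Finset.sum_mul, Finset.sum_mul]
  simp only [Finset.mul_sum]

lemma superOp_eq_sum_sandwich (T : SuperOp I I) :
    T = ∑ x : I × I × I × I, T (Matrix.single x.2.1 x.2.2.2 1) x.1 x.2.2.1 •
      sandwich (Matrix.single x.1 x.2.1 1) (Matrix.single x.2.2.1 x.2.2.2 1) := by
  refine superOp_ext fun c d a b => ?_
  rw [LinearMap.sum_apply, Matrix.sum_apply]
  simp only [LinearMap.smul_apply, Matrix.smul_apply, sandwich_single, smul_eq_mul]
  rw [Finset.sum_eq_single (a, c, b, d)]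
  · simp
  · rintro ⟨a', c', b', d'⟩ _ hne
    have : ¬ ((a' = a ∧ c' = c) ∧ b' = b ∧ d' = d) := by
      rintro ⟨⟨rfl, rfl⟩, rfl, rfl⟩
      exact hne rfl
    simp only [Matrix.single_apply]
    by_cases h1 : a' = a ∧ c' = c
    · rw [if_neg (fun h => this ⟨h1, h⟩ : ¬ (b' = b ∧ d' = d))]
      simp
    · rw [if_neg h1]
      simp
  · simp

/-- Every superoperator is a combination of the `sandwich (P e) (P f)`. -/
lemma IsComplete.superOp_eq_sum {P : κ → Matrix I I ℂ} {N : ℂ} (hP : IsComplete P N)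
    (hN : N ≠ 0) (T : SuperOp I I) :
    T = ∑ e, ∑ f, ((N * star N)⁻¹ * superInner (P e) (P f) T) • sandwich (P e) (P f) := by
  set R : SuperOp I I →ₗ[ℂ] SuperOp I I := ∑ e, ∑ f, ((N * star N)⁻¹ • superInner (P e) (P f)).smulRight
    (sandwich (P e) (P f)) with hR
  have hRT : ∀ T, R T = ∑ e, ∑ f, ((N * star N)⁻¹ * superInner (P e) (P f) T) •
      sandwich (P e) (P f) := fun T => by
    simp only [hR, LinearMap.sum_apply, LinearMap.smulRight_apply, LinearMap.smul_apply,
      smul_eq_mul]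
  have hs : ∀ E F, R (sandwich E F) = sandwich E F := fun E F => by
    rw [hRT]
    conv_rhs => rw [← hP.sum_hsInner_smul hN E, ← hP.sum_hsInner_smul hN F, sandwich_sum_smul]
    refine Finset.sum_congr rfl fun e _ => Finset.sum_congr rfl fun f _ => ?_
    rw [superInner_sandwich, star_mul', mul_inv, star_inv₀]
    congr 1
    ring
  rw [← hRT]
  conv_rhs => rw [superOp_eq_sum_sandwich T, map_sum]
  simp only [map_smul, hs]
  exact superOp_eq_sum_sandwich T

lemma IsComplete.mem_span_sandwich {P : κ → Matrix I I ℂ} {N : ℂ} (hP : IsComplete P N)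
    (hN : N ≠ 0) (T : SuperOp I I) :
    T ∈ Submodule.span ℂ {X | ∃ e f, X = sandwich (P e) (P f)} := by
  rw [hP.superOp_eq_sum hN T]
  exact sum_mem fun e _ => sum_mem fun f _ =>
    Submodule.smul_mem _ _ (Submodule.subset_span ⟨e, f, rfl⟩)

lemma IsComplete.tensorMat {ι : Type} [Fintype ι] [DecidableEq ι] {J : Type} [Fintype J]
    [DecidableEq J] {P : κ → Matrix J J ℂ} {N : ℂ} (hP : IsComplete P N) (f : I ≃ (ι → J)) :
    IsComplete (fun e : ι → κ => tensorMat f f fun j => P (e j)) (N ^ Fintype.card ι) := by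
  intro a c a' c'
  simp only [QEC.tensorMat, Matrix.of_apply, star_prod, ← Finset.prod_mul_distrib]
  rw [← Fintype.piFinset_univ, ← Finset.prod_univ_sum (fun _ => (Finset.univ : Finset κ))
    (fun j e => star (P e (f a j) (f c j)) * P e (f a' j) (f c' j))]
  simp only [hP _ _ _ _]
  rw [Finset.prod_ite_zero, Finset.prod_const, Finset.card_univ]
  have h : (∀ j ∈ Finset.univ, f a j = f a' j ∧ f c j = f c' j) ↔ a = a' ∧ c = c' := by
    rw [← forall_equiv_apply_eq_iff f a, ← forall_equiv_apply_eq_iff f c]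
    simp only [forall_and]
  by_cases hab : a = a' ∧ c = c'
  · rw [if_pos hab, if_pos (h.2 hab)]
  · rw [if_neg hab, if_neg (mt h.1 hab)]

end OperatorBasis

/-! ## Pauli operators -/

lemma sgn_zero : sgn 0 = 1 := by simp [sgn]

lemma zmod_two_cases (x : ZMod 2) : x = 0 ∨ x = 1 := by
  revert x
  decide

lemma sum_zmod_two (f : ZMod 2 → ℂ) : ∑ x, f x = f 0 + f 1 := Fin.sum_univ_two f

lemma zmod_two_one_add_one : (1 + 1 : ZMod 2) = 0 := by decide

lemma sgn_one : sgn 1 = -1 := by simp [sgn]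

lemma sgn_add (x y : ZMod 2) : sgn (x + y) = sgn x * sgn y := by
  rcases zmod_two_cases x with rfl | rfl <;> rcases zmod_two_cases y with rfl | rfl <;>
    simp [sgn_zero, sgn_one, zmod_two_one_add_one]

lemma sgn_sum {ι : Type} (s : Finset ι) (x : ι → ZMod 2) :
    sgn (∑ i ∈ s, x i) = ∏ i ∈ s, sgn (x i) := by
  classical
  induction s using Finset.induction_on with
  | empty => simp [sgn_zero]
  | insert i s hi ih => rw [Finset.sum_insert hi, Finset.prod_insert hi, sgn_add, ih]

lemma sgn_mul_self (x : ZMod 2) : sgn x * sgn x = 1 := by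
  by_cases h : x = 0 <;> simp [sgn, h]

lemma star_sgn (x : ZMod 2) : star (sgn x) = sgn x := by
  by_cases h : x = 0 <;> simp [sgn, h]

/-- Labels of the Pauli operators on `W`. -/
abbrev PauliLabel (W : Type) := (W → ZMod 2) × (W → ZMod 2)

/-- Entries of the one-qubit Pauli operator `X^x Z^z`. -/
def pauliEntry (x z a b : ZMod 2) : ℂ := if a = b + x then sgn (z * b) else 0

section Pauli

variable {W : Type} [Fintype W] [DecidableEq W]

/-- The Pauli operator `X^{e.1} Z^{e.2}`. -/
def pauli (e : PauliLabel W) : Matrix (W → ZMod 2) (W → ZMod 2) ℂ := Xop e.1 * Zop e.2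

lemma pauli_apply (e : PauliLabel W) (a b : W → ZMod 2) :
    pauli e a b = if a = b + e.1 then sgn (∑ w, e.2 w * b w) else 0 := by
  rw [pauli, Matrix.mul_apply, Finset.sum_eq_single b]
  · simp [Xop, Zop, funext_iff]
  · intro c _ hc
    have : ¬ ∀ w, c w = b w := fun h => hc (funext h)
    simp [Zop, this]
  · simp

lemma pauli_apply_prod (e : PauliLabel W) (a b : W → ZMod 2) :
    pauli e a b = ∏ w, pauliEntry (e.1 w) (e.2 w) (a w) (b w) := by
  rw [pauli_apply, sgn_sum]
  simp only [pauliEntry]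
  rw [Finset.prod_ite_zero]
  by_cases h : a = b + e.1
  · rw [if_pos h, if_pos (by simp [h])]
  · rw [if_neg h, if_neg fun h' => h (funext fun w => h' w (Finset.mem_univ w))]

lemma pauli_zero : pauli (0 : PauliLabel W) = 1 := by
  ext a b
  simp [pauli_apply, Matrix.one_apply, sgn_zero]

lemma pauli_mul (e f : PauliLabel W) :
    pauli e * pauli f = sgn (∑ w, e.2 w * f.1 w) • pauli (e + f) := by
  ext a b
  rw [Matrix.mul_apply, Finset.sum_eq_single (b + f.1)]
  · simp only [pauli_apply, Matrix.smul_apply, smul_eq_mul, Prod.fst_add, Prod.snd_add,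
      Pi.add_apply, mul_add, add_mul, Finset.sum_add_distrib, sgn_add, if_true]
    rw [add_assoc b, add_comm f.1]
    split_ifs <;> ring
  · intro c _ hc
    simp [pauli_apply, hc]
  · simp

lemma pauli_mul_comm (e f : PauliLabel W) :
    ∃ z : ℂ, pauli e * pauli f = z • (pauli f * pauli e) := by
  refine ⟨sgn (∑ w, e.2 w * f.1 w) * sgn (∑ w, f.2 w * e.1 w), ?_⟩
  rw [pauli_mul, pauli_mul, smul_smul, mul_assoc, sgn_mul_self, mul_one, add_comm]

lemma pauli_conjTranspose_mul_self (e : PauliLabel W) : (pauli e)ᴴ * pauli e = 1 := by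
  ext a b
  rw [Matrix.mul_apply, Finset.sum_eq_single (a + e.1)]
  · simp only [Matrix.conjTranspose_apply, pauli_apply, if_true, add_left_inj, Matrix.one_apply]
    by_cases h : a = b
    · simp only [h, if_true, star_sgn, sgn_mul_self]
    · simp [h]
  · intro c _ hc
    simp [pauli_apply, hc]
  · simp

lemma sum_pauliEntry (a c a' c' : ZMod 2) :
    ∑ p : ZMod 2 × ZMod 2, star (pauliEntry p.1 p.2 a c) * pauliEntry p.1 p.2 a' c' =
      if a = a' ∧ c = c' then 2 else 0 := by
  simp only [Fintype.sum_prod_type, sum_zmod_two]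
  rcases zmod_two_cases a with rfl | rfl <;> rcases zmod_two_cases c with rfl | rfl <;>
    rcases zmod_two_cases a' with rfl | rfl <;> rcases zmod_two_cases c' with rfl | rfl <;>
    simp [pauliEntry, sgn_zero, sgn_one, zmod_two_one_add_one] <;> norm_num

lemma sum_pauliEntry_mul (x z x' z' : ZMod 2) :
    ∑ a : ZMod 2, ∑ c : ZMod 2, star (pauliEntry x z a c) * pauliEntry x' z' a c =
      if x = x' ∧ z = z' then 2 else 0 := by
  simp only [sum_zmod_two]
  rcases zmod_two_cases x with rfl | rfl <;> rcases zmod_two_cases z with rfl | rfl <;>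
    rcases zmod_two_cases x' with rfl | rfl <;> rcases zmod_two_cases z' with rfl | rfl <;>
    simp [pauliEntry, sgn_zero, sgn_one, zmod_two_one_add_one] <;> norm_num

lemma isComplete_pauli : IsComplete (pauli (W := W)) (2 ^ Fintype.card W) := by
  intro a c a' c'
  simp only [pauli_apply_prod, star_prod, ← Finset.prod_mul_distrib]
  rw [← Equiv.sum_comp (Equiv.arrowProdEquivProdArrow W (fun _ => ZMod 2) (fun _ => ZMod 2))]
  refine (sum_prod_apply (Equiv.refl (W → ZMod 2 × ZMod 2)) fun w p =>
    star (pauliEntry p.1 p.2 (a w) (c w)) * pauliEntry p.1 p.2 (a' w) (c' w)).trans ?_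
  simp only [sum_pauliEntry]
  rw [Finset.prod_ite_zero, Finset.prod_const, Finset.card_univ]
  have h : (∀ w ∈ Finset.univ, a w = a' w ∧ c w = c' w) ↔ a = a' ∧ c = c' := by
    simp [forall_and, funext_iff]
  by_cases hab : a = a' ∧ c = c'
  · rw [if_pos hab, if_pos (h.2 hab)]
  · rw [if_neg hab, if_neg (mt h.1 hab)]

lemma hsInner_pauli (e f : PauliLabel W) :
    hsInner (pauli e) (pauli f) = if e = f then 2 ^ Fintype.card W else 0 := by
  simp only [hsInner, pauli_apply_prod, star_prod, ← Finset.prod_mul_distrib]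
  have := sum_sum_prod_apply (Equiv.refl (W → ZMod 2)) fun w x y =>
    star (pauliEntry (e.1 w) (e.2 w) x y) * pauliEntry (f.1 w) (f.2 w) x y
  simp only [Equiv.refl_apply] at this
  rw [this]
  simp only [sum_pauliEntry_mul]
  rw [Finset.prod_ite_zero, Finset.prod_const, Finset.card_univ]
  have h : (∀ w ∈ Finset.univ, e.1 w = f.1 w ∧ e.2 w = f.2 w) ↔ e = f := by
    simp [forall_and, Prod.ext_iff, funext_iff]
  by_cases hab : e = f
  · rw [if_pos hab, if_pos (h.2 hab)]
  · rw [if_neg hab, if_neg (mt h.1 hab)]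

lemma two_pow_card_ne_zero (W : Type) [Fintype W] : (2 ^ Fintype.card W : ℂ) ≠ 0 :=
  pow_ne_zero _ two_ne_zero

lemma hadamard_conjTranspose_mul_self : (hadamard W)ᴴ * hadamard W = 1 := by
  ext a b
  have h1 : ∀ a b : W → ZMod 2, hadamard W a b = ∏ w, ((Real.sqrt 2 : ℂ)⁻¹ * sgn (a w * b w)) :=
    fun a b => by
      rw [Finset.prod_mul_distrib, Finset.prod_const, Finset.card_univ, ← sgn_sum]
      rfl
  have h2 : ∀ a b : ZMod 2, ∑ c : ZMod 2, star ((Real.sqrt 2 : ℂ)⁻¹ * sgn (c * a)) *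
      ((Real.sqrt 2 : ℂ)⁻¹ * sgn (c * b)) = if a = b then 1 else 0 := fun a b => by
    have hs : (Real.sqrt 2 : ℂ)⁻¹ * (Real.sqrt 2 : ℂ)⁻¹ = 1 / 2 := by
      rw [← mul_inv, ← Complex.ofReal_mul, Real.mul_self_sqrt (by norm_num)]
      norm_num
    have h3 : ∀ c : ZMod 2, star ((Real.sqrt 2 : ℂ)⁻¹ * sgn (c * a)) *
        ((Real.sqrt 2 : ℂ)⁻¹ * sgn (c * b)) = 1 / 2 * (sgn (c * a) * sgn (c * b)) := fun c => by
      rw [star_mul', star_sgn, star_inv₀, RCLike.star_def, Complex.conj_ofReal, ← hs]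
      ring
    simp only [h3]
    simp only [sum_zmod_two]
    rcases zmod_two_cases a with rfl | rfl <;> rcases zmod_two_cases b with rfl | rfl <;>
      norm_num [sgn_zero, sgn_one]
  rw [Matrix.mul_apply]
  simp only [Matrix.conjTranspose_apply, h1, star_prod, ← Finset.prod_mul_distrib]
  have := sum_prod_apply (Equiv.refl (W → ZMod 2)) fun w c =>
    star ((Real.sqrt 2 : ℂ)⁻¹ * sgn (c * a w)) * ((Real.sqrt 2 : ℂ)⁻¹ * sgn (c * b w))
  simp only [Equiv.refl_apply] at this
  rw [this]
  simp only [h2, Matrix.one_apply]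
  rw [Finset.prod_ite_zero, Finset.prod_const_one]
  by_cases hab : a = b
  · rw [if_pos hab, if_pos (by simp [hab])]
  · rw [if_neg hab, if_neg fun h => hab (funext fun w => h w (Finset.mem_univ w))]

end Pauli

/-! ## Pauli operators on registers -/

section Registers

variable {W Loc : Type} [Fintype W] [DecidableEq W] [Fintype Loc] [DecidableEq Loc] (r : W → Loc)

/-- The part of a Pauli operator on the register `j`. -/
def PauliLabel.restrict (e : PauliLabel W) (j : Loc) : PauliLabel (Reg r j) :=
  (fun w => e.1 w.1, fun w => e.2 w.1)

/-- The Pauli operator with given parts on the registers. -/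
def PauliLabel.glue (p : ∀ j, PauliLabel (Reg r j)) : PauliLabel W :=
  (fun w => (p (r w)).1 ⟨w, rfl⟩, fun w => (p (r w)).2 ⟨w, rfl⟩)

lemma PauliLabel.restrict_glue (p : ∀ j, PauliLabel (Reg r j)) (j : Loc) :
    (PauliLabel.glue r p).restrict r j = p j := by
  refine Prod.ext (funext ?_) (funext ?_) <;>
  · rintro ⟨w, rfl⟩
    rfl

lemma tensorMat_pauli_restrict (e : PauliLabel W) :
    tensorMat (regEquiv r) (regEquiv r) (fun j => pauli (e.restrict r j)) = pauli e := by
  ext a b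
  simp only [tensorMat, Matrix.of_apply, pauli_apply_prod]
  exact Fintype.prod_fiberwise r fun w => pauliEntry (e.1 w) (e.2 w) (a w) (b w)

lemma sandwich_pauli_eq_tensorOp (e f : PauliLabel W) :
    sandwich (pauli e) (pauli f) = tensorOp (regEquiv r) (regEquiv r) fun j =>
      sandwich (pauli (e.restrict r j)) (pauli (f.restrict r j)) := by
  rw [tensorOp_sandwich, tensorMat_pauli_restrict, tensorMat_pauli_restrict]

/-- The set of wires on which a Pauli operator acts nontrivially. -/
def PauliLabel.support {W : Type} [Fintype W] (e : PauliLabel W) : Finset W :=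
  Finset.univ.filter fun w => e.1 w ≠ 0 ∨ e.2 w ≠ 0

/-- Expand every factor in Pauli operators and glue them across registers. Left and right operators
are tracked by separate sets because the two sides of a superoperator can carry different errors. -/
lemma tensorOp_mem_span_pauli (S S' : Finset Loc)
    (T : ∀ j, SuperOp (Reg r j → ZMod 2) (Reg r j → ZMod 2))
    (hT : ∀ j, T j ∈ Submodule.span ℂ {X | ∃ e f : PauliLabel (Reg r j),
      ((j ∉ S → e = 0) ∧ (j ∉ S' → f = 0)) ∧ X = sandwich (pauli e) (pauli f)}) :
    tensorOp (regEquiv r) (regEquiv r) T ∈ Submodule.span ℂ {X | ∃ e f : PauliLabel W,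
      ((∀ w ∈ e.support, r w ∈ S) ∧ (∀ w ∈ f.support, r w ∈ S')) ∧
        X = sandwich (pauli e) (pauli f)} := by
  refine Submodule.span_mono ?_
    (multilinearMap_mem_span (tensorOpMultilinear (regEquiv r) (regEquiv r)) _ T hT)
  rintro _ ⟨x, hx, rfl⟩
  choose e f hef hX using hx
  have key : ∀ (p : ∀ j, PauliLabel (Reg r j)) (S : Finset Loc), (∀ j, j ∉ S → p j = 0) →
      ∀ w ∈ (PauliLabel.glue r p).support, r w ∈ S := fun p S h w hw => by
    by_contra hwS
    have h0 : (p (r w)).1 ⟨w, rfl⟩ ≠ 0 ∨ (p (r w)).2 ⟨w, rfl⟩ ≠ 0 := (Finset.mem_filter.1 hw).2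
    rw [h _ hwS] at h0
    simp at h0
  refine ⟨PauliLabel.glue r e, PauliLabel.glue r f, ⟨key e S fun j => (hef j).1,
    key f S' fun j => (hef j).2⟩, ?_⟩
  rw [sandwich_pauli_eq_tensorOp r]
  simp only [PauliLabel.restrict_glue]
  change tensorOp _ _ x = _
  rw [funext hX]

end Registers

/-! ## Truncation of a noisy layer to few faults -/

section Truncation

variable {ι : Type} [Fintype ι] [DecidableEq ι] {I J : ι → Type}
  [∀ j, Fintype (I j)] [∀ j, DecidableEq (I j)] [∀ j, Fintype (J j)] [∀ j, DecidableEq (J j)]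
  {K L : Type} [Fintype K] [DecidableEq K] [Fintype L] [DecidableEq L]

/-- The part of `⨂ⱼ Nⱼ = ⨂ⱼ (Gⱼ + (Nⱼ - Gⱼ))` with at most `m` factors `Nⱼ - Gⱼ`. -/
def truncated (f : K ≃ ∀ j, I j) (g : L ≃ ∀ j, J j) (N G : ∀ j, SuperOp (I j) (J j)) (m : ℕ) :
    SuperOp K L :=
  ∑ S : Finset ι with S.card ≤ m, tensorOp f g (S.piecewise (N - G) G)

/-- Chernoff argument: a term with more than m faults may be multiplied by 5^(|S| - m - 1) ≥ 1; the
sum over all `S` is then binomial, with base 5δ + (1 + δ). -/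
lemma sum_pow_card_tail_le (N m : ℕ) (hN : Fintype.card ι = N) {δ : ℝ} (hδ : 0 ≤ δ) :
    ∑ S : Finset ι with ¬ S.card ≤ m, δ ^ S.card * (1 + δ) ^ (N - S.card) ≤
      (1 / 5) ^ (m + 1) * (1 + 6 * δ) ^ N := by
  have h1 : ∀ S ∈ (Finset.univ.filter fun S : Finset ι => ¬ S.card ≤ m),
      δ ^ S.card * (1 + δ) ^ (N - S.card) ≤
        (1 / 5) ^ (m + 1) * ((5 * δ) ^ S.card * (1 + δ) ^ (N - S.card)) := fun S hS => by
    have hS' : m + 1 ≤ S.card := by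
      have := (Finset.mem_filter.1 hS).2
      omega
    rw [← mul_assoc]
    refine mul_le_mul_of_nonneg_right ?_ (by positivity)
    rw [mul_pow, ← mul_assoc]
    refine le_mul_of_one_le_left (by positivity) ?_
    rw [one_div, inv_pow, ← div_eq_inv_mul, one_le_div (by positivity)]
    exact pow_le_pow_right₀ (by norm_num) hS'
  refine (Finset.sum_le_sum h1).trans ?_
  rw [← Finset.mul_sum]
  refine mul_le_mul_of_nonneg_left ?_ (by positivity)
  refine (Finset.sum_le_univ_sum_of_nonneg fun S => by positivity).trans (le_of_eq ?_)
  rw [← hN, ← Finset.card_univ, ← Finset.powerset_univ, Finset.sum_pow_mul_eq_add_pow]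
  ring

/-- Since e^13 ≤ 5^10, the first factor is at most exp(-13xδ), while the second is at most
exp(12xδ). The threshold 10xδ is chosen so that the first one wins. -/
lemma tail_le_exp {N m : ℕ} {x δ : ℝ} (hδ : 0 ≤ δ) (hN : (N : ℝ) ≤ 2 * x)
    (hm : 10 * (x * δ) ≤ m + 1) :
    (1 / 5 : ℝ) ^ (m + 1) * (1 + 6 * δ) ^ N ≤ Real.exp (-(x * δ)) := by
  have h1 : (1 / 5 : ℝ) ≤ Real.exp (-(13 / 10)) := by
    rw [Real.exp_neg, one_div, inv_le_inv₀ (by norm_num) (Real.exp_pos _)]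
    have h : Real.exp (13 / 10) ^ 10 ≤ (5 : ℝ) ^ 10 := by
      rw [← Real.exp_nat_mul]
      have : ((10 : ℕ) : ℝ) * (13 / 10) = (13 : ℕ) * 1 := by norm_num
      rw [this, Real.exp_nat_mul]
      refine (pow_le_pow_left₀ (Real.exp_pos _).le Real.exp_one_lt_d9.le 13).trans ?_
      norm_num
    exact le_of_pow_le_pow_left₀ (by norm_num) (by norm_num) h
  have h2 : (1 / 5 : ℝ) ^ (m + 1) ≤ Real.exp (-(13 * (x * δ))) := by
    refine (pow_le_pow_left₀ (by norm_num) h1 _).trans ?_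
    rw [← Real.exp_nat_mul, Real.exp_le_exp]
    push_cast
    linarith
  have h3 : (1 + 6 * δ) ^ N ≤ Real.exp (12 * (x * δ)) := by
    refine (pow_le_pow_left₀ (by positivity)
      ((add_comm 1 (6 * δ)).le.trans (Real.add_one_le_exp (6 * δ))) _).trans ?_
    rw [← Real.exp_nat_mul, Real.exp_le_exp]
    nlinarith
  refine (mul_le_mul h2 h3 (by positivity) (Real.exp_pos _).le).trans ?_
  rw [← Real.exp_add, Real.exp_le_exp]
  linarith

lemma diamondLE_tensorOp_sub_truncated (f : K ≃ ∀ j, I j) (g : L ≃ ∀ j, J j)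
    {N G : ∀ j, SuperOp (I j) (J j)} {m : ℕ} {x δ : ℝ} (hδ : 0 ≤ δ)
    (hN : ∀ j, DiamondLE (N j) 1) (hNG : ∀ j, DiamondLE (N j - G j) δ)
    (hx : (Fintype.card ι : ℝ) ≤ 2 * x) (hm : 10 * (x * δ) ≤ m + 1) :
    DiamondLE (tensorOp f g N - truncated f g N G m) (Real.exp (-(x * δ))) := by
  -- The ideal gates are not assumed to be channels; their norm is bounded through the nearby
  -- channels `N j`, which is why 1 + δ appears in the tail sum.
  have hG : ∀ j, DiamondLE (G j) (1 + δ) := fun j => by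
    have h := (hN j).add (hNG j).neg
    rwa [← sub_eq_add_neg, sub_sub_cancel] at h
  have h1 : tensorOp f g N = ∑ S : Finset ι, tensorOp f g (S.piecewise (N - G) G) := by
    rw [← tensorOp_add]
    congr 1
    funext j
    simp
  have h2 : tensorOp f g N - truncated f g N G m =
      ∑ S : Finset ι with ¬ S.card ≤ m, tensorOp f g (S.piecewise (N - G) G) := by
    rw [h1, truncated, sub_eq_iff_eq_add, add_comm, Finset.sum_filter_add_sum_filter_not]
  rw [h2]
  refine (DiamondLE.sum _ (c := fun S : Finset ι =>
    δ ^ S.card * (1 + δ) ^ (Fintype.card ι - S.card)) fun S _ => ?_).mono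
    ((sum_pow_card_tail_le _ m rfl hδ).trans (tail_le_exp hδ hx hm))
  have h3 : ∏ j, S.piecewise (fun _ => δ) (fun _ => 1 + δ) j =
      δ ^ S.card * (1 + δ) ^ (Fintype.card ι - S.card) := by
    rw [Finset.prod_piecewise]
    simp [Finset.card_sdiff]
  rw [← h3]
  refine DiamondLE.tensorOp f g (fun j => ?_) fun j => ?_
  · by_cases hj : j ∈ S <;> simp [hj] <;> positivity
  · by_cases hj : j ∈ S <;> simp only [Finset.piecewise, hj, if_true, if_false]
    · exact hNG j
    · exact hG j

end Truncation

/-! ## Errors of bounded weight on data and ancilla qubits -/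

section Errors

variable {D A : Type} [Fintype D] [DecidableEq D] [Fintype A] [DecidableEq A]

/-- A Pauli operator acting on at most `x` data qubits and at most `x` ancilla qubits. -/
def PauliLabel.IsLocal (x : ℕ) (e : PauliLabel (D ⊕ A)) : Prop :=
  e.support.toLeft.card ≤ x ∧ e.support.toRight.card ≤ x

/-- Superoperators `I` followed by an error acting on at most `x` data qubits and at most `x`
ancilla qubits. -/
def errorSpan {H : Type} [Fintype H] (x : ℕ) (I : SuperOp H (D ⊕ A → ZMod 2)) :
    Submodule ℂ (SuperOp H (D ⊕ A → ZMod 2)) :=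
  Submodule.span ℂ {X | ∃ e f : PauliLabel (D ⊕ A),
    (e.IsLocal x ∧ f.IsLocal x) ∧ X = sandwich (pauli e) (pauli f) ∘ₗ I}

lemma comp_mem_errorSpan {H : Type} [Fintype H] {x : ℕ} {I : SuperOp H (D ⊕ A → ZMod 2)}
    {Y : SuperOp (D ⊕ A → ZMod 2) (D ⊕ A → ZMod 2)} {P Q : PauliLabel (D ⊕ A) → Prop}
    (hY : Y ∈ Submodule.span ℂ {X | ∃ e f : PauliLabel (D ⊕ A), (P e ∧ Q f) ∧
      X = sandwich (pauli e) (pauli f)}) (hP : ∀ e, P e → e.IsLocal x)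
    (hQ : ∀ e, Q e → e.IsLocal x) : Y ∘ₗ I ∈ errorSpan x I := by
  induction hY using Submodule.span_induction with
  | mem Y hY =>
    obtain ⟨e, f, ⟨he, hf⟩, rfl⟩ := hY
    exact Submodule.subset_span ⟨e, f, ⟨hP e he, hQ f hf⟩, rfl⟩
  | zero => rw [LinearMap.zero_comp]; exact zero_mem _
  | add Y Y' _ _ h h' => rw [LinearMap.add_comp]; exact add_mem h h'
  | smul c Y _ h => rw [LinearMap.smul_comp]; exact Submodule.smul_mem _ _ h

/-- The old error meets at most 2x locations, x through data and x through ancilla qubits, and at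
most m more are faulty. As `r` is injective on data and on ancilla qubits separately, the number of
locations bounds each of the two new supports, not merely their total. -/
lemma PauliLabel.IsLocal.of_spread {Loc : Type} [Fintype Loc] [DecidableEq Loc]
    {r : D ⊕ A → Loc} (hD : ∀ q q' : D, r (Sum.inl q) = r (Sum.inl q') → q = q')
    (hA : ∀ k k' : A, r (Sum.inr k) = r (Sum.inr k') → k = k') {S : Finset Loc} {m x : ℕ}
    (hS : S.card ≤ m) {e e' : PauliLabel (D ⊕ A)} (he : e.IsLocal x)
    (h : ∀ w ∈ e'.support, r w ∈ S ∪ e.support.image r) : e'.IsLocal (2 * x + m) := by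
  have h1 : (S ∪ e.support.image r).card ≤ 2 * x + m := by
    have h2 := Finset.card_union_le S (e.support.image r)
    have h3 := Finset.card_image_le (s := e.support) (f := r)
    have h4 := Finset.card_toLeft_add_card_toRight (u := e.support)
    have h5 := he.1
    have h6 := he.2
    omega
  constructor
  · refine (Finset.card_le_card_of_injOn (fun q => r (Sum.inl q)) (fun q hq => ?_)
      (fun q _ q' _ hqq => hD q q' hqq)).trans h1
    exact h _ (Finset.mem_toLeft.1 hq)
  · refine (Finset.card_le_card_of_injOn (fun k => r (Sum.inr k)) (fun k hk => ?_)
      (fun k _ k' _ hkk => hA k k' hkk)).trans h1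
    exact h _ (Finset.mem_toRight.1 hk)

/-- `P` and `Q` stand for "this register is untouched on the left, respectively on the right", so
one location may carry an error on one side only. -/
lemma sandwich_mem_span_pauli {W : Type} [Fintype W] [DecidableEq W] {P Q : Prop}
    {E F : Matrix (W → ZMod 2) (W → ZMod 2) ℂ} (hE : P → E = 1) (hF : Q → F = 1) :
    sandwich E F ∈ Submodule.span ℂ {X | ∃ e f : PauliLabel W,
      ((P → e = 0) ∧ (Q → f = 0)) ∧ X = sandwich (pauli e) (pauli f)} := by
  have key : ∀ (P : Prop) (E : Matrix (W → ZMod 2) (W → ZMod 2) ℂ), (P → E = 1) →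
      ∃ x : PauliLabel W → ℂ, (∀ e, x e ≠ 0 → P → e = 0) ∧ E = ∑ e, x e • pauli e := by
    intro P E h
    by_cases hP : P
    · refine ⟨Pi.single 0 1, fun e he _ => ?_, ?_⟩
      · by_contra h0
        exact he (Pi.single_eq_of_ne h0 _)
      · rw [Finset.sum_eq_single 0]
        · simp [pauli_zero, h hP]
        · intro e _ he
          simp [he]
        · simp
    · exact ⟨_, fun e _ h => absurd h hP,
        (isComplete_pauli.sum_hsInner_smul (two_pow_card_ne_zero W) E).symm⟩
  obtain ⟨x, hx, rfl⟩ := key P E hE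
  obtain ⟨y, hy, rfl⟩ := key Q F hF
  rw [sandwich_sum_smul]
  refine sum_mem fun e _ => sum_mem fun f _ => ?_
  by_cases h : x e = 0 ∨ y f = 0
  · have : x e * star (y f) = 0 := by
      rcases h with h | h <;> simp [h]
    rw [this, zero_smul]
    exact zero_mem _
  · push Not at h
    exact Submodule.smul_mem _ _ (Submodule.subset_span ⟨e, f, ⟨hx e h.1, hy f h.2⟩, rfl⟩)

lemma superOp_mem_span_pauli {W : Type} [Fintype W] [DecidableEq W] {P Q : Prop} (hP : ¬ P)
    (hQ : ¬ Q) (T : SuperOp (W → ZMod 2) (W → ZMod 2)) :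
    T ∈ Submodule.span ℂ {X | ∃ e f : PauliLabel W,
      ((P → e = 0) ∧ (Q → f = 0)) ∧ X = sandwich (pauli e) (pauli f)} := by
  refine Submodule.span_mono ?_
    (isComplete_pauli.mem_span_sandwich (two_pow_card_ne_zero W) T)
  rintro _ ⟨e, f, rfl⟩
  exact ⟨e, f, ⟨fun h => absurd h hP, fun h => absurd h hQ⟩, rfl⟩

lemma comp_eq_comp_sandwich {I J : Type} [Fintype I] [DecidableEq I] {U : Matrix I I ℂ}
    (hU : Uᴴ * U = 1) (T : SuperOp I J) :
    T = (T ∘ₗ sandwich Uᴴ Uᴴ) ∘ₗ sandwich U U := by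
  rw [LinearMap.comp_assoc, sandwich_comp, hU, sandwich_one_one, LinearMap.comp_id]

lemma PauliLabel.restrict_eq_zero {W Loc : Type} [Fintype W] [DecidableEq Loc] {r : W → Loc}
    {e : PauliLabel W} {j : Loc} (hj : j ∉ e.support.image r) : e.restrict r j = 0 := by
  have h0 : ∀ w : Reg r j, w.1 ∉ e.support := fun w hw =>
    hj (Finset.mem_image.2 ⟨w.1, hw, w.2⟩)
  simp only [PauliLabel.support, Finset.mem_filter, Finset.mem_univ, true_and, not_or,
    not_not] at h0
  exact Prod.ext (funext fun w => (h0 w).1) (funext fun w => (h0 w).2)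

/-- Commuting a Pauli error through a layer of unitary gates, some of them faulty. -/
lemma tensorOp_comp_sandwich_pauli {W Loc : Type} [Fintype W] [DecidableEq W] [Fintype Loc]
    [DecidableEq Loc] (r : W → Loc) (U : ∀ j, Matrix (Reg r j → ZMod 2) (Reg r j → ZMod 2) ℂ)
    (hU : ∀ j, (U j)ᴴ * U j = 1) (S : Finset Loc)
    (T : ∀ j, SuperOp (Reg r j → ZMod 2) (Reg r j → ZMod 2))
    (hT : ∀ j, j ∉ S → T j = sandwich (U j) (U j)) (e f : PauliLabel W) :
    ∃ Y ∈ Submodule.span ℂ {X | ∃ e' f' : PauliLabel W,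
      ((∀ w ∈ e'.support, r w ∈ S ∪ e.support.image r) ∧
        (∀ w ∈ f'.support, r w ∈ S ∪ f.support.image r)) ∧ X = sandwich (pauli e') (pauli f')},
      tensorOp (regEquiv r) (regEquiv r) T ∘ₗ sandwich (pauli e) (pauli f) =
        Y ∘ₗ tensorOp (regEquiv r) (regEquiv r) fun j => sandwich (U j) (U j) := by
  -- At each location the witness is the possibly faulty gate after the incoming Pauli part and the
  -- inverse ideal gate. It is trivial, on either side, where there is neither a fault nor an
  -- incoming error on that side.
  refine ⟨_, tensorOp_mem_span_pauli r (S ∪ e.support.image r) (S ∪ f.support.image r)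
    (fun j => (T j ∘ₗ sandwich (pauli (e.restrict r j)) (pauli (f.restrict r j))) ∘ₗ
      sandwich (U j)ᴴ (U j)ᴴ) fun j => ?_, ?_⟩
  · by_cases hj : j ∈ S
    · exact superOp_mem_span_pauli (fun h => h (Finset.mem_union_left _ hj))
        (fun h => h (Finset.mem_union_left _ hj)) _
    · rw [hT j hj, sandwich_comp, sandwich_comp]
      have hU2 : U j * (U j)ᴴ = 1 := mul_eq_one_comm.1 (hU j)
      refine sandwich_mem_span_pauli (fun h => ?_) (fun h => ?_) <;>
      · rw [PauliLabel.restrict_eq_zero fun h' => h (Finset.mem_union_right _ h'), pauli_zero,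
          mul_one, hU2]
  · rw [sandwich_pauli_eq_tensorOp r, tensorOp_comp, tensorOp_comp]
    refine congrArg (tensorOp (regEquiv r) (regEquiv r)) (funext fun j => ?_)
    exact comp_eq_comp_sandwich (hU j) _

lemma unitaryGroup_conjTranspose_mul_self {I : Type} [Fintype I] [DecidableEq I]
    (U : Matrix.unitaryGroup I ℂ) : (U : Matrix I I ℂ)ᴴ * (U : Matrix I I ℂ) = 1 :=
  Unitary.coe_star_mul_self U

/-- A layer of unitary gates with at most `m` faults turns an error on `x` qubits into an error on
`2 x + m` qubits after the ideal layer. -/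
lemma GateLayer.tensorOp_comp_mem_errorSpan (G : GateLayer D A) {S : Finset G.Loc} {m x : ℕ}
    (hS : S.card ≤ m) {T : ∀ j, SuperOp (Reg G.reg j → ZMod 2) (Reg G.reg j → ZMod 2)}
    (hT : ∀ j, j ∉ S → T j = sandwich (G.gate j : Matrix _ _ ℂ) (G.gate j : Matrix _ _ ℂ))
    {H : Type} [Fintype H] {I X : SuperOp H (D ⊕ A → ZMod 2)} (hX : X ∈ errorSpan x I) :
    tensorOp (regEquiv G.reg) (regEquiv G.reg) T ∘ₗ X ∈
      errorSpan (2 * x + m) (G.toLayer.ideal ∘ₗ I) := by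
  induction hX using Submodule.span_induction with
  | zero => rw [LinearMap.comp_zero]; exact zero_mem _
  | add Y Y' _ _ h h' => rw [LinearMap.comp_add]; exact add_mem h h'
  | smul c Y _ h => rw [LinearMap.comp_smul]; exact Submodule.smul_mem _ _ h
  | mem Y hY =>
    obtain ⟨e, f, ⟨he, hf⟩, rfl⟩ := hY
    obtain ⟨Y, hY, hYe⟩ := tensorOp_comp_sandwich_pauli G.reg
      (fun j => (G.gate j).1) (fun j => unitaryGroup_conjTranspose_mul_self (G.gate j)) S T hT e f
    rw [← LinearMap.comp_assoc, hYe, LinearMap.comp_assoc]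
    exact comp_mem_errorSpan hY (fun e' h => he.of_spread G.reg_data G.reg_anc hS h)
      (fun f' h => hf.of_spread G.reg_data G.reg_anc hS h)

end Errors

/-! ## Noisy syndrome extraction circuits -/

section Layers

variable {W W' : Type} [Fintype W] [DecidableEq W] [Fintype W'] [DecidableEq W']

lemma Layer.diamondLE_of_mem_trans {L : Layer W W'} {δ : ℝ}
    {T : SuperOp (W → ZMod 2) (W' → ZMod 2)} (hT : T ∈ L.trans δ) : DiamondLE T 1 := by
  obtain ⟨N, hN, rfl⟩ := hT
  have h := DiamondLE.tensorOp (regEquiv L.inReg) (regEquiv L.outReg) (T := N) (c := fun _ => 1)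
    (fun _ => zero_le_one) fun j => (hN j).1.diamondLE
  rw [Finset.prod_const_one] at h
  exact h

/-- A noisy layer with at most `m` faults. -/
def Layer.truncated (L : Layer W W')
    (N : ∀ j, SuperOp (Reg L.inReg j → ZMod 2) (Reg L.outReg j → ZMod 2)) (m : ℕ) :
    SuperOp (W → ZMod 2) (W' → ZMod 2) :=
  QEC.truncated (regEquiv L.inReg) (regEquiv L.outReg) N L.gate m

lemma Layer.diamondLE_apply_sub_truncated (L : Layer W W')
    {N : ∀ j, SuperOp (Reg L.inReg j → ZMod 2) (Reg L.outReg j → ZMod 2)} {m : ℕ} {x δ : ℝ}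
    (hδ : 0 ≤ δ) (hN : ∀ j, L.IsNoisyGate δ j (N j))
    (hx : (Fintype.card L.Loc : ℝ) ≤ 2 * x) (hm : 10 * (x * δ) ≤ m + 1) :
    DiamondLE (L.apply N - L.truncated N m) (Real.exp (-(x * δ))) :=
  diamondLE_tensorOp_sub_truncated _ _ hδ (fun j => (hN j).1.diamondLE)
    (fun j => diamondLE_of_dnorm_le hδ (hN j).2.2) hx hm

end Layers

/-! ### Faulty preparations as ideal preparations followed by errors. -/

section Preparation

variable {I J : Type} [Fintype I] [DecidableEq I] [Fintype J] [DecidableEq J]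

lemma exists_eq_comp_relabel {f : J → I} {f' : I → J} (hf : ∀ a, f (f' a) = a) (T : SuperOp I J) :
    ∃ L : SuperOp J J, T = L ∘ₗ relabel f := by
  refine ⟨T ∘ₗ relabel f', LinearMap.ext fun ρ => ?_⟩
  change T ρ = T (Matrix.of fun a b => ρ (f (f' a)) (f (f' b)))
  simp only [hf]
  rfl

/-- A map on a one-dimensional input depends on the trace only, and `prepare τ` preserves the trace;
preparing `T 1` afterwards therefore recovers `T`. -/
lemma exists_eq_comp_prepare [Unique I] {τ : Matrix J J ℂ} (hτ : τ.trace = 1) (T : SuperOp I J) :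
    ∃ L : SuperOp J J, T = L ∘ₗ prepare τ := by
  refine ⟨prepare (T 1), LinearMap.ext fun ρ => ?_⟩
  change T ρ = (ρ.trace • τ).trace • T 1
  rw [Matrix.trace_smul, hτ, smul_eq_mul, mul_one, ← map_smul]
  congr 1
  ext a b
  rw [Subsingleton.elim a default, Subsingleton.elim b default]
  simp [Matrix.trace]

lemma relabel_eq_sandwich (f : J → I) :
    relabel f = sandwich (Matrix.of fun (a : J) (c : I) => if f a = c then (1 : ℂ) else 0)
      (Matrix.of fun a c => if f a = c then 1 else 0) := by
  refine superOp_ext fun c d a b => ?_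
  rw [sandwich_single]
  change Matrix.single c d (1 : ℂ) (f a) (f b) = _
  simp only [Matrix.single_apply, eq_comm (a := c), eq_comm (a := d)]
  by_cases h1 : f a = c <;> by_cases h2 : f b = d <;> simp [h1, h2]

lemma prepare_eq_sandwich [Unique I] {τ : Matrix J J ℂ} {v : J → ℂ}
    (hτ : ∀ a b, τ a b = v a * star (v b)) :
    prepare (I := I) τ = sandwich (Matrix.of fun a _ => v a) (Matrix.of fun a _ => v a) := by
  refine superOp_ext fun c d a b => ?_
  rw [sandwich_single]
  change ((Matrix.single c d (1 : ℂ)).trace • τ) a b = _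
  rw [Subsingleton.elim d c]
  simp [hτ]

lemma initState_apply (W : Type) [Fintype W] [DecidableEq W] (b : PauliBasis) :
    ∃ v : (W → ZMod 2) → ℂ, ∀ a c, initState W b a c = v a * star (v c) := by
  cases b with
  | Z =>
    refine ⟨fun a => if a = 0 then 1 else 0, fun a c => ?_⟩
    by_cases h1 : a = 0 <;> by_cases h2 : c = 0 <;>
      simp [initState, h1, h2, eq_comm]
  | X =>
    refine ⟨fun a => hadamard W a 0, fun a c => ?_⟩
    change sandwich (hadamard W) (hadamard W) (Matrix.single 0 0 1) a c = _
    rw [sandwich_single]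

lemma trace_initState (W : Type) [Fintype W] [DecidableEq W] (b : PauliBasis) :
    (initState W b).trace = 1 := by
  cases b with
  | Z => simp [initState]
  | X =>
    change (hadamard W * Matrix.single 0 0 (1 : ℂ) * (hadamard W)ᴴ).trace = 1
    rw [Matrix.trace_mul_comm, ← Matrix.mul_assoc, hadamard_conjTranspose_mul_self,
      Matrix.one_mul]
    simp

end Preparation

section Circuit

variable {D A : Type} [Fintype D] [DecidableEq D] [Fintype A] [DecidableEq A]

lemma isEmpty_reg_inl_inr (k : A) : IsEmpty (Reg (Sum.inl : D → D ⊕ A) (Sum.inr k)) :=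
  ⟨fun w => Sum.inl_ne_inr w.2⟩

lemma prepLayer_exists_eq_comp (basis : A → PauliBasis) (j : D ⊕ A)
    (T : SuperOp (Reg (Sum.inl : D → D ⊕ A) j → ZMod 2) (Reg (id : D ⊕ A → D ⊕ A) j → ZMod 2)) :
    ∃ L : SuperOp (Reg (id : D ⊕ A → D ⊕ A) j → ZMod 2) (Reg (id : D ⊕ A → D ⊕ A) j → ZMod 2),
      T = L ∘ₗ (prepLayer D A basis).gate j := by
  cases j with
  | inl q =>
    refine exists_eq_comp_relabel (f' := fun a _ => a ⟨q, rfl⟩) (fun a => ?_) T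
    funext w
    obtain ⟨w, hw⟩ := w
    obtain rfl : w = q := Sum.inl_injective hw
    rfl
  | inr k =>
    have := isEmpty_reg_inl_inr (D := D) k
    exact exists_eq_comp_prepare (trace_initState _ _) T

/-- The prepared states are pure, so one Kraus operator suffices. With the unitary gates it forms
the single operator W that is later compared with the syndrome projectors. -/
lemma prepLayer_ideal_eq_sandwich (basis : A → PauliBasis) :
    ∃ M : Matrix (D ⊕ A → ZMod 2) (D → ZMod 2) ℂ,
      (prepLayer D A basis).ideal = sandwich M M := by
  have h : ∀ j : D ⊕ A, ∃ M : Matrix (Reg (id : D ⊕ A → D ⊕ A) j → ZMod 2)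
      (Reg (Sum.inl : D → D ⊕ A) j → ZMod 2) ℂ,
      (prepLayer D A basis).gate j = sandwich M M := fun j => by
    cases j with
    | inl q => exact ⟨_, relabel_eq_sandwich _⟩
    | inr k =>
      have := isEmpty_reg_inl_inr (D := D) k
      obtain ⟨v, hv⟩ := initState_apply (Reg (id : D ⊕ A → D ⊕ A) (Sum.inr k)) (basis k)
      exact ⟨_, prepare_eq_sandwich hv⟩
  choose M hM using h
  refine ⟨tensorMat (regEquiv _) (regEquiv _) M, ?_⟩
  rw [← tensorOp_sandwich]
  exact congrArg (tensorOp (regEquiv _) (regEquiv _)) (funext hM)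

lemma prepLayer_tensorOp_mem_errorSpan (basis : A → PauliBasis) {S : Finset (D ⊕ A)} {m : ℕ}
    (hS : S.card ≤ m)
    {T : ∀ j, SuperOp (Reg (Sum.inl : D → D ⊕ A) j → ZMod 2) (Reg (id : D ⊕ A → D ⊕ A) j → ZMod 2)}
    (hT : ∀ j, j ∉ S → T j = (prepLayer D A basis).gate j) :
    tensorOp (regEquiv _) (regEquiv _) T ∈ errorSpan m (prepLayer D A basis).ideal := by
  choose L hL using fun j => prepLayer_exists_eq_comp basis j (T j)
  let G : ∀ j, SuperOp (Reg (Sum.inl : D → D ⊕ A) j → ZMod 2) (Reg (id : D ⊕ A → D ⊕ A) j → ZMod 2) :=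
    (prepLayer D A basis).gate
  have h0 : (prepLayer D A basis).ideal = tensorOp (regEquiv Sum.inl) (regEquiv id) G := rfl
  have h1 : tensorOp (regEquiv _) (regEquiv _) T = tensorOp (regEquiv id) (regEquiv id)
      (fun j => if j ∈ S then L j else LinearMap.id) ∘ₗ (prepLayer D A basis).ideal := by
    rw [h0, tensorOp_comp]
    refine congrArg (tensorOp (regEquiv _) (regEquiv _)) (funext fun j => ?_)
    by_cases hj : j ∈ S
    · simp only [hj, if_true]
      exact hL j
    · simp only [hj, if_false]
      exact hT j hj
  have h2 : ∀ e : PauliLabel (D ⊕ A), (∀ w ∈ e.support, id w ∈ S) → e.IsLocal m := fun e he =>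
    ⟨(Finset.card_le_card_of_injOn Sum.inl (fun q hq => he _ (Finset.mem_toLeft.1 hq))
      Sum.inl_injective.injOn).trans hS,
     (Finset.card_le_card_of_injOn Sum.inr (fun q hq => he _ (Finset.mem_toRight.1 hq))
      Sum.inr_injective.injOn).trans hS⟩
  rw [h1]
  refine comp_mem_errorSpan (tensorOp_mem_span_pauli id S S _ fun j => ?_) h2 h2
  by_cases hj : j ∈ S
  · exact superOp_mem_span_pauli (fun h => h hj) (fun h => h hj) _
  · rw [if_neg hj, ← sandwich_one_one]
    exact sandwich_mem_span_pauli (fun _ => rfl) (fun _ => rfl)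

/-- The change of basis preceding a computational basis measurement of the ancilla qubits. -/
def measRotation (basis : A → PauliBasis) : GateLayer D A where
  Loc := D ⊕ A
  reg := id
  reg_surjective := Function.surjective_id
  reg_data _ _ h := Sum.inl_injective h
  reg_anc _ _ h := Sum.inr_injective h
  gate
    | Sum.inl _ => 1
    | Sum.inr k => match basis k with
      | PauliBasis.Z => 1
      | PauliBasis.X => ⟨hadamard _, Matrix.mem_unitaryGroup_iff'.2 hadamard_conjTranspose_mul_self⟩

variable (D A) in
/-- Computational basis measurement of every ancilla qubit. -/
def measureAncillas : SuperOp (D ⊕ A → ZMod 2) (D ⊕ A → ZMod 2) :=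
  tensorOp (regEquiv id) (regEquiv id) fun j : D ⊕ A => match j with
    | Sum.inl _ => LinearMap.id
    | Sum.inr _ => measZ _

lemma measureAncillas_apply (ρ : Matrix (D ⊕ A → ZMod 2) (D ⊕ A → ZMod 2) ℂ)
    {a b : D ⊕ A → ZMod 2} (hab : ∀ k, a (Sum.inr k) = b (Sum.inr k)) :
    measureAncillas D A ρ a b = ρ a b := by
  have h : ∀ c d, measureAncillas D A (Matrix.single c d 1) a b = Matrix.single c d (1 : ℂ) a b := by
    intro c d
    rw [single_eq_tensorMat (regEquiv id), measureAncillas, tensorOp_tensorMat]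
    refine Finset.prod_congr rfl fun j _ => ?_
    cases j with
    | inl q => rfl
    | inr k =>
      have hk : regEquiv id a (Sum.inr k) = regEquiv id b (Sum.inr k) := by
        funext w
        obtain ⟨w, hw⟩ := w
        obtain rfl : w = Sum.inr k := hw
        exact hab k
      exact if_pos hk
  rw [superOp_apply]
  conv_rhs => rw [Matrix.matrix_eq_sum_single ρ]
  simp only [h, Matrix.sum_apply]
  refine Finset.sum_congr rfl fun c _ => Finset.sum_congr rfl fun d _ => ?_
  simp [Matrix.single_apply]

lemma measLayer_gate_eq (basis : A → PauliBasis) (j : D ⊕ A) :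
    (measLayer D A basis).gate j = (match j with
      | Sum.inl _ => LinearMap.id
      | Sum.inr _ => measZ _ :
        SuperOp (Reg (id : D ⊕ A → D ⊕ A) j → ZMod 2) (Reg (id : D ⊕ A → D ⊕ A) j → ZMod 2)) ∘ₗ
        (measRotation basis : GateLayer D A).toLayer.gate j := by
  cases j with
  | inl q =>
    exact sandwich_one_one.symm
  | inr k =>
    change meas _ (basis k) = measZ _ ∘ₗ sandwich (Subtype.val (match basis k with
      | PauliBasis.Z => _
      | PauliBasis.X => _)) (Subtype.val (match basis k with
      | PauliBasis.Z => _
      | PauliBasis.X => _))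
    cases basis k with
    | Z =>
      exact (congrArg (LinearMap.comp (measZ _)) sandwich_one_one).symm
    | X => rfl

lemma measLayer_ideal (basis : A → PauliBasis) :
    (measLayer D A basis).ideal =
      measureAncillas D A ∘ₗ (measRotation basis : GateLayer D A).toLayer.ideal := by
  let G : ∀ j, SuperOp (Reg (id : D ⊕ A → D ⊕ A) j → ZMod 2) (Reg (id : D ⊕ A → D ⊕ A) j → ZMod 2) :=
    (measRotation basis : GateLayer D A).toLayer.gate
  have h0 : (measRotation basis : GateLayer D A).toLayer.ideal =
    tensorOp (regEquiv id) (regEquiv id) G := rfl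
  rw [h0, measureAncillas, tensorOp_comp]
  exact congrArg (tensorOp (regEquiv id) (regEquiv id)) (funext (measLayer_gate_eq basis))

/-- A faulty measurement with diagonal output is unchanged by a further computational basis
measurement. Its fault can thus be moved into the basis change that precedes a perfect measurement,
where the rule for unitary layers applies. -/
lemma measLayer_tensorOp_comp (basis : A → PauliBasis) {S : Finset (D ⊕ A)} {m x : ℕ}
    (hS : S.card ≤ m)
    {T : ∀ j, SuperOp (Reg (id : D ⊕ A → D ⊕ A) j → ZMod 2) (Reg (id : D ⊕ A → D ⊕ A) j → ZMod 2)}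
    (hT : ∀ j, j ∉ S → T j = (measLayer D A basis).gate j)
    (hclass : ∀ j, j ∈ S → ∀ ρ a b, (∃ w : Reg (id : D ⊕ A → D ⊕ A) j,
      w.1 ∈ (measLayer D A basis).classical ∧ a w ≠ b w) → T j ρ a b = 0)
    {H : Type} [Fintype H] {I X : SuperOp H (D ⊕ A → ZMod 2)} (hX : X ∈ errorSpan x I) :
    ∃ Y ∈ errorSpan (2 * x + m) ((measRotation basis).toLayer.ideal ∘ₗ I),
      tensorOp (regEquiv id) (regEquiv id) T ∘ₗ X = measureAncillas D A ∘ₗ Y := by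
  let G : ∀ j, SuperOp (Reg (id : D ⊕ A → D ⊕ A) j → ZMod 2) (Reg (id : D ⊕ A → D ⊕ A) j → ZMod 2) :=
    (measRotation basis : GateLayer D A).toLayer.gate
  let T' : ∀ j, SuperOp (Reg (id : D ⊕ A → D ⊕ A) j → ZMod 2) (Reg (id : D ⊕ A → D ⊕ A) j → ZMod 2) :=
    fun j => if j ∈ S then T j else G j
  refine ⟨_, GateLayer.tensorOp_comp_mem_errorSpan (measRotation basis) (S := S) (T := T') hS
    (fun j hj => if_neg hj) hX, ?_⟩
  rw [← LinearMap.comp_assoc]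
  congr 1
  change _ = measureAncillas D A ∘ₗ tensorOp (regEquiv id) (regEquiv id) T'
  rw [measureAncillas, tensorOp_comp]
  refine congrArg (tensorOp (regEquiv id) (regEquiv id)) (funext fun j => ?_)
  by_cases hj : j ∈ S
  · have h1 : T' j = T j := if_pos hj
    rw [h1]
    cases j with
    | inl q => rfl
    | inr k =>
      refine LinearMap.ext fun ρ => ?_
      ext a b
      by_cases hab : a = b
      · exact (if_pos hab).symm
      · refine Eq.trans ?_ (if_neg hab).symm
        obtain ⟨w, hw⟩ := Function.ne_iff.1 hab
        exact hclass _ hj ρ a b ⟨w, ⟨k, w.2.symm⟩, hw⟩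
  · have h1 : T' j = G j := if_neg hj
    rw [h1, hT j hj]
    exact measLayer_gate_eq basis j

end Circuit

lemma Layer.truncated_comp {W W' : Type} [Fintype W] [DecidableEq W] [Fintype W'] [DecidableEq W']
    (L : Layer W W') (N : ∀ j, SuperOp (Reg L.inReg j → ZMod 2) (Reg L.outReg j → ZMod 2))
    (m : ℕ) {H : Type} (X : SuperOp H (W → ZMod 2)) :
    L.truncated N m ∘ₗ X = ∑ S : Finset L.Loc with S.card ≤ m,
      tensorOp (regEquiv L.inReg) (regEquiv L.outReg) (S.piecewise (N - L.gate) L.gate) ∘ₗ X := by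
  refine LinearMap.ext fun ρ => ?_
  rw [LinearMap.sum_apply]
  exact LinearMap.sum_apply _ _ _

lemma card_le_of_mem_filter_univ {ι : Type} [Fintype ι] {m : ℕ} {S : Finset ι}
    (hS : S ∈ Finset.univ.filter fun S : Finset ι => S.card ≤ m) : S.card ≤ m :=
  (Finset.mem_filter.1 hS).2

/-! ### Truncation of whole circuits and growth of the error weight. -/

section NoisyCircuit

variable {D A : Type} [Fintype D] [DecidableEq D] [Fintype A] [DecidableEq A]

lemma prepLayer_truncated_mem_errorSpan (basis : A → PauliBasis)
    (N : ∀ j, SuperOp (Reg (prepLayer D A basis).inReg j → ZMod 2)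
      (Reg (prepLayer D A basis).outReg j → ZMod 2)) (m : ℕ) :
    (prepLayer D A basis).truncated N m ∈ errorSpan m (prepLayer D A basis).ideal := by
  refine sum_mem fun S hS => ?_
  exact prepLayer_tensorOp_mem_errorSpan basis (Finset.mem_filter.1 hS).2
    fun j hj => Finset.piecewise_eq_of_notMem _ _ _ hj

lemma GateLayer.truncated_comp_mem_errorSpan (G : GateLayer D A)
    (N : ∀ j, SuperOp (Reg G.toLayer.inReg j → ZMod 2) (Reg G.toLayer.outReg j → ZMod 2)) {m x : ℕ} {H : Type}
    [Fintype H] {I X : SuperOp H (D ⊕ A → ZMod 2)} (hX : X ∈ errorSpan x I) :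
    G.toLayer.truncated N m ∘ₗ X ∈ errorSpan (2 * x + m) (G.toLayer.ideal ∘ₗ I) := by
  rw [Layer.truncated_comp]
  refine sum_mem fun S hS => ?_
  exact G.tensorOp_comp_mem_errorSpan (Finset.mem_filter.1 hS).2
    (fun j hj => if_neg hj) hX

lemma measLayer_gate_classical (basis : A → PauliBasis) (j : D ⊕ A)
    (ρ : Matrix (Reg (id : D ⊕ A → D ⊕ A) j → ZMod 2) (Reg (id : D ⊕ A → D ⊕ A) j → ZMod 2) ℂ)
    (a b : Reg (id : D ⊕ A → D ⊕ A) j → ZMod 2)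
    (h : ∃ w : Reg (id : D ⊕ A → D ⊕ A) j, w.1 ∈ (measLayer D A basis).classical ∧ a w ≠ b w) :
    (measLayer D A basis).gate j ρ a b = 0 := by
  rw [measLayer_gate_eq]
  obtain ⟨w, ⟨k, hk⟩, hw⟩ := h
  cases j with
  | inl q =>
    have := hk.trans w.2
    simp at this
  | inr k =>
    have hab : a ≠ b := fun h => hw (congrFun h w)
    exact if_neg hab

lemma measLayer_truncated_comp (basis : A → PauliBasis) {δ : ℝ}
    {N : ∀ j, SuperOp (Reg (measLayer D A basis).inReg j → ZMod 2)
      (Reg (measLayer D A basis).outReg j → ZMod 2)}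
    (hN : ∀ j, (measLayer D A basis).IsNoisyGate δ j (N j)) {m x : ℕ} {H : Type} [Fintype H]
    {I X : SuperOp H (D ⊕ A → ZMod 2)} (hX : X ∈ errorSpan x I) :
    ∃ Y ∈ errorSpan (2 * x + m) ((measRotation basis).toLayer.ideal ∘ₗ I),
      (measLayer D A basis).truncated N m ∘ₗ X = measureAncillas D A ∘ₗ Y := by
  have h : ∀ S : Finset (D ⊕ A), S.card ≤ m →
      ∃ Y ∈ errorSpan (2 * x + m) ((measRotation basis).toLayer.ideal ∘ₗ I),
      tensorOp (regEquiv id) (regEquiv id) (S.piecewise (N - (measLayer D A basis).gate)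
        (measLayer D A basis).gate) ∘ₗ X = measureAncillas D A ∘ₗ Y := fun S hS => by
    refine measLayer_tensorOp_comp basis hS
      (fun j hj => Finset.piecewise_eq_of_notMem _ _ _ hj) (fun j hj ρ a b hab => ?_) hX
    have hp := Finset.piecewise_eq_of_mem S (N - (measLayer D A basis).gate)
      (measLayer D A basis).gate hj
    refine (congrArg (fun Z : SuperOp (Reg (id : D ⊕ A → D ⊕ A) j → ZMod 2)
      (Reg (id : D ⊕ A → D ⊕ A) j → ZMod 2) => Z ρ a b) hp).trans ?_
    -- A faulty factor of the expansion is a difference of gates; it keeps classical outputs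
    -- classical because both gates do.
    change N j ρ a b - (measLayer D A basis).gate j ρ a b = 0
    rw [(hN j).2.1 ρ a b hab, measLayer_gate_classical basis j ρ a b hab, sub_zero]
  choose! Y hY hYX using h
  refine ⟨∑ S : Finset (D ⊕ A) with S.card ≤ m, Y S,
    sum_mem fun S hS => hY S (Finset.mem_filter.1 hS).2, ?_⟩
  rw [Layer.truncated_comp]
  have hsum : measureAncillas D A ∘ₗ (∑ S : Finset (D ⊕ A) with S.card ≤ m, Y S) =
      ∑ S : Finset (D ⊕ A) with S.card ≤ m, measureAncillas D A ∘ₗ Y S := by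
    refine LinearMap.ext fun ρ => ?_
    simp only [LinearMap.sum_apply, LinearMap.comp_apply, map_sum]
  rw [hsum]
  refine Finset.sum_congr rfl fun S hS => hYX S ?_
  exact card_le_of_mem_filter_univ (ι := D ⊕ A) hS

/-- `T'` is only known to have norm at most 1 + b, which gives b + a(1 + b). In the form (1 + a)(1 +
b) - 1 the bound multiplies along the layers. -/
lemma DiamondLE.comp_sub_comp {I J K : Type} [Fintype I] [DecidableEq I] [Fintype J]
    [DecidableEq J] [Fintype K] [DecidableEq K] {S S' : SuperOp J K} {T T' : SuperOp I J}
    {a b : ℝ} (ha : 0 ≤ a) (hS : DiamondLE S 1) (hT : DiamondLE T 1)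
    (hSS : DiamondLE (S - S') a) (hTT : DiamondLE (T - T') b) :
    DiamondLE (S ∘ₗ T - S' ∘ₗ T') ((1 + a) * (1 + b) - 1) := by
  have h1 : DiamondLE T' (1 + b) := by
    have h := hT.add hTT.neg
    rwa [← sub_eq_add_neg, sub_sub_cancel] at h
  have h2 : S ∘ₗ T - S' ∘ₗ T' = S ∘ₗ (T - T') + (S - S') ∘ₗ T' := by
    rw [LinearMap.comp_sub, LinearMap.sub_comp]
    abel
  rw [h2]
  refine ((hS.comp zero_le_one hTT).add (hSS.comp ha h1)).mono (le_of_eq ?_)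
  ring

lemma GateLayer.card_loc_le (G : GateLayer D A) : Fintype.card G.Loc ≤ Fintype.card (D ⊕ A) :=
  Fintype.card_le_of_surjective G.reg G.reg_surjective

/-- The spreading property is stated for every incoming `X` with an error of every weight `y`, so
that the induction can prepend a layer and the result can be attached to the preparation. -/
lemma exists_truncated_transGates {x δ : ℝ} {m : ℕ} (hδ : 0 ≤ δ)
    (hx : (Fintype.card (D ⊕ A) : ℝ) ≤ 2 * x) (hm : 10 * (x * δ) ≤ m + 1)
    (Gs : List (GateLayer D A)) {T : SuperOp (D ⊕ A → ZMod 2) (D ⊕ A → ZMod 2)}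
    (hT : T ∈ transGates δ Gs) :
    DiamondLE T 1 ∧ ∃ T' : SuperOp (D ⊕ A → ZMod 2) (D ⊕ A → ZMod 2),
      DiamondLE (T - T') ((1 + Real.exp (-(x * δ))) ^ Gs.length - 1) ∧
      ∀ (H : Type) [Fintype H] (y : ℕ) (I X : SuperOp H (D ⊕ A → ZMod 2)), X ∈ errorSpan y I →
        T' ∘ₗ X ∈ errorSpan ((fun z => 2 * z + m)^[Gs.length] y) (idealGates Gs ∘ₗ I) := by
  induction Gs generalizing T with
  | nil =>
    obtain rfl : T = LinearMap.id := hT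
    refine ⟨diamondLE_id, LinearMap.id, ?_, fun H _ y I X hX => hX⟩
    simpa using diamondLE_zero
  | cons G Gs ih =>
    obtain ⟨T₁, hT₁, T₂, hT₂, rfl⟩ := hT
    obtain ⟨h2, T₂', h3, h4⟩ := ih hT₂
    have h1 := Layer.diamondLE_of_mem_trans hT₁
    obtain ⟨N, hN, rfl⟩ := hT₁
    refine ⟨by simpa using h2.comp zero_le_one h1, T₂' ∘ₗ G.toLayer.truncated N m, ?_,
      fun H _ y I X hX => ?_⟩
    · have h5 := G.toLayer.diamondLE_apply_sub_truncated hδ hN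
        (le_trans (by exact_mod_cast G.card_loc_le) hx) hm
      refine (h2.comp_sub_comp ?_ h1 h3 h5).mono (le_of_eq ?_)
      · rw [sub_nonneg]
        exact one_le_pow₀ (by linarith [Real.exp_pos (-(x * δ))])
      · rw [List.length_cons, pow_succ]
        ring
    · have h6 := h4 H _ _ _ (G.truncated_comp_mem_errorSpan N (m := m) hX)
      rw [List.length_cons, Function.iterate_succ_apply]
      exact h6

lemma idealGates_eq_sandwich (Gs : List (GateLayer D A)) :
    ∃ M : Matrix (D ⊕ A → ZMod 2) (D ⊕ A → ZMod 2) ℂ, idealGates Gs = sandwich M M := by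
  induction Gs with
  | nil => exact ⟨1, sandwich_one_one.symm⟩
  | cons G Gs ih =>
    obtain ⟨M, hM⟩ := ih
    refine ⟨M * tensorMat (regEquiv G.reg) (regEquiv G.reg) fun j => (G.gate j).1, ?_⟩
    rw [← sandwich_comp, ← tensorOp_sandwich, ← hM]
    rfl

lemma iterate_two_mul_add (m k y : ℕ) : (fun z => 2 * z + m)^[k] y + m = 2 ^ k * (y + m) := by
  induction k generalizing y with
  | zero => simp
  | succ k ih =>
    rw [Function.iterate_succ_apply, ih, pow_succ]
    ring

/-- A noisy circuit is close to the noiseless one up to an error of small weight before the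
measurement. -/
lemma AncillaCircuit.exists_truncated (Φ : AncillaCircuit D A) {x δ : ℝ} (hδ : 0 ≤ δ)
    (hx : (Fintype.card (D ⊕ A) : ℝ) ≤ 2 * x) :
    ∃ W : Matrix (D ⊕ A → ZMod 2) (D → ZMod 2) ℂ,
      Φ.ideal = measureAncillas D A ∘ₗ sandwich W W ∧
      ∀ T ∈ Φ.trans δ, DiamondLE T 1 ∧ ∃ (y : ℕ) (X : SuperOp (D → ZMod 2) (D ⊕ A → ZMod 2)),
        (y : ℝ) ≤ 10 * (x * δ) * 2 ^ Φ.depth ∧ X ∈ errorSpan y (sandwich W W) ∧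
        DiamondLE (T - measureAncillas D A ∘ₗ X)
          ((1 + Real.exp (-(x * δ))) ^ Φ.depth - 1) := by
  obtain ⟨M₁, hM₁⟩ := prepLayer_ideal_eq_sandwich (D := D) Φ.initBasis
  obtain ⟨M₂, hM₂⟩ := idealGates_eq_sandwich Φ.gates
  obtain ⟨M₃, hM₃⟩ := idealGates_eq_sandwich [(measRotation Φ.measBasis : GateLayer D A)]
  have hM₃' : (measRotation Φ.measBasis : GateLayer D A).toLayer.ideal = sandwich M₃ M₃ := hM₃
  refine ⟨M₃ * (M₂ * M₁), ?_, fun T hT => ?_⟩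
  · rw [← sandwich_comp, ← sandwich_comp, ← hM₁, ← hM₂, ← hM₃', AncillaCircuit.ideal,
      measLayer_ideal]
    rfl
  have hxδ : 0 ≤ x * δ := by
    have : (0 : ℝ) ≤ Fintype.card (D ⊕ A) := by positivity
    exact mul_nonneg (by linarith) hδ
  -- The tail estimate needs m + 1 ≥ 10xδ and the weight estimate m ≤ 10xδ; the floor satisfies
  -- both.
  set m := ⌊10 * (x * δ)⌋₊ with hm_def
  have hm : 10 * (x * δ) ≤ m + 1 := (Nat.lt_floor_add_one _).le
  have hm' : (m : ℝ) ≤ 10 * (x * δ) := Nat.floor_le (by positivity)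
  obtain ⟨T₁, hT₁, T₂, hT₂, T₃, hT₃, rfl⟩ := hT
  have h1 := Layer.diamondLE_of_mem_trans hT₁
  have h3 := Layer.diamondLE_of_mem_trans hT₃
  obtain ⟨h2, T₂', h4, h5⟩ := exists_truncated_transGates hδ hx hm _ hT₂
  obtain ⟨N₁, hN₁, rfl⟩ := hT₁
  obtain ⟨N₃, hN₃, rfl⟩ := hT₃
  have h6 := (prepLayer D A Φ.initBasis).diamondLE_apply_sub_truncated hδ hN₁ hx hm
  have h7 := (measLayer D A Φ.measBasis).diamondLE_apply_sub_truncated hδ hN₃ hx hm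
  have h21 : DiamondLE (T₂ ∘ₗ (prepLayer D A Φ.initBasis).apply N₁) 1 := by
    simpa using h2.comp zero_le_one h1
  refine ⟨by simpa using h3.comp zero_le_one h21, ?_⟩
  obtain ⟨Y, hY, hYe⟩ := measLayer_truncated_comp Φ.measBasis hN₃ (m := m)
    (h5 _ _ _ _ (prepLayer_truncated_mem_errorSpan Φ.initBasis N₁ m))
  have hexp := Real.exp_pos (-(x * δ))
  -- The preparation contributes m, every gate layer applies z ↦ 2z + m, and the measurement applies
  -- it once more. In total this is (2^d - 1)m, with d the depth.
  refine ⟨2 * (fun z => 2 * z + m)^[Φ.gates.length] m + m, Y, ?_, ?_, ?_⟩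
  rotate_left
  · rwa [← sandwich_comp, ← sandwich_comp, ← hM₁, ← hM₂, ← hM₃']
  · rw [← hYe]
    refine (h3.comp_sub_comp hexp.le h21 h7 (h2.comp_sub_comp ?_ h1 h4 h6)).mono (le_of_eq ?_)
    · rw [sub_nonneg]
      exact one_le_pow₀ (by linarith)
    · rw [AncillaCircuit.depth, pow_add]
      ring
  · have h8 := iterate_two_mul_add m Φ.gates.length m
    have h9 : 2 * (fun z => 2 * z + m)^[Φ.gates.length] m + m ≤ 2 ^ Φ.depth * m := by
      have : 2 ^ Φ.depth * m = 2 * (2 ^ Φ.gates.length * (m + m)) := by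
        rw [AncillaCircuit.depth, pow_add]
        ring
      omega
    have h10 : ((2 * (fun z => 2 * z + m)^[Φ.gates.length] m + m : ℕ) : ℝ) ≤ 2 ^ Φ.depth * m := by
      exact_mod_cast h9
    refine h10.trans ?_
    rw [mul_comm]
    exact mul_le_mul_of_nonneg_right hm' (by positivity)

end NoisyCircuit

/-! ## Correction of a single block -/

section Slices

variable {D A : Type} [Fintype D] [DecidableEq D] [Fintype A] [DecidableEq A]

lemma sum_data_ancilla (F : (D ⊕ A → ZMod 2) → ℂ) :
    ∑ c, F c = ∑ τ : A → ZMod 2, ∑ b : D → ZMod 2, F (Sum.elim b τ) := by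
  rw [← Equiv.sum_comp (Equiv.sumArrowEquivProdArrow D A (ZMod 2)).symm, Fintype.sum_prod_type,
    Finset.sum_comm]
  rfl

/-- The data part of a Pauli operator on data and ancilla qubits. -/
def PauliLabel.data (e : PauliLabel (D ⊕ A)) : PauliLabel D :=
  (fun q => e.1 (Sum.inl q), fun q => e.2 (Sum.inl q))

/-- The ancilla part of a Pauli operator on data and ancilla qubits. -/
def PauliLabel.anc (e : PauliLabel (D ⊕ A)) : PauliLabel A :=
  (fun q => e.1 (Sum.inr q), fun q => e.2 (Sum.inr q))

lemma pauli_elim (e : PauliLabel (D ⊕ A)) (a b : D → ZMod 2) (σ τ : A → ZMod 2) :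
    pauli e (Sum.elim a σ) (Sum.elim b τ) = pauli e.data a b * pauli e.anc σ τ := by
  simp only [pauli_apply_prod, Fintype.prod_sum_type]
  rfl

/-- The projection of a vector on data and ancilla qubits to an ancilla basis state. -/
def ancSlice (x : (D ⊕ A → ZMod 2) → ℂ) (σ : A → ZMod 2) : (D → ZMod 2) → ℂ :=
  fun a => x (Sum.elim a σ)

lemma zmod_two_add_cancel {ι : Type} (x y : ι → ZMod 2) : x + y + y = x := by
  funext i
  rcases zmod_two_cases (x i) with h | h <;> rcases zmod_two_cases (y i) with h' | h' <;>
    simp [h, h', zmod_two_one_add_one]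

/-- A Pauli error shifts the ancilla basis states. -/
lemma ancSlice_pauli_mulVec (e : PauliLabel (D ⊕ A)) (σ : A → ZMod 2) :
    ∃ z : ℂ, ∀ x : (D ⊕ A → ZMod 2) → ℂ,
      ancSlice (pauli e *ᵥ x) σ = z • (pauli e.data *ᵥ ancSlice x (σ + e.anc.1)) := by
  refine ⟨pauli e.anc σ (σ + e.anc.1), fun x => ?_⟩
  funext a
  change ∑ c, pauli e (Sum.elim a σ) c * x c = pauli e.anc σ (σ + e.anc.1) *
    ∑ b, pauli e.data a b * x (Sum.elim b (σ + e.anc.1))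
  rw [sum_data_ancilla, Finset.sum_eq_single (σ + e.anc.1), Finset.mul_sum]
  · refine Finset.sum_congr rfl fun b _ => ?_
    rw [pauli_elim]
    ring
  · intro τ _ hτ
    refine Finset.sum_eq_zero fun b _ => ?_
    rw [pauli_elim, pauli_apply e.anc, if_neg]
    · simp
    · rintro rfl
      exact hτ (zmod_two_add_cancel _ _).symm
  · simp

end Slices

section Correct

variable {n lX lZ : ℕ} (dec : Decoder n lX lZ)

lemma Decoder.uec_elim (a b : Fin n → ZMod 2) (σ τ : Anc lX lZ → ZMod 2) :
    dec.Uec (Sum.elim a σ) (Sum.elim b τ) = if σ = τ then pauli (dec σ) a b else 0 := by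
  by_cases h : σ = τ
  · rw [if_pos h]
    exact if_pos fun k => congrFun h k
  · rw [if_neg h]
    exact if_neg fun h' => h (funext h')

lemma Decoder.ancSlice_uec_mulVec (x : (Fin n ⊕ Anc lX lZ → ZMod 2) → ℂ)
    (σ : Anc lX lZ → ZMod 2) :
    ancSlice (dec.Uec *ᵥ x) σ = pauli (dec σ) *ᵥ ancSlice x σ := by
  funext a
  change ∑ c, dec.Uec (Sum.elim a σ) c * x c = ∑ b, pauli (dec σ) a b * x (Sum.elim b σ)
  rw [sum_data_ancilla, Finset.sum_eq_single σ]
  · simp only [uec_elim, if_true]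
  · intro τ _ hτ
    simp [uec_elim, Ne.symm hτ]
  · simp

lemma elim_eq_elim {D A γ : Type} {a b : D → γ} {σ τ : A → γ} :
    Sum.elim a σ = Sum.elim b τ ↔ a = b ∧ σ = τ :=
  ⟨fun h => ⟨funext fun q => congrFun h (Sum.inl q), funext fun q => congrFun h (Sum.inr q)⟩,
    fun h => by rw [h.1, h.2]⟩

/-- The Kraus operators of the correction. -/
def Decoder.kraus (σ : Anc lX lZ → ZMod 2) :
    Matrix (Fin n → ZMod 2) (Fin n ⊕ Anc lX lZ → ZMod 2) ℂ :=
  Matrix.of fun a c => dec.Uec (Sum.elim a σ) c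

lemma Decoder.correct_apply
    (ρ : Matrix (Fin n ⊕ Anc lX lZ → ZMod 2) (Fin n ⊕ Anc lX lZ → ZMod 2) ℂ) :
    dec.correct ρ = ∑ σ, dec.kraus σ * ρ * (dec.kraus σ)ᴴ := by
  ext a b
  rw [Matrix.sum_apply]
  rfl

lemma Decoder.sum_kraus : ∑ σ, (dec.kraus σ)ᴴ * dec.kraus σ = 1 := by
  ext c d
  obtain ⟨⟨a, σ⟩, rfl⟩ := (Equiv.sumArrowEquivProdArrow _ _ (ZMod 2)).symm.surjective c
  obtain ⟨⟨b, τ⟩, rfl⟩ := (Equiv.sumArrowEquivProdArrow _ _ (ZMod 2)).symm.surjective d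
  change (∑ σ, (dec.kraus σ)ᴴ * dec.kraus σ) (Sum.elim a σ) (Sum.elim b τ) =
    (1 : Matrix _ _ ℂ) (Sum.elim a σ) (Sum.elim b τ)
  have h : ∀ σ', ((dec.kraus σ')ᴴ * dec.kraus σ') (Sum.elim a σ) (Sum.elim b τ) =
      if σ' = σ then (if σ' = τ then (1 : Matrix _ _ ℂ) a b else 0) else 0 := fun σ' => by
    rw [← pauli_conjTranspose_mul_self (dec σ'), Matrix.mul_apply, Matrix.mul_apply]
    simp only [Matrix.conjTranspose_apply, kraus, Matrix.of_apply, uec_elim]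
    by_cases h1 : σ' = σ
    · by_cases h2 : σ' = τ
      · simp only [if_pos h1, if_pos h2]
      · simp only [if_pos h1, if_neg h2, mul_zero, Finset.sum_const_zero]
    · simp only [if_neg h1, star_zero, zero_mul, Finset.sum_const_zero]
  rw [Matrix.sum_apply]
  simp only [h, Finset.sum_ite_eq', Finset.mem_univ, if_true, Matrix.one_apply,
    elim_eq_elim]
  by_cases h1 : σ = τ <;> by_cases h2 : a = b <;> simp [h1, h2]

lemma Decoder.diamondLE_correct : DiamondLE dec.correct 1 :=
  diamondLE_of_kraus dec.correct_apply dec.sum_kraus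

/-- The correction is controlled by the ancilla basis states and the ancillas are then traced out,
so only entries diagonal in the ancillas contribute. This allows the perfect final measurement to be
dropped. -/
lemma Decoder.correct_measureAncillas
    (ρ : Matrix (Fin n ⊕ Anc lX lZ → ZMod 2) (Fin n ⊕ Anc lX lZ → ZMod 2) ℂ) :
    dec.correct (measureAncillas _ _ ρ) = dec.correct ρ := by
  rw [correct_apply, correct_apply]
  refine Finset.sum_congr rfl fun σ _ => ?_
  ext a b
  simp only [Matrix.mul_apply, Finset.sum_mul, Matrix.conjTranspose_apply, kraus, Matrix.of_apply]
  refine Finset.sum_congr rfl fun d _ => Finset.sum_congr rfl fun c _ => ?_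
  by_cases h1 : ∀ k, c (Sum.inr k) = σ k
  · by_cases h2 : ∀ k, d (Sum.inr k) = σ k
    · rw [measureAncillas_apply _ fun k => (h1 k).trans (h2 k).symm]
    · have : dec.Uec (Sum.elim b σ) d = 0 := if_neg fun h => h2 fun k => (h k).symm
      simp [this]
  · have : dec.Uec (Sum.elim a σ) c = 0 := if_neg fun h => h1 fun k => (h k).symm
    simp [this]

lemma Decoder.correct_vecMulVec (x y : (Fin n ⊕ Anc lX lZ → ZMod 2) → ℂ) :
    dec.correct (Matrix.vecMulVec x (star y)) =
      ∑ σ, Matrix.vecMulVec (pauli (dec σ) *ᵥ ancSlice x σ)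
        (star (pauli (dec σ) *ᵥ ancSlice y σ)) := by
  rw [correct_apply]
  refine Finset.sum_congr rfl fun σ _ => ?_
  rw [← ancSlice_uec_mulVec, ← ancSlice_uec_mulVec]
  exact sandwich_vecMulVec (dec.kraus σ) (dec.kraus σ) x y

end Correct

/-! ### The single-shot property applied to residual circuit errors. -/

section SingleShot

variable {n lX lZ : ℕ} (C : CSSCode n lX lZ)

/-- The span of the superoperators `P (·) Q†` with Pauli operators of reduced weight at most `t`. -/
def CSSCode.reducedSpan (t : ℝ) : Submodule ℂ (SuperOp (Fin n → ZMod 2) (Fin n → ZMod 2)) :=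
  Submodule.span ℂ {X | ∃ e f : PauliLabel (Fin n),
    ((C.redWeight e : ℝ) ≤ t ∧ (C.redWeight f : ℝ) ≤ t) ∧ X = sandwich (pauli e) (pauli f)}

/-- The stabilizer optimal for `e` is also used for `d + e`; the triangle inequality for the Hamming
distance does the rest. -/
lemma sInf_hammingNorm_add_le (M : Submodule (ZMod 2) (Fin n → ZMod 2)) (d e : Fin n → ZMod 2) :
    sInf {w | ∃ s ∈ M, hammingNorm (d + e + s) = w} ≤
      sInf {w | ∃ s ∈ M, hammingNorm (e + s) = w} + hammingNorm d := by
  obtain ⟨s, hs, hs'⟩ := Nat.sInf_mem (s := {w | ∃ s ∈ M, hammingNorm (e + s) = w})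
    ⟨_, 0, M.zero_mem, rfl⟩
  rw [← hs']
  refine (Nat.sInf_le (s := {w | ∃ s ∈ M, hammingNorm (d + e + s) = w}) ⟨s, hs, rfl⟩).trans ?_
  have h := hammingDist_triangle (d + e + s) (e + s) 0
  rw [hammingDist_zero_right, hammingDist_zero_right, hammingDist_eq_hammingNorm,
    show -(d + e + s) + (e + s) = d from
      (by abel : _ = -d).trans (funext fun i => ZMod.neg_eq_self_mod_two _)] at h
  omega

lemma CSSCode.redWeight_add_le (d e : PauliLabel (Fin n)) {y : ℕ} (h1 : hammingNorm d.1 ≤ y)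
    (h2 : hammingNorm d.2 ≤ y) : C.redWeight (d + e) ≤ C.redWeight e + y := by
  have h3 := sInf_hammingNorm_add_le C.stabX d.1 e.1
  have h4 := sInf_hammingNorm_add_le C.stabZ d.2 e.2
  refine max_le ?_ ?_
  · exact h3.trans (add_le_add (le_max_left _ _) h1)
  · exact h4.trans (add_le_add (le_max_right _ _) h2)

/-- The Z part on the ancillas is left out: it only multiplies ancilla basis states by signs and
causes no syndrome error. -/
lemma PauliLabel.IsLocal.hammingNorm_le {A : Type} [Fintype A] [DecidableEq A] {y : ℕ}
    {e : PauliLabel (Fin n ⊕ A)} (he : e.IsLocal y) :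
    hammingNorm e.data.1 ≤ y ∧ hammingNorm e.data.2 ≤ y ∧ hammingNorm e.anc.1 ≤ y := by
  refine ⟨(Finset.card_le_card fun q hq => ?_).trans he.1,
    (Finset.card_le_card fun q hq => ?_).trans he.1,
    (Finset.card_le_card fun q hq => ?_).trans he.2⟩
  · exact Finset.mem_toLeft.2 (Finset.mem_filter.2 ⟨Finset.mem_univ _,
      Or.inl (Finset.mem_filter.1 hq).2⟩)
  · exact Finset.mem_toLeft.2 (Finset.mem_filter.2 ⟨Finset.mem_univ _,
      Or.inr (Finset.mem_filter.1 hq).2⟩)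
  · exact Finset.mem_toRight.2 (Finset.mem_filter.2 ⟨Finset.mem_univ _,
      Or.inl (Finset.mem_filter.1 hq).2⟩)

variable {C}

lemma ancSlice_withSyndrome {D A : Type} [Fintype A] (φ : (D → ZMod 2) → ℂ) (σ : A → ZMod 2) :
    ancSlice (withSyndrome φ σ) σ = φ := by
  funext a
  exact if_pos fun _ => rfl

/-- For one observed syndrome the corrected state is a Pauli error of small reduced weight applied
to the code state. -/
lemma Decoder.IsSingleShot.exists_pauli {dec : Decoder n lX lZ} {R S β : ℝ}
    (hdec : dec.IsSingleShot C R S β)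
    {W : Matrix (Fin n ⊕ Anc lX lZ → ZMod 2) (Fin n → ZMod 2) ℂ}
    (hW : ∀ σ : Anc lX lZ → ZMod 2, ∃ ω : ℂ, ∀ ψ, ancSlice (W *ᵥ ψ) σ = ω • (C.proj σ *ᵥ ψ))
    {y : ℕ} (hy : (y : ℝ) ≤ S * n) {e : PauliLabel (Fin n ⊕ Anc lX lZ)} (he : e.IsLocal y)
    {u : PauliLabel (Fin n)} (hu : (C.redWeight u : ℝ) ≤ β * S * n + R * n)
    (σ : Anc lX lZ → ZMod 2) :
    ∃ (z : ℂ) (e' : PauliLabel (Fin n)), (C.redWeight e' : ℝ) ≤ β * S * n + y ∧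
      ∀ φ ∈ C.codeSpace, pauli (dec σ) *ᵥ ancSlice (pauli e *ᵥ (W *ᵥ (pauli u *ᵥ φ))) σ =
        z • (pauli e' *ᵥ φ) := by
  obtain ⟨h1, h2, h3⟩ := he.hammingNorm_le
  -- The observed syndrome is σ, whereas the projector that acted is the one for σ + `e.anc.1`; the
  -- X part on the ancillas is exactly the syndrome error.
  obtain ⟨e', ε, he', -, h⟩ := hdec u e.anc.1 hu
    (le_trans (by exact_mod_cast h3) hy) σ
  obtain ⟨z₁, hz₁⟩ := ancSlice_pauli_mulVec e σ
  obtain ⟨ω, hω⟩ := hW (σ + e.anc.1)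
  obtain ⟨z₂, hz₂⟩ := pauli_mul_comm (dec σ) e.data
  -- The factors come from the ancilla shift, from W versus the projector, from commuting the
  -- correction past the data error, from the decoder, and from merging two Pauli operators. None
  -- depends on φ, so the outcome is one Pauli operator on the whole code space.
  refine ⟨z₁ * ω * z₂ * (if ∀ k, (σ + e.anc.1) k = C.syndrome u k then ε else 0) *
    sgn (∑ w, e.data.2 w * e'.1 w), e.data + e', ?_, fun φ hφ => ?_⟩
  · have := C.redWeight_add_le e.data e' h1 h2
    have h' : ((C.redWeight (e.data + e') : ℕ) : ℝ) ≤ C.redWeight e' + y := by exact_mod_cast this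
    linarith
  · have h4 := congrArg (fun x : (Fin n ⊕ Anc lX lZ → ZMod 2) → ℂ => ancSlice x σ) (h φ hφ)
    have h5 : pauli (dec σ) *ᵥ (C.proj (σ + e.anc.1) *ᵥ (pauli u *ᵥ φ)) =
        (if ∀ k, (σ + e.anc.1) k = C.syndrome u k then ε else 0) • (pauli e' *ᵥ φ) := by
      change ancSlice (dec.Uec *ᵥ withSyndrome _ σ) σ =
        (if ∀ k, (σ + e.anc.1) k = C.syndrome u k then ε else 0) •
          ancSlice (withSyndrome (pauli e' *ᵥ φ) σ) σ at h4
      rw [Decoder.ancSlice_uec_mulVec, ancSlice_withSyndrome, ancSlice_withSyndrome] at h4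
      exact h4
    rw [hz₁, hω, Matrix.mulVec_smul, Matrix.mulVec_smul, Matrix.mulVec_smul, Matrix.mulVec_mulVec,
      hz₂, Matrix.smul_mulVec, ← Matrix.mulVec_mulVec, h5, Matrix.mulVec_smul,
      Matrix.mulVec_mulVec, pauli_mul, Matrix.smul_mulVec]
    simp only [smul_smul]
    congr 1
    ring

lemma vecMulVec_smul_star {I J : Type} (x y : ℂ) (v : I → ℂ) (w : J → ℂ) :
    Matrix.vecMulVec (x • v) (star (y • w)) = (x * star y) • Matrix.vecMulVec v (star w) := by
  ext i j
  simp [Matrix.vecMulVec_apply]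
  ring

/-- The noisy syndrome extraction followed by the correction turns Pauli errors of moderate reduced
weight on code states into errors of small reduced weight. -/
lemma Decoder.IsSingleShot.exists_reducedSpan {dec : Decoder n lX lZ} {R S β : ℝ}
    (hdec : dec.IsSingleShot C R S β)
    {W : Matrix (Fin n ⊕ Anc lX lZ → ZMod 2) (Fin n → ZMod 2) ℂ}
    (hW : ∀ σ : Anc lX lZ → ZMod 2, ∃ ω : ℂ, ∀ ψ, ancSlice (W *ᵥ ψ) σ = ω • (C.proj σ *ᵥ ψ))
    {y : ℕ} (hy : (y : ℝ) ≤ S * n) {t : ℝ} (ht : β * S * n + y ≤ t)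
    {X : SuperOp (Fin n → ZMod 2) (Fin n ⊕ Anc lX lZ → ZMod 2)}
    (hX : X ∈ errorSpan y (sandwich W W))
    {u v : PauliLabel (Fin n)} (hu : (C.redWeight u : ℝ) ≤ β * S * n + R * n)
    (hv : (C.redWeight v : ℝ) ≤ β * S * n + R * n) :
    ∃ Q ∈ C.reducedSpan t, ∀ φ ∈ C.codeSpace, ∀ φ' ∈ C.codeSpace,
      (dec.correct ∘ₗ X) (sandwich (pauli u) (pauli v) (Matrix.vecMulVec φ (star φ'))) =
        Q (Matrix.vecMulVec φ (star φ')) := by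
  induction hX using Submodule.span_induction with
  | zero =>
    refine ⟨0, zero_mem _, fun φ _ φ' _ => ?_⟩
    rw [LinearMap.comp_zero]
    rfl
  | add X X' _ _ h h' =>
    obtain ⟨Q, hQ, hQe⟩ := h
    obtain ⟨Q', hQ', hQe'⟩ := h'
    refine ⟨Q + Q', add_mem hQ hQ', fun φ hφ φ' hφ' => ?_⟩
    rw [LinearMap.comp_add, LinearMap.add_apply, LinearMap.add_apply, hQe φ hφ φ' hφ',
      hQe' φ hφ φ' hφ']
  | smul c X _ h =>
    obtain ⟨Q, hQ, hQe⟩ := h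
    refine ⟨c • Q, Submodule.smul_mem _ _ hQ, fun φ hφ φ' hφ' => ?_⟩
    rw [LinearMap.comp_smul, LinearMap.smul_apply, LinearMap.smul_apply, hQe φ hφ φ' hφ']
  | mem X hX =>
    obtain ⟨e, f, ⟨he, hf⟩, rfl⟩ := hX
    choose z e' he' hz using fun σ => hdec.exists_pauli hW hy he hu σ
    choose z' f' hf' hz' using fun σ => hdec.exists_pauli hW hy hf hv σ
    refine ⟨∑ σ, (z σ * star (z' σ)) • sandwich (pauli (e' σ)) (pauli (f' σ)),
      sum_mem fun σ _ => Submodule.smul_mem _ _ (Submodule.subset_span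
        ⟨e' σ, f' σ, ⟨(he' σ).trans ht, (hf' σ).trans ht⟩, rfl⟩), fun φ hφ φ' hφ' => ?_⟩
    rw [LinearMap.comp_apply, LinearMap.comp_apply, sandwich_vecMulVec, sandwich_vecMulVec,
      sandwich_vecMulVec, Decoder.correct_vecMulVec, LinearMap.sum_apply]
    refine Finset.sum_congr rfl fun σ _ => ?_
    rw [hz σ φ hφ, hz' σ φ' hφ', vecMulVec_smul_star, LinearMap.smul_apply, sandwich_vecMulVec]

/-- Before the measurement, the ancilla basis states of an ideal syndrome extraction circuit are
proportional to the syndrome projections. -/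
lemma CSSCode.IsSyndromeExtraction.exists_smul_proj {Φ : AncillaCircuit (Fin n) (Anc lX lZ)}
    (hΦ : C.IsSyndromeExtraction Φ)
    {W : Matrix (Fin n ⊕ Anc lX lZ → ZMod 2) (Fin n → ZMod 2) ℂ}
    (hW : Φ.ideal = measureAncillas _ _ ∘ₗ sandwich W W) (σ : Anc lX lZ → ZMod 2) :
    ∃ ω : ℂ, ∀ ψ, ancSlice (W *ᵥ ψ) σ = ω • (C.proj σ *ᵥ ψ) := by
  -- Evaluating both descriptions of the ideal circuit on matrix units equates two products of
  -- entries; fixing one nonzero entry of W then forces proportionality.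
  have key : ∀ a c b d, W (Sum.elim a σ) c * star (W (Sum.elim b σ) d) =
      C.proj σ a c * C.proj σ d b := fun a c b d => by
    have h := (hΦ (Matrix.single c d 1) (Sum.elim a σ) (Sum.elim b σ)).trans (if_pos fun _ => rfl)
    rw [hW, LinearMap.comp_apply, measureAncillas_apply _ (a := Sum.elim a σ) (b := Sum.elim b σ)
      fun _ => rfl, sandwich_single] at h
    rw [h]
    change (C.proj σ * Matrix.single c d (1 : ℂ) * C.proj σ) a b = _
    simp [Matrix.mul_apply, Matrix.single_apply, ite_and]
  have h0 : ∃ ω : ℂ, ∀ a c, W (Sum.elim a σ) c = ω * C.proj σ a c := by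
    by_cases hz : ∀ b d, W (Sum.elim b σ) d = 0
    · exact ⟨0, fun a c => by rw [hz, zero_mul]⟩
    · push Not at hz
      obtain ⟨b, d, hbd⟩ := hz
      have hbd' : star (W (Sum.elim b σ) d) ≠ 0 := star_ne_zero.2 hbd
      refine ⟨C.proj σ d b / star (W (Sum.elim b σ) d), fun a c => ?_⟩
      rw [div_mul_eq_mul_div, eq_div_iff hbd', key, mul_comm]
  obtain ⟨ω, hω⟩ := h0
  refine ⟨ω, fun ψ => ?_⟩
  funext a
  change ∑ c, W (Sum.elim a σ) c * ψ c = ω * ∑ c, C.proj σ a c * ψ c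
  simp only [hω, Finset.mul_sum, mul_assoc]

end SingleShot

/-! ## Several blocks -/

/-- The operator ZX in the definition is the adjoint of XZ, so the partial trace is a
Hilbert–Schmidt inner product on the block. -/
lemma pauliCoeff_apply {n : ℕ} {N : Type}
    (M : Matrix (N × (Fin n → ZMod 2)) (N × (Fin n → ZMod 2)) ℂ) (e : PauliLabel (Fin n)) (x y : N) :
    pauliCoeff M e x y =
      ((2 : ℂ) ^ n)⁻¹ * hsInner (pauli e) (Matrix.of fun u v => M (x, u) (y, v)) := by
  have h : ∀ u v, (Zop e.2 * Xop e.1) v u = star (pauli e u v) := fun u v => by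
    rw [pauli_apply, Matrix.mul_apply, Finset.sum_eq_single v]
    · have h : v = u + e.1 ↔ u = v + e.1 :=
        ⟨fun h => by rw [h, zmod_two_add_cancel], fun h => by rw [h, zmod_two_add_cancel]⟩
      by_cases h' : u = v + e.1
      · rw [if_pos h', star_sgn]
        simp [Zop, Xop, ← Pi.add_apply, ← funext_iff, h.2 h']
      · rw [if_neg h']
        simp only [Xop, Matrix.of_apply, ← Pi.add_apply, ← funext_iff, h, if_neg h', mul_zero,
          star_zero]
    · intro c _ hc
      simp [Zop, ← funext_iff, Ne.symm hc]
    · simp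
  simp only [pauliCoeff, hsInner, Matrix.of_apply, h, mul_comm]

section Blocks

variable {n h : ℕ}

/-- Pauli operators on `h` blocks of `n` qubits. -/
def blockPauli (E : Fin h → PauliLabel (Fin n)) : Matrix (Blocks h n) (Blocks h n) ℂ :=
  tensorMat (I := fun _ => Fin n → ZMod 2) (J := fun _ => Fin n → ZMod 2)
    (Equiv.refl _) (Equiv.refl _) fun i => pauli (E i)

lemma isComplete_blockPauli :
    IsComplete (blockPauli (n := n) (h := h)) ((2 ^ Fintype.card (Fin n)) ^ Fintype.card (Fin h)) :=
  isComplete_pauli.tensorMat (Equiv.refl (Blocks h n))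

lemma blockPauli_apply (E : Fin h → PauliLabel (Fin n)) (i : Fin h) (a c : Blocks h n) :
    blockPauli E a c =
      (∏ k : {k // k ≠ i}, pauli (E k) ((splitBlock i a).1 k) ((splitBlock i c).1 k)) *
        pauli (E i) (splitBlock i a).2 (splitBlock i c).2 := by
  rw [mul_comm]
  exact Fintype.prod_eq_mul_prod_subtype_ne (fun k => pauli (E k) (a k) (c k)) i

/-- The Hilbert-Schmidt inner product with a Pauli operator on all blocks, from the coefficients with
respect to one block. -/
lemma hsInner_blockPauli (E : Fin h → PauliLabel (Fin n)) (i : Fin h)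
    (M : Matrix (Blocks h n) (Blocks h n) ℂ) :
    hsInner (blockPauli E) M = ∑ x, ∑ y,
      star (∏ k : {k // k ≠ i}, pauli (E k) (x k) (y k)) *
        hsInner (pauli (E i)) (Matrix.of fun u v =>
          Matrix.reindex (splitBlock i) (splitBlock i) M (x, u) (y, v)) := by
  set G : ({k : Fin h // k ≠ i} → Fin n → ZMod 2) × (Fin n → ZMod 2) →
      ({k : Fin h // k ≠ i} → Fin n → ZMod 2) × (Fin n → ZMod 2) → ℂ := fun p q =>
    star (∏ k : {k // k ≠ i}, pauli (E k) (p.1 k) (q.1 k)) *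
      (star (pauli (E i) p.2 q.2) * Matrix.reindex (splitBlock i) (splitBlock i) M p q)
  have h1 : ∀ a c, star (blockPauli E a c) * M a c = G (splitBlock i a) (splitBlock i c) :=
    fun a c => by
      have h3 : M a c = Matrix.reindex (splitBlock i) (splitBlock i) M (splitBlock i a)
          (splitBlock i c) :=
        congrArg₂ M ((splitBlock i).symm_apply_apply a).symm ((splitBlock i).symm_apply_apply c).symm
      rw [blockPauli_apply E i, star_mul', mul_assoc, h3]
  have h2 : hsInner (blockPauli E) M = ∑ p, ∑ q, G p q := by
    rw [hsInner, ← Equiv.sum_comp (splitBlock i)]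
    refine Finset.sum_congr rfl fun a _ => ?_
    rw [← Equiv.sum_comp (splitBlock i)]
    exact Finset.sum_congr rfl fun c _ => h1 a c
  rw [h2]
  simp only [Fintype.sum_prod_type, hsInner, Finset.mul_sum, Matrix.of_apply]
  refine Finset.sum_congr rfl fun x _ => ?_
  rw [Finset.sum_comm]

variable {lX lZ : ℕ} (C : CSSCode n lX lZ)

lemma CSSCode.redWeight_le_of_hsInner_ne_zero {E : Fin h → PauliLabel (Fin n)}
    {M : Matrix (Blocks h n) (Blocks h n) ℂ} (hM : hsInner (blockPauli E) M ≠ 0) (i : Fin h) :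
    C.redWeight (E i) ≤ C.blockRedWeight i M := by
  refine Finset.le_sup (f := C.redWeight) 
    ((@Finset.mem_filter _ _ (_) _ _).2 ⟨Finset.mem_univ _, fun h0 => hM ?_⟩)
  rw [hsInner_blockPauli E i]
  refine Finset.sum_eq_zero fun x _ => Finset.sum_eq_zero fun y _ => ?_
  have h1 := congrFun (congrFun h0 x) y
  rw [pauliCoeff_apply] at h1
  rw [(mul_eq_zero.1 h1).resolve_left (inv_ne_zero (pow_ne_zero _ two_ne_zero)), mul_zero]

lemma CSSCode.blockRedWeight_smul_blockPauli_le (z : ℂ) (E : Fin h → PauliLabel (Fin n))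
    (i : Fin h) : C.blockRedWeight i (z • blockPauli E) ≤ C.redWeight (E i) := by
  refine Finset.sup_le fun e he => ?_
  suffices h : e = E i by rw [h]
  by_contra hne
  refine ((@Finset.mem_filter _ _ (_) _ _).1 he).2 ?_
  ext x y
  have h1 : (Matrix.of fun u v => Matrix.reindex (splitBlock i) (splitBlock i) (z • blockPauli E)
      (x, u) (y, v)) =
      (z * ∏ k : {k // k ≠ i}, pauli (E k) (x k) (y k)) • pauli (E i) := by
    ext u v
    simp only [Matrix.of_apply, Matrix.reindex_apply, Matrix.submatrix_apply, Matrix.smul_apply,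
      blockPauli_apply E i, Equiv.apply_symm_apply, smul_eq_mul, mul_assoc]
  have h2 : ∀ (w : ℂ) (P M : Matrix (Fin n → ZMod 2) (Fin n → ZMod 2) ℂ),
      hsInner P (w • M) = w * hsInner P M := fun w P M => by
    simp only [hsInner, Matrix.smul_apply, smul_eq_mul, Finset.mul_sum, mul_left_comm]
  rw [pauliCoeff_apply, h1, h2, hsInner_pauli, if_neg hne, mul_zero, mul_zero, Matrix.zero_apply]

/-- The span of the superoperators `P (·) Q†` with Pauli operators of reduced weight at most `t` on
every block. -/
def CSSCode.blockReducedSpan (h : ℕ) (t : ℝ) : Submodule ℂ (SuperOp (Blocks h n) (Blocks h n)) :=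
  Submodule.span ℂ {X | ∃ E F : Fin h → PauliLabel (Fin n),
    (∀ i, (C.redWeight (E i) : ℝ) ≤ t ∧ (C.redWeight (F i) : ℝ) ≤ t) ∧
      X = sandwich (blockPauli E) (blockPauli F)}

variable {C}

lemma CSSCode.redWeightLE_of_mem_blockReducedSpan {t : ℝ} {V : SuperOp (Blocks h n) (Blocks h n)}
    (hV : V ∈ C.blockReducedSpan h t) (i : Fin h) : C.RedWeightLE i V t := by
  obtain ⟨r, z, X, rfl⟩ := Submodule.mem_span_set'.1 hV
  choose E F hEF hX using fun k => (X k).2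
  refine ⟨r, fun k => z k • blockPauli (E k), fun k => (1 : ℂ) • blockPauli (F k),
    Finset.sum_congr rfl fun k _ => ?_, fun k => ⟨?_, ?_⟩⟩
  · rw [sandwich_smul_smul, star_one, mul_one, hX]
  · exact (Nat.cast_le.2 (C.blockRedWeight_smul_blockPauli_le (z k) (E k) i)).trans (hEF k i).1
  · exact (Nat.cast_le.2 (C.blockRedWeight_smul_blockPauli_le 1 (F k) i)).trans (hEF k i).2

lemma CSSCode.RedWeightLE.of_superInner_ne_zero {t : ℝ} {V : SuperOp (Blocks h n) (Blocks h n)}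
    {i : Fin h} (hV : C.RedWeightLE i V t) {E F : Fin h → PauliLabel (Fin n)}
    (hEF : superInner (blockPauli E) (blockPauli F) V ≠ 0) :
    (C.redWeight (E i) : ℝ) ≤ t ∧ (C.redWeight (F i) : ℝ) ≤ t := by
  obtain ⟨r, M, N, rfl, hMN⟩ := hV
  rw [map_sum] at hEF
  obtain ⟨k, -, hk⟩ := Finset.exists_ne_zero_of_sum_ne_zero hEF
  rw [superInner_sandwich] at hk
  refine ⟨le_trans ?_ (hMN k).1, le_trans ?_ (hMN k).2⟩
  · exact_mod_cast C.redWeight_le_of_hsInner_ne_zero (left_ne_zero_of_mul hk) i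
  · exact_mod_cast C.redWeight_le_of_hsInner_ne_zero (star_ne_zero.1 (right_ne_zero_of_mul hk)) i

/-- The hypothesis offers a possibly different decomposition of `V` for each block. The Pauli
coefficients of `V` itself do not depend on the decomposition, so a nonzero one satisfies the weight
bounds of all blocks at once. -/
lemma CSSCode.mem_blockReducedSpan {t : ℝ} {V : SuperOp (Blocks h n) (Blocks h n)}
    (hV : ∀ i, C.RedWeightLE i V t) : V ∈ C.blockReducedSpan h t := by
  rw [isComplete_blockPauli.superOp_eq_sum (pow_ne_zero _ (two_pow_card_ne_zero _)) V]
  refine sum_mem fun E _ => sum_mem fun F _ => ?_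
  by_cases h0 : superInner (blockPauli E) (blockPauli F) V = 0
  · rw [h0, mul_zero, zero_smul]
    exact zero_mem _
  · exact Submodule.smul_mem _ _ (Submodule.subset_span
      ⟨E, F, fun i => (hV i).of_superInner_ne_zero h0, rfl⟩)

lemma blockTensor_sandwich_pauli (E F : Fin h → PauliLabel (Fin n)) :
    blockTensor (fun i => sandwich (pauli (E i)) (pauli (F i))) =
      sandwich (blockPauli E) (blockPauli F) :=
  tensorOp_sandwich _ _ _ _

lemma CSSCode.blockTensor_mem_blockReducedSpan {t : ℝ}
    {Q : Fin h → SuperOp (Fin n → ZMod 2) (Fin n → ZMod 2)} (hQ : ∀ i, Q i ∈ C.reducedSpan t) :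
    blockTensor Q ∈ C.blockReducedSpan h t := by
  have h1 := multilinearMap_mem_span (tensorOpMultilinear (Equiv.refl (Blocks h n)) (Equiv.refl _))
    (fun _ => _) Q hQ
  refine Submodule.span_mono ?_ h1
  rintro _ ⟨x, hx, rfl⟩
  choose E F hEF hx' using hx
  refine ⟨E, F, hEF, ?_⟩
  rw [← blockTensor_sandwich_pauli, ← funext hx']
  rfl

/-- Tensor products of superoperators that agree on the code space agree on the product code
space. -/
lemma CSSCode.blockTensor_apply_eq {S Q : Fin h → SuperOp (Fin n → ZMod 2) (Fin n → ZMod 2)}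
    (hSQ : ∀ i, ∀ φ ∈ C.codeSpace, ∀ φ' ∈ C.codeSpace,
      S i (Matrix.vecMulVec φ (star φ')) = Q i (Matrix.vecMulVec φ (star φ')))
    {ψ ψ' : Blocks h n → ℂ} (hψ : ψ ∈ C.blockCodeSpace h) (hψ' : ψ' ∈ C.blockCodeSpace h) :
    blockTensor S (Matrix.vecMulVec ψ (star ψ')) = blockTensor Q (Matrix.vecMulVec ψ (star ψ')) := by
  -- Entangled code states are combinations of products. Ket and bra are expanded independently,
  -- hence the use of two different vectors ψ and ψ'.
  induction hψ using Submodule.span_induction with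
  | zero => simp only [Matrix.zero_vecMulVec, map_zero]
  | add x y _ _ hx hy => simp only [Matrix.add_vecMulVec, map_add, hx, hy]
  | smul z x _ hx => simp only [Matrix.smul_vecMulVec, map_smul, hx]
  | mem x hx =>
    obtain ⟨φ, hφ, rfl⟩ := hx
    induction hψ' using Submodule.span_induction with
    | zero => simp only [star_zero, Matrix.vecMulVec_zero, map_zero]
    | add x y _ _ hx hy => simp only [star_add, Matrix.vecMulVec_add, map_add, hx, hy]
    | smul z x _ hx => simp only [star_smul, Matrix.vecMulVec_smul, map_smul, hx]
    | mem y hy =>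
      obtain ⟨φ', hφ', rfl⟩ := hy
      have h1 : Matrix.vecMulVec (fun a : Blocks h n => ∏ i, φ i (a i))
          (star fun a : Blocks h n => ∏ i, φ' i (a i)) =
          tensorMat (I := fun _ => Fin n → ZMod 2) (J := fun _ => Fin n → ZMod 2) (Equiv.refl _)
            (Equiv.refl _) fun i => Matrix.vecMulVec (φ i) (star (φ' i)) := by
        ext a b
        simp [Matrix.vecMulVec_apply, tensorMat, Finset.prod_mul_distrib]
      rw [h1, blockTensor, blockTensor, tensorOp_tensorMat, tensorOp_tensorMat]
      simp only [hSQ _ _ (hφ _) _ (hφ' _)]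

/-- If each factor turns Pauli errors of reduced weight at most `t₀` on code states into errors of
reduced weight at most `t`, so does the tensor product. -/
lemma CSSCode.exists_blockReducedSpan {t₀ t : ℝ}
    {S : Fin h → SuperOp (Fin n → ZMod 2) (Fin n → ZMod 2)}
    (hS : ∀ i, ∀ u v : PauliLabel (Fin n), (C.redWeight u : ℝ) ≤ t₀ → (C.redWeight v : ℝ) ≤ t₀ →
      ∃ Q ∈ C.reducedSpan t, ∀ φ ∈ C.codeSpace, ∀ φ' ∈ C.codeSpace,
        S i (sandwich (pauli u) (pauli v) (Matrix.vecMulVec φ (star φ'))) =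
          Q (Matrix.vecMulVec φ (star φ')))
    {V : SuperOp (Blocks h n) (Blocks h n)} (hV : V ∈ C.blockReducedSpan h t₀) :
    ∃ V' ∈ C.blockReducedSpan h t, ∀ ψ ∈ C.blockCodeSpace h,
      blockTensor S (V (ketBra ψ)) = V' (ketBra ψ) := by
  induction hV using Submodule.span_induction with
  | zero => exact ⟨0, zero_mem _, fun ψ _ => map_zero _⟩
  | add X Y _ _ hX hY =>
    obtain ⟨X', hX', hX⟩ := hX
    obtain ⟨Y', hY', hY⟩ := hY
    exact ⟨X' + Y', add_mem hX' hY', fun ψ hψ => by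
      rw [LinearMap.add_apply, map_add, hX ψ hψ, hY ψ hψ, LinearMap.add_apply]⟩
  | smul z X _ hX =>
    obtain ⟨X', hX', hX⟩ := hX
    exact ⟨z • X', Submodule.smul_mem _ _ hX', fun ψ hψ => by
      rw [LinearMap.smul_apply, map_smul, hX ψ hψ, LinearMap.smul_apply]⟩
  | mem X hX =>
    obtain ⟨E, F, hEF, rfl⟩ := hX
    choose Q hQ hQe using fun i => hS i (E i) (F i) (hEF i).1 (hEF i).2
    refine ⟨blockTensor Q, blockTensor_mem_blockReducedSpan hQ, fun ψ hψ => ?_⟩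
    rw [← blockTensor_sandwich_pauli, ← LinearMap.comp_apply, blockTensor, blockTensor,
      tensorOp_comp]
    exact blockTensor_apply_eq (S := fun i => S i ∘ₗ sandwich (pauli (E i)) (pauli (F i))) hQe hψ hψ

end Blocks

/-! ### Total error over all blocks, and the theorem. -/

/-- Expand S = T - (T - S) over subsets of the factors. The empty subset gives the tensor product of
the `T j`, and the others contribute c^|s| because the `T j` have norm at most 1. -/
lemma DiamondLE.tensorOp_sub_tensorOp {ι : Type} [Fintype ι] [DecidableEq ι] {I J : ι → Type}
    [∀ j, Fintype (I j)] [∀ j, DecidableEq (I j)] [∀ j, Fintype (J j)] [∀ j, DecidableEq (J j)]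
    {K L : Type} [Fintype K] [DecidableEq K] [Fintype L] [DecidableEq L] (f : K ≃ ∀ j, I j)
    (g : L ≃ ∀ j, J j) {S T : ∀ j, SuperOp (I j) (J j)} {c : ℝ} (hc : 0 ≤ c)
    (hT : ∀ j, DiamondLE (T j) 1) (hST : ∀ j, DiamondLE (T j - S j) c) :
    DiamondLE (QEC.tensorOp f g T - QEC.tensorOp f g S) ((1 + c) ^ Fintype.card ι - 1) := by
  have h1 : S = fun j => -(T j - S j) + T j := by
    funext j
    abel
  have h2 : QEC.tensorOp f g T - QEC.tensorOp f g S = -∑ s ∈ Finset.univ.erase (∅ : Finset ι),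
      QEC.tensorOp f g (s.piecewise (fun j => -(T j - S j)) T) := by
    conv_lhs => rw [h1, tensorOp_add, ← Finset.add_sum_erase _ _ (Finset.mem_univ (∅ : Finset ι)),
      Finset.piecewise_empty]
    abel
  have h3 : (1 + c) ^ Fintype.card ι - 1 = ∑ s ∈ Finset.univ.erase (∅ : Finset ι), c ^ s.card := by
    rw [add_comm, ← Fintype.sum_pow_mul_eq_add_pow,
      ← Finset.add_sum_erase _ _ (Finset.mem_univ (∅ : Finset ι))]
    simp
  rw [h2, h3]
  refine (DiamondLE.sum _ fun s _ => ?_).neg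
  have h4 := DiamondLE.tensorOp f g (T := s.piecewise (fun j => -(T j - S j)) T)
    (c := s.piecewise (fun _ => c) fun _ => 1) (fun j => ?_) (fun j => ?_)
  · rwa [Finset.prod_piecewise, Finset.univ_inter, Finset.prod_const, Finset.prod_const_one,
      mul_one] at h4
  · by_cases hj : j ∈ s <;> simp [hj, hc]
  · by_cases hj : j ∈ s
    · simpa only [Finset.piecewise_eq_of_mem _ _ _ hj] using (hST j).neg
    · simpa only [Finset.piecewise_eq_of_notMem _ _ _ hj] using hT j

/-- With x = hdη, the power is at most exp(x), and exp(x) - 1 ≤ 2x for x ≤ 1, which `hexp` ensures.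
Strictness comes from 2 < e², as the right side is e²hdε. -/
lemma one_add_pow_sub_one_lt {η ε κ : ℝ} {d h : ℕ} (hη : 0 < η) (hηε : η ≤ ε) (hd : 0 < d)
    (hh : 0 < h) (hκ : κ = Real.exp 1 * d) (hexp : h * κ * Real.exp 1 * ε ≤ 1) :
    (1 + ((1 + η) ^ d - 1)) ^ h - 1 < h * κ * Real.exp 1 * ε := by
  subst hκ
  have he : 2 < Real.exp 1 := by linarith [Real.exp_one_gt_d9]
  have hd' : (0 : ℝ) < d := Nat.cast_pos.2 hd
  have hh' : (0 : ℝ) < h := Nat.cast_pos.2 hh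
  have hx : 0 < h * d * η := by positivity
  have hxε : h * d * η ≤ h * d * ε := mul_le_mul_of_nonneg_left hηε (by positivity)
  have he2 : 2 < Real.exp 1 * Real.exp 1 := by nlinarith
  have h0 : h * (Real.exp 1 * d) * Real.exp 1 * ε = Real.exp 1 * Real.exp 1 * (h * d * ε) := by ring
  rw [h0] at hexp ⊢
  have hx' : 0 < h * d * ε := hx.trans_le hxε
  have h1 : 2 * (h * d * ε) < Real.exp 1 * Real.exp 1 * (h * d * ε) :=
    mul_lt_mul_of_pos_right he2 hx'
  have h2 : (1 + ((1 + η) ^ d - 1)) ^ h ≤ Real.exp (h * d * η) := by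
    rw [add_sub_cancel, ← pow_mul, show (h : ℝ) * d * η = ((d * h : ℕ) : ℝ) * η by push_cast; ring,
      Real.exp_nat_mul]
    exact pow_le_pow_left₀ (by linarith) (by linarith [Real.add_one_le_exp η]) _
  have h3 := Real.abs_exp_sub_one_le (x := h * d * η) (by rw [abs_of_pos hx]; linarith)
  rw [abs_of_pos hx] at h3
  linarith [le_abs_self (Real.exp (h * d * η) - 1)]

end QEC

end

theorem mainTheorem2 {n lX lZ : ℕ} (C : QEC.CSSCode n lX lZ) (hl : lX + lZ < n)
    (r s : ℕ) (hC : C.IsQLDPC r s)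
    (Φ : QEC.AncillaCircuit (Fin n) (QEC.Anc lX lZ)) (hΦ : C.IsSyndromeExtraction Φ)
    (R S β : ℝ) (hR : 0 < R) (hS : 0 < S) (hβ : 0 < β)
    (hdist : β * S * n + R * n < (C.minDist : ℝ) / 2)
    (dec : QEC.Decoder n lX lZ) (hdec : dec.IsSingleShot C R S β)
    (δ : ℝ) (hδ0 : 0 ≤ δ) (hδ1 : δ ≤ 1) (hδ : 5 * δ * 2 ^ (Φ.depth + 1) ≤ S)
    (κ : ℝ) (hκ : κ = Real.exp 1 * Φ.depth)
    (h : ℕ) (hh : 0 < h)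
    (hexp : h * κ * Real.exp 1 * Real.exp (-(n * δ / 3)) ≤ 1)
    (V : QEC.SuperOp (QEC.Blocks h n) (QEC.Blocks h n))
    (hV : ∀ i, C.RedWeightLE i V (β * S * n + R * n))
    (T : Fin h → QEC.SuperOp (Fin n → ZMod 2) (Fin n ⊕ QEC.Anc lX lZ → ZMod 2))
    (hT : ∀ i, T i ∈ Φ.trans δ) :
    ∃ V' : QEC.SuperOp (QEC.Blocks h n) (QEC.Blocks h n),
      (∀ i, C.RedWeightLE i V' (β * S * n + 5 * n * δ * 2 ^ (Φ.depth + 1))) ∧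
      ∀ ψ ∈ C.blockCodeSpace h, ∑ a, ‖ψ a‖ ^ 2 = 1 →
        QEC.traceNorm (V (QEC.ketBra ψ)) ≤ 1 →
        QEC.traceNorm (QEC.blockTensor (fun i => dec.correct ∘ₗ T i) (V (QEC.ketBra ψ)) -
            V' (QEC.ketBra ψ)) <
          h * κ * Real.exp 1 * Real.exp (-(n * δ / 3)) := by
  have hcard : (Fintype.card (Fin n ⊕ QEC.Anc lX lZ) : ℝ) ≤ 2 * (n : ℝ) := by
    rw [Fintype.card_sum, Fintype.card_sum, Fintype.card_fin, Fintype.card_fin, Fintype.card_fin]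
    exact_mod_cast (by omega : n + (lX + lZ) ≤ 2 * n)
  obtain ⟨W, hW, hΦT⟩ := Φ.exists_truncated hδ0 hcard
  choose hT1 y X hy hX hTX using fun i => hΦT (T i) (hT i)
  have hy' : ∀ i, (y i : ℝ) ≤ 5 * n * δ * 2 ^ (Φ.depth + 1) := fun i =>
    (hy i).trans (le_of_eq (by ring))
  -- The assumption on δ is what makes every residual ancilla error an admissible syndrome error for
  -- the decoder.
  have hyS : ∀ i, (y i : ℝ) ≤ S * n := fun i => (hy' i).trans
    ((le_of_eq (by ring)).trans (mul_le_mul_of_nonneg_right hδ (Nat.cast_nonneg n)))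
  obtain ⟨V', hV', hVV'⟩ := QEC.CSSCode.exists_blockReducedSpan
    (S := fun i => dec.correct ∘ₗ X i)
    (fun i u v hu hv => hdec.exists_reducedSpan (hΦ.exists_smul_proj hW) (hyS i)
      (add_le_add_right (hy' i) (β * S * n)) (hX i) hu hv)
    (QEC.CSSCode.mem_blockReducedSpan hV)
  refine ⟨V', QEC.CSSCode.redWeightLE_of_mem_blockReducedSpan hV', fun ψ hψ _ hVψ => ?_⟩
  have hη := Real.exp_pos (-(n * δ))
  have hη1 : 0 ≤ (1 + Real.exp (-(n * δ))) ^ Φ.depth - 1 := by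
    rw [sub_nonneg]
    exact one_le_pow₀ (by linarith)
  have hD : QEC.DiamondLE (QEC.blockTensor (fun i => dec.correct ∘ₗ T i) -
      QEC.blockTensor fun i => dec.correct ∘ₗ X i)
      ((1 + ((1 + Real.exp (-(n * δ))) ^ Φ.depth - 1)) ^ h - 1) := by
    have h1 := QEC.DiamondLE.tensorOp_sub_tensorOp (Equiv.refl (QEC.Blocks h n)) (Equiv.refl _)
      (T := fun i => dec.correct ∘ₗ T i) (S := fun i => dec.correct ∘ₗ X i) hη1
      (fun i => by simpa using dec.diamondLE_correct.comp zero_le_one (hT1 i)) fun i => ?_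
    · rwa [Fintype.card_fin] at h1
    · have h2 := dec.diamondLE_correct.comp zero_le_one (hTX i)
      have h3 : dec.correct ∘ₗ (T i - QEC.measureAncillas _ _ ∘ₗ X i) =
          dec.correct ∘ₗ T i - dec.correct ∘ₗ X i := by
        refine LinearMap.ext fun ρ => ?_
        simp only [LinearMap.comp_apply, LinearMap.sub_apply, map_sub, dec.correct_measureAncillas]
      rwa [h3, one_mul] at h2
  have h4 := QEC.traceNorm_le_of_diamondLE hD (V (QEC.ketBra ψ))
  rw [LinearMap.sub_apply, hVV' ψ hψ] at h4
  have h5 : (1 : ℝ) ≤ (1 + ((1 + Real.exp (-(n * δ))) ^ Φ.depth - 1)) ^ h :=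
    one_le_pow₀ (by linarith)
  -- The truncation error per layer is exp(-nδ), smaller than the exp(-nδ/3) allowed.
  refine (h4.trans (mul_le_of_le_one_right (sub_nonneg.2 h5) hVψ)).trans_lt
    (QEC.one_add_pow_sub_one_lt hη (Real.exp_le_exp.2 ?_) (Nat.succ_pos _) hh hκ hexp)
  have : 0 ≤ n * δ := mul_nonneg (Nat.cast_nonneg n) hδ0
  linarith
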